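/- Let $k$ be an algebraically closed field of characteristic $3$. A Lie superalgebra $\mathfrak g=\mathfrak g_{\bar 0}\oplus\mathfrak g_{\bar 1}$ over $k$ has an even, super-anticommutative bracket that satisfies the super Jacobi identity and $[x,[x,x]]=0$ for all $x\in\mathfrak g_{\bar 1}$; it is simple if its bracket is not zero and it has no graded ideals except $0$ and $\mathfrak g$; isomorphisms are even. Let $V=k^2$ with a nonzero alternating bilinear form $\langle\cdot|\cdot\rangle$. *Composition superalgebras.* For $r=1,2,4,8$ let $C_r$ be the split Hurwitz algebra $k$, $k\times k$, $\mathrm{Mat}_2(k)$, $C(k)$ (the split Cayley algebra), with norm $q$, polar form $b$ and standard involution $\bar x=b(x,1)1-x$. Let $S_r$ be its para-Hurwitz algebra: the same space and norm, with product $x\bullet y=\bar x\,\bar y$. Let $B(1,2)=k1\oplus V$ be the Hurwitz superalgebra with even part $k1$, odd part $V$, unit $1$, $uv=\langle u|v\rangle 1$ for $u,v\in V$, $q(1)=1$ and $b(u,v)=\langle u|v\rangle$; let $S_{1,2}$ be its para-Hurwitz superalgebra, with $x\bullet y=\bar x\,\bar y$. *The superalgebra $\mathfrak g(S,S')$.*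 For such an $S$ let $\mathfrak{tri}(S)=\mathfrak{tri}(S)_{\bar 0}\oplus\mathfrak{tri}(S)_{\bar 1}$, where $\mathfrak{tri}(S)_{\bar\imath}$ is the set of triples $(d_0,d_1,d_2)\in\mathfrak{osp}(S,b)_{\bar\imath}^3$ with $d_0(x\bullet y)=d_1(x)\bullet y+(-1)^{i|x|}x\bullet d_2(y)$ for homogeneous $x,y$, with the componentwise supercommutator; let $\theta(d_0,d_1,d_2)=(d_2,d_0,d_1)$ and $$t_{x,y}=\bigl(\sigma_{x,y},\ \tfrac12 b(x,y)1-r_xl_y,\ \tfrac12 b(x,y)1-l_xr_y\bigr),$$ where $l_x(y)=x\bullet y$, $r_x(y)=(-1)^{|x||y|}y\bullet x$, $\sigma_{x,y}(z)=(-1)^{|y||z|}b(x,z)y-(-1)^{|x|(|y|+|z|)}b(y,z)x$. Then $$\mathfrak g(S,S')=\bigl(\mathfrak{tri}(S)\oplus\mathfrak{tri}(S')\bigr)\oplus\bigoplus_{i=0}^{2}\iota_i(S\otimes S'),$$ with $\iota_i(S\otimes S')$ a copy of $S\otimes S'$, is the superalgebra whose super-anticommutative bracket extends the brackets of $\mathfrak{tri}(S)$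 and $\mathfrak{tri}(S')$, with $[\mathfrak{tri}(S),\mathfrak{tri}(S')]=0$, by (indices modulo $3$, homogeneous elements) - $[d,\iota_i(x\otimes x')]=\iota_i(d_i(x)\otimes x')$ and $[d',\iota_i(x\otimes x')]=(-1)^{|d'||x|}\iota_i(x\otimes d'_i(x'))$, - $[\iota_i(x\otimes x'),\iota_{i+1}(y\otimes y')]=(-1)^{|x'||y|}\iota_{i+2}((x\bullet y)\otimes(x'\bullet y'))$, - $[\iota_i(x\otimes x'),\iota_i(y\otimes y')]=(-1)^{|x||x'|+|x||y'|+|y||y'|}b'(x',y')\theta^i(t_{x,y})+(-1)^{|y||x'|}b(x,y)\theta'^i(t'_{x',y'})$. *The superalgebra $\mathfrak g(T_J^o)$.* For $r=2,4,8$ let $J=H_3(C_r,*)$ be the space of hermitian $3\times3$ matrices over $C_r$ (with $(x_{ij})^*=(\bar x_{ji})$), with Jordan product $x\circ y=\frac12(xy+yx)$ and trace $t(x)$, the sum of the diagonal entries (which lie in $k1=k$). Let $J_0=\{x\in J: t(x)=0\}$, let $T_J^o=J_0/k1$, and write $\hat x$ for the class of $x\in J_0$. Put $(\hat x|\hat y)=t(x\circ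 y)$ and let $[\hat x\hat y\hat z]$ be the class of $x\circ(y\circ z)-y\circ(x\circ z)$. With $T=T_J^o$, $d_{x,y}=[xy\,\cdot\,]$, let $\mathfrak{inder}(T)$ be the Lie algebra generated by the maps $d_{x,y}$, and $$\mathfrak g(T)=\bigl(\mathfrak{sp}(V)\oplus\mathfrak{inder}(T)\bigr)\oplus(V\otimes T),$$ with even part $\mathfrak{sp}(V)\oplus\mathfrak{inder}(T)$ (a direct sum of Lie algebras), odd part $V\otimes T$, the natural action of the even part on the odd part, and $[u\otimes x,v\otimes y]=-(x|y)\gamma_{u,v}+\langle u|v\rangle d_{x,y}$, where $\gamma_{u,v}=\langle u|\cdot\rangle v+\langle v|\cdot\rangle u$. Then $\mathfrak g(S_{1,2},S_r)$ is a Lie superalgebra for $r=1,2,4,8$. For $r=2,4,8$, the triple system $T=T_J^o$ of $J=H_3(C_r,*)$ is an orthogonal triple system, i.e. $(\cdot|\cdot)$ is a nonzero symmetric form, $[xxy]=0$, $[xyy]=(x|y)y-(y|y)x$, $[xy[uvw]]=[[xyu]vw]+[u[xyv]w]+[uv[xyw]]$ and $([xyu]|v)+(u|[xyv])=0$ (so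 that $\mathfrak{inder}(T)$ is spanned by the maps $d_{x,y}$), and $\mathfrak g(T_J^o)$ is a simple Lie superalgebra. Moreover: 1. $\mathfrak g(S_{1,2},S_1)\cong\mathfrak{psl}_{2,2}(k)$, the quotient of the Lie superalgebra $\mathfrak{sl}_{2,2}(k)$ of $(2|2)\times(2|2)$ matrices of supertrace $0$ by the scalar matrices. 2. The derived algebra $[\mathfrak g(S_{1,2},S_2),\mathfrak g(S_{1,2},S_2)]$ is isomorphic to $\mathfrak g(T_J^o)$ for $J=H_3(k\times k,*)$. 3. $\mathfrak g(S_{1,2},S_4)$ is isomorphic to $\mathfrak g(T_J^o)$ for $J=H_3(\mathrm{Mat}_2(k),*)$. 4. $\mathfrak g(S_{1,2},S_8)$ is isomorphic to $\mathfrak g(T_J^o)$ for $J=H_3(C(k),*)$. -/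

import Mathlib

open scoped TensorProduct

namespace Supersquare

section Superspaces

variable {k M : Type*} [Field k] [AddCommGroup M] [Module k M]

/-- The sign `(-1) ^ e`, for a parity `e`. -/
def sgn (k : Type*) [Field k] (e : ZMod 2) : k := (-1) ^ e.val

/-- A `ℤ/2`-graded vector space `M = M₀ ⊕ M₁`. -/
structure Superspace (k M : Type*) [Field k] [AddCommGroup M] [Module k M] where
  part : ZMod 2 → Submodule k M
  isCompl : IsCompl (part 0) (part 1)

theorem Superspace.isCompl_part (X : Superspace k M) (i : ZMod 2) :
    IsCompl (X.part i) (X.part (i + 1)) := by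
  fin_cases i
  · exact X.isCompl
  · exact X.isCompl.symm

/-- The projection of `M` onto its homogeneous component of parity `i`. -/
noncomputable def Superspace.proj (X : Superspace k M) (i : ZMod 2) : M →ₗ[k] M :=
  (X.part i).subtype ∘ₗ Submodule.projectionOnto _ _ (X.isCompl_part i)

theorem Superspace.proj_mem (X : Superspace k M) (i : ZMod 2) (x : M) :
    X.proj i x ∈ X.part i := by
  simp [Superspace.proj]

theorem Superspace.proj_self (X : Superspace k M) {i : ZMod 2} {x : M} (hx : x ∈ X.part i) :
    X.proj i x = x := by
  have := Submodule.projectionOnto_apply_left (X.isCompl_part i) ⟨x, hx⟩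
  simp only [Superspace.proj, LinearMap.comp_apply, Submodule.subtype_apply]
  rw [this]

theorem Superspace.proj_ne (X : Superspace k M) {i j : ZMod 2} (hij : i ≠ j) {x : M}
    (hx : x ∈ X.part i) : X.proj j x = 0 := by
  have hij' : i = j + 1 := by clear hx; revert i j; decide
  subst hij'
  have := Submodule.projectionOnto_apply_right (X.isCompl_part j) ⟨x, hx⟩
  simp only [Superspace.proj, LinearMap.comp_apply, Submodule.subtype_apply]
  rw [this]; rfl

theorem Superspace.proj_eq (X : Superspace k M) {i : ZMod 2} {x : M} (hx : x ∈ X.part i)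
    (j : ZMod 2) : X.proj j x = if i = j then x else 0 := by
  split_ifs with h
  · rw [← h, X.proj_self hx]
  · exact X.proj_ne h hx

theorem Superspace.proj_add_proj (X : Superspace k M) (x : M) :
    X.proj 0 x + X.proj 1 x = x := by
  have hx : x ∈ X.part 0 ⊔ X.part 1 := by rw [X.isCompl.sup_eq_top]; trivial
  obtain ⟨y, hy, z, hz, rfl⟩ := Submodule.mem_sup.1 hx
  rw [map_add, map_add, X.proj_self hy, X.proj_self hz, X.proj_ne (by decide) hy,
    X.proj_ne (by decide) hz]
  simp

theorem Superspace.hom_induction (X : Superspace k M) {P : M → Prop}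
    (hom : ∀ i, ∀ x ∈ X.part i, P x) (add : ∀ x y, P x → P y → P (x + y)) (x : M) : P x := by
  rw [← X.proj_add_proj x]
  exact add _ _ (hom 0 _ (X.proj_mem 0 x)) (hom 1 _ (X.proj_mem 1 x))

/-- The linear endomorphisms of `M` that are homogeneous of parity `i`. -/
def Superspace.endPart (X : Superspace k M) (i : ZMod 2) : Submodule k (Module.End k M) where
  carrier := {f | ∀ j, ∀ x ∈ X.part j, f x ∈ X.part (i + j)}
  add_mem' hf hg j x hx := add_mem (hf j x hx) (hg j x hx)
  zero_mem' _ _ _ := zero_mem _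
  smul_mem' c _ hf j x hx := (X.part (i + j)).smul_mem c (hf j x hx)

/-- The homogeneous component of parity `i` of a linear endomorphism. -/
noncomputable def Superspace.comp (X : Superspace k M) (i : ZMod 2) :
    Module.End k M →ₗ[k] Module.End k M :=
  ∑ j, LinearMap.mulLeft k (X.proj (i + j)) ∘ₗ LinearMap.mulRight k (X.proj j)

/-- The supercommutator on `End M`: the bilinear extension of
`[f, g] = f g - (-1) ^ (|f| |g|) g f` for homogeneous `f`, `g`. -/
noncomputable def Superspace.superComm (X : Superspace k M) :
    Module.End k M →ₗ[k] Module.End k M →ₗ[k] Module.End k M :=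
  LinearMap.mul k (Module.End k M) -
    ∑ i, ∑ j, sgn k (i * j) •
      (LinearMap.mul k (Module.End k M)).flip.compl₁₂ (X.comp i) (X.comp j)

theorem zmod2_sum {A : Type*} [AddCommMonoid A] (f : ZMod 2 → A) : ∑ i, f i = f 0 + f 1 :=
  Fin.sum_univ_two f

theorem Superspace.comp_apply (X : Superspace k M) (i : ZMod 2) (f : Module.End k M) (x : M) :
    X.comp i f x = X.proj i (f (X.proj 0 x)) + X.proj (i + 1) (f (X.proj 1 x)) := by
  simp [Superspace.comp, zmod2_sum]

theorem Superspace.comp_self (X : Superspace k M) {i : ZMod 2} {f : Module.End k M}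
    (hf : f ∈ X.endPart i) : X.comp i f = f := by
  ext x
  have h0 := hf 0 _ (X.proj_mem 0 x)
  have h1 := hf 1 _ (X.proj_mem 1 x)
  rw [add_zero] at h0
  rw [X.comp_apply, X.proj_self h0, X.proj_self h1, ← map_add, X.proj_add_proj]

theorem Superspace.comp_ne (X : Superspace k M) {i j : ZMod 2} (hij : i ≠ j)
    {f : Module.End k M} (hf : f ∈ X.endPart i) : X.comp j f = 0 := by
  ext x
  have h0 := hf 0 _ (X.proj_mem 0 x)
  have h1 := hf 1 _ (X.proj_mem 1 x)
  rw [add_zero] at h0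
  rw [X.comp_apply, X.proj_ne hij h0, X.proj_ne (by simpa using hij) h1]
  simp

theorem Superspace.superComm_of_mem (X : Superspace k M) {i j : ZMod 2} {f g : Module.End k M}
    (hf : f ∈ X.endPart i) (hg : g ∈ X.endPart j) :
    X.superComm f g = f * g - sgn k (i * j) • (g * f) := by
  have key : ∀ a b : ZMod 2, sgn k (a * b) • (X.comp b g * X.comp a f)
      = if a = i ∧ b = j then sgn k (i * j) • (g * f) else 0 := by
    intro a b
    split_ifs with h
    · obtain ⟨rfl, rfl⟩ := h
      rw [X.comp_self hf, X.comp_self hg]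
    · rw [not_and_or] at h
      rcases h with h | h
      · rw [X.comp_ne (Ne.symm h) hf]; simp
      · rw [X.comp_ne (Ne.symm h) hg]; simp
  simp only [Superspace.superComm, LinearMap.sub_apply, LinearMap.sum_apply,
    LinearMap.smul_apply, LinearMap.compl₁₂_apply, LinearMap.flip_apply, LinearMap.mul_apply',
    key]
  congr 1
  rw [Finset.sum_eq_single i, Finset.sum_eq_single j] <;> simp +contextual

/-- The purely even superspace. -/
def Superspace.ofEven (k M : Type*) [Field k] [AddCommGroup M] [Module k M] : Superspace k M where
  part i := if i = 0 then ⊤ else ⊥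
  isCompl := by simpa using isCompl_top_bot

/-- A superalgebra (not assumed associative, unital, Lie, ...), its product written as a bracket. -/
structure Superalgebra (k G : Type*) [Field k] [AddCommGroup G] [Module k G] where
  part : ZMod 2 → Submodule k G
  bracket : G →ₗ[k] G →ₗ[k] G

/-- `A` is a Lie superalgebra: the grading is a direct sum decomposition, the bracket is even,
super-anticommutative and satisfies the super Jacobi identity; the condition `[x, [x, x]] = 0` for
odd `x`, a part of the definition in characteristic `3`, follows from it in other characteristics
different from `2`. -/
structure Superalgebra.IsLie {k G : Type*} [Field k] [AddCommGroup G] [Module k G]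
    (A : Superalgebra k G) : Prop where
  isCompl : IsCompl (A.part 0) (A.part 1)
  bracket_mem : ∀ i j, ∀ x ∈ A.part i, ∀ y ∈ A.part j, A.bracket x y ∈ A.part (i + j)
  anticomm : ∀ i j, ∀ x ∈ A.part i, ∀ y ∈ A.part j,
    A.bracket x y = -(sgn k (i * j) • A.bracket y x)
  jacobi : ∀ i j, ∀ x ∈ A.part i, ∀ y ∈ A.part j, ∀ z,
    A.bracket x (A.bracket y z) =
      A.bracket (A.bracket x y) z + sgn k (i * j) • A.bracket y (A.bracket x z)
  cube : ∀ x ∈ A.part 1, A.bracket x (A.bracket x x) = 0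

/-- A graded two-sided ideal. -/
structure Superalgebra.IsIdeal {k G : Type*} [Field k] [AddCommGroup G] [Module k G]
    (A : Superalgebra k G) (I : Submodule k G) : Prop where
  graded : I = (I ⊓ A.part 0) ⊔ (I ⊓ A.part 1)
  left : ∀ x, ∀ y ∈ I, A.bracket x y ∈ I
  right : ∀ x ∈ I, ∀ y, A.bracket x y ∈ I

/-- A superalgebra is simple if its product is not zero and it has no proper nonzero graded
ideals. -/
structure Superalgebra.IsSimple {k G : Type*} [Field k] [AddCommGroup G] [Module k G]
    (A : Superalgebra k G) : Prop where
  nonabelian : ∃ x y, A.bracket x y ≠ 0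
  ideal : ∀ I : Submodule k G, A.IsIdeal I → I = ⊥ ∨ I = ⊤

/-- Isomorphism of superalgebras: an even linear bijection that preserves the brackets. -/
def Superalgebra.Iso {k G H : Type*} [Field k] [AddCommGroup G] [Module k G] [AddCommGroup H]
    [Module k H] (A : Superalgebra k G) (B : Superalgebra k H) : Prop :=
  ∃ e : G ≃ₗ[k] H, (∀ i, ∀ x, e x ∈ B.part i ↔ x ∈ A.part i) ∧
    ∀ x y, e (A.bracket x y) = B.bracket (e x) (e y)

/-- The subsuperalgebra on a (graded) subspace closed under the bracket. -/
def Superalgebra.restrict {k G : Type*} [Field k] [AddCommGroup G] [Module k G]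
    (A : Superalgebra k G) (N : Submodule k G) (hN : ∀ x ∈ N, ∀ y ∈ N, A.bracket x y ∈ N) :
    Superalgebra k N where
  part i := (A.part i).comap N.subtype
  bracket := LinearMap.mk₂ k (fun x y => ⟨A.bracket x y, hN x x.2 y y.2⟩)
    (fun _ _ _ => by ext; simp) (fun _ _ _ => by ext; simp)
    (fun _ _ _ => by ext; simp) (fun _ _ _ => by ext; simp)

/-- The quotient by an ideal. -/
def Superalgebra.quotient {k G : Type*} [Field k] [AddCommGroup G] [Module k G]
    (A : Superalgebra k G) (I : Submodule k G) (hl : ∀ x, ∀ y ∈ I, A.bracket x y ∈ I)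
    (hr : ∀ x ∈ I, ∀ y, A.bracket x y ∈ I) : Superalgebra k (G ⧸ I) where
  part i := (A.part i).map I.mkQ
  bracket := I.liftQ
    (LinearMap.mk₂ k (fun x => I.mapQ I (A.bracket x) (fun y hy => hl x y hy))
      (fun _ _ z => by induction z using Submodule.Quotient.induction_on; simp)
      (fun _ _ z => by induction z using Submodule.Quotient.induction_on; simp)
      (fun _ _ _ => by simp) (fun _ _ _ => by simp))
    (fun x hx => by
      ext y
      simpa using hr x hx y)

/-- The underlying space of the derived algebra `[A, A]`: the span of all brackets. -/
def Superalgebra.derivedSpace {k G : Type*} [Field k] [AddCommGroup G] [Module k G]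
    (A : Superalgebra k G) : Submodule k G :=
  Submodule.span k {z | ∃ x y, z = A.bracket x y}

/-- The derived algebra `[A, A]`. -/
def Superalgebra.derived {k G : Type*} [Field k] [AddCommGroup G] [Module k G]
    (A : Superalgebra k G) : Superalgebra k A.derivedSpace :=
  A.restrict A.derivedSpace fun x _ y _ => Submodule.subset_span ⟨x, y, rfl⟩

end Superspaces

section Composition

variable {k S : Type*} [Field k] [AddCommGroup S] [Module k S]

theorem zmod2_cases (i : ZMod 2) : i = 0 ∨ i = 1 := by revert i; decide

@[simp] theorem sgn_zero : sgn k 0 = 1 := by simp [sgn]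

@[simp] theorem sgn_one : sgn k 1 = -1 := by simp [sgn, ZMod.val_one]

theorem sgn_add (a b : ZMod 2) : sgn k (a + b) = sgn k a * sgn k b := by
  have h : (1 + 1 : ZMod 2) = 0 := rfl
  rcases zmod2_cases a with rfl | rfl <;> rcases zmod2_cases b with rfl | rfl <;> simp [h]

theorem sgn_mul_self (a : ZMod 2) : sgn k a * sgn k a = 1 := by
  rcases zmod2_cases a with rfl | rfl <;> simp

/-- A composition superalgebra over a field of characteristic different from `2`: a superalgebra
with a regular quadratic superform `(norm, form)` that permits composition. -/
structure CompositionSuperalgebra (k S : Type*) [Field k] [AddCommGroup S] [Module k S] extends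
    Superspace k S where
  mul : S →ₗ[k] S →ₗ[k] S
  mul_mem : ∀ i j, ∀ x ∈ part i, ∀ y ∈ part j, mul x y ∈ part (i + j)
  norm : QuadraticForm k (part 0)
  form : S →ₗ[k] S →ₗ[k] k
  form_even : ∀ i j, i ≠ j → ∀ x ∈ part i, ∀ y ∈ part j, form x y = 0
  form_symm : ∀ i j, ∀ x ∈ part i, ∀ y ∈ part j, form x y = sgn k (i * j) * form y x
  form_polar : ∀ x y : part 0, form x y = norm (x + y) - norm x - norm y
  nondegenerate : form.Nondegenerate
  norm_mul : ∀ x y z : part 0, mul x y = (z : S) → norm z = norm x * norm y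
  form_mul_left : ∀ (x : part 0) (y z : S), form (mul x y) (mul x z) = norm x * form y z
  form_mul_right : ∀ (x : part 0) (y z : S), form (mul y x) (mul z x) = norm x * form y z
  form_mul_mul : ∀ i j l, ∀ x ∈ part i, ∀ y ∈ part j, ∀ z ∈ part l, ∀ t,
    form (mul x y) (mul z t) + sgn k (i * j + i * l + j * l) * form (mul z y) (mul x t) =
      sgn k (j * l) * (form x z * form y t)

/-- A Hurwitz superalgebra: a unital composition superalgebra. -/
structure HurwitzSuperalgebra (k S : Type*) [Field k] [AddCommGroup S] [Module k S] extends
    CompositionSuperalgebra k S where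
  one : S
  one_mem : one ∈ part 0
  one_mul : ∀ x, mul one x = x
  mul_one : ∀ x, mul x one = x

/-- A symmetric composition superalgebra: the bilinear form is associative. -/
structure SymmetricCompositionSuperalgebra (k S : Type*) [Field k] [AddCommGroup S]
    [Module k S] extends CompositionSuperalgebra k S where
  form_assoc : ∀ x y z, form (mul x y) z = form x (mul y z)

namespace HurwitzSuperalgebra

variable (C : HurwitzSuperalgebra k S)

/-- The standard involution `x ↦ form(x, 1) 1 - x`. -/
def conj : S →ₗ[k] S := (C.form.flip C.one).smulRight C.one - LinearMap.id

theorem conj_apply (x : S) : C.conj x = C.form x C.one • C.one - x := rfl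

theorem form_one (x : S) : C.form C.one x = C.form x C.one := by
  induction x using C.hom_induction with
  | hom i x hx => rw [C.form_symm 0 i _ C.one_mem _ hx]; simp
  | add x y hx hy => simp [hx, hy]

theorem form_one_odd {i : ZMod 2} {x : S} (hx : x ∈ C.part i) (hi : i ≠ 0) :
    C.form x C.one = 0 := C.form_even i 0 hi _ hx _ C.one_mem

theorem form_one_one (x : S) : C.form x C.one * C.form C.one C.one = 2 * C.form x C.one := by
  induction x using C.hom_induction with
  | hom i x hx =>
    rcases zmod2_cases i with rfl | rfl
    · have h := C.form_mul_mul 0 0 0 x hx _ C.one_mem _ C.one_mem C.one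
      simp only [C.one_mul, C.mul_one, C.form_one] at h
      simp at h
      linear_combination -h
    · rw [C.form_one_odd hx (by decide)]; simp
  | add x y hx hy => simp only [map_add, LinearMap.add_apply]; linear_combination hx + hy

theorem conj_conj (x : S) : C.conj (C.conj x) = x := by
  have h := C.form_one_one x
  have h1 : C.form (C.conj x) C.one = C.form x C.one := by
    simp only [conj_apply, map_sub, map_smul, LinearMap.sub_apply, LinearMap.smul_apply,
      smul_eq_mul, h]
    ring
  rw [conj_apply, h1, conj_apply]
  abel

theorem form_conj_conj (x y : S) : C.form (C.conj x) (C.conj y) = C.form x y := by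
  have h := C.form_one_one x
  simp only [conj_apply, map_sub, map_smul, LinearMap.sub_apply, LinearMap.smul_apply,
    smul_eq_mul, C.form_one]
  linear_combination (C.form y C.one) * h

theorem conj_mem {i : ZMod 2} {x : S} (hx : x ∈ C.part i) : C.conj x ∈ C.part i := by
  rw [conj_apply]
  refine sub_mem ?_ hx
  by_cases hi : i = 0
  · subst hi; exact (C.part 0).smul_mem _ C.one_mem
  · rw [C.form_one_odd hx hi]; simp

theorem form_mul_adj_left {i j : ZMod 2} {x y : S} (hx : x ∈ C.part i) (hy : y ∈ C.part j)
    (t : S) : C.form (C.mul x y) t = sgn k (i * j) * C.form y (C.mul (C.conj x) t) := by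
  have h := C.form_mul_mul i j 0 x hx y hy _ C.one_mem t
  have h0 := C.form_one_odd hx
  simp only [C.one_mul, mul_zero, add_zero, sgn_zero] at h
  simp only [conj_apply, map_sub, map_smul, LinearMap.sub_apply, LinearMap.smul_apply,
    smul_eq_mul, C.one_mul]
  rcases zmod2_cases i with rfl | rfl
  · simp at h ⊢; linear_combination h
  · rw [h0 (by decide)] at h ⊢; linear_combination h

theorem form_mul_adj_right {i j l : ZMod 2} {x y z : S} (hx : x ∈ C.part i)
    (hy : y ∈ C.part j) (hz : z ∈ C.part l) :
    C.form (C.mul x y) z = sgn k (j * l) * C.form x (C.mul z (C.conj y)) := by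
  have h := C.form_mul_mul i j l x hx y hy z hz C.one
  have h0 := C.form_one_odd hy
  have h1 := C.form_symm _ _ _ (C.mul_mem _ _ _ hz _ hy) _ hx
  simp only [C.mul_one, h1] at h
  simp only [conj_apply, map_sub, map_smul, smul_eq_mul, C.mul_one]
  rcases zmod2_cases j with rfl | rfl
  · rcases zmod2_cases i with rfl | rfl <;> rcases zmod2_cases l with rfl | rfl <;>
      simp at h ⊢ <;> linear_combination h
  · rw [h0 (by decide)] at h ⊢
    have h2 : (1 + 1 : ZMod 2) = 0 := rfl
    rcases zmod2_cases i with rfl | rfl <;> rcases zmod2_cases l with rfl | rfl <;>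
      simp [h2] at h ⊢ <;> linear_combination h

theorem conj_mul {i j : ZMod 2} {x y : S} (hx : x ∈ C.part i) (hy : y ∈ C.part j) :
    C.conj (C.mul x y) = sgn k (i * j) • C.mul (C.conj y) (C.conj x) := by
  rw [← sub_eq_zero]
  refine C.nondegenerate.1 _ fun z => ?_
  have key : ∀ z, C.form (C.conj (C.mul x y) - sgn k (i * j) • C.mul (C.conj y) (C.conj x))
      (C.conj z) = 0 := ?_
  · rw [← C.conj_conj z, key]
  intro z
  induction z using C.hom_induction with
  | hom l z hz =>
    have h1 := C.form_mul_adj_left hx hy z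
    have h2 := C.form_symm _ _ _ hy _ (C.mul_mem _ _ _ (C.conj_mem hx) _ hz)
    have h3 := C.form_mul_adj_right (C.conj_mem hx) hz hy
    have h4 := C.form_symm _ _ _ (C.conj_mem hx) _ (C.mul_mem _ _ _ hy _ (C.conj_mem hz))
    have h5 := C.form_mul_adj_left hy (C.conj_mem hz) (C.conj x)
    have h6 := C.form_symm _ _ _ (C.conj_mem hz) _
      (C.mul_mem _ _ _ (C.conj_mem hy) _ (C.conj_mem hx))
    rw [map_sub, LinearMap.sub_apply]
    have h0 : C.form (C.conj (C.mul x y)) (C.conj z) = C.form (C.mul x y) z :=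
      C.form_conj_conj _ _
    rw [h0, h1, h2, h3, h4, h5, h6, map_smul, LinearMap.smul_apply, smul_eq_mul]
    have h7 : (1 + 1 : ZMod 2) = 0 := rfl
    rcases zmod2_cases i with rfl | rfl <;> rcases zmod2_cases j with rfl | rfl <;>
      rcases zmod2_cases l with rfl | rfl <;> simp [h7]
  | add x y hx hy => simp only [map_add, hx, hy, add_zero]

theorem para_assoc (x y z : S) : C.form (C.mul (C.conj x) (C.conj y)) z =
    C.form x (C.mul (C.conj y) (C.conj z)) := by
  induction x using C.hom_induction with
  | add x y hx hy => simp only [map_add, LinearMap.add_apply, hx, hy]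
  | hom i x hx =>
  induction y using C.hom_induction with
  | add x y hx hy => simp only [map_add, LinearMap.add_apply, hx, hy]
  | hom j y hy =>
    rw [← C.form_conj_conj, C.conj_mul (C.conj_mem hx) (C.conj_mem hy), C.conj_conj,
      C.conj_conj, map_smul, LinearMap.smul_apply, C.form_mul_adj_left hy hx, smul_eq_mul,
      ← mul_assoc, mul_comm j i, sgn_mul_self, _root_.one_mul]

theorem norm_conj [NeZero (2 : k)] (x y : C.part 0) (h : C.conj x = (y : S)) :
    C.norm y = C.norm x := by
  have h1 := C.form_polar x x
  have h2 := C.form_polar y y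
  have h3 := C.form_conj_conj x x
  have h4 : ∀ z : C.part 0, C.norm (z + z) = 4 * C.norm z := fun z => by
    rw [← two_smul k z, QuadraticMap.map_smul]; norm_num
  rw [h, h1, h2, h4, h4] at h3
  have h5 : (2 : k) * (C.norm y - C.norm x) = 0 := by linear_combination h3
  have := (mul_eq_zero.1 h5).resolve_left (NeZero.ne 2)
  linear_combination this

/-- The para-Hurwitz superalgebra of a Hurwitz superalgebra: the same superspace and norm, with the
product `x • y = x̄ ȳ`. -/
def para [NeZero (2 : k)] : SymmetricCompositionSuperalgebra k S where
  toSuperspace := C.toSuperspace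
  mul := C.mul.compl₁₂ C.conj C.conj
  mul_mem i j x hx y hy := C.mul_mem _ _ _ (C.conj_mem hx) _ (C.conj_mem hy)
  norm := C.norm
  form := C.form
  form_even := C.form_even
  form_symm := C.form_symm
  form_polar := C.form_polar
  nondegenerate := C.nondegenerate
  norm_mul x y z h := by
    rw [C.norm_mul ⟨_, C.conj_mem x.2⟩ ⟨_, C.conj_mem y.2⟩ z h,
      C.norm_conj x ⟨_, C.conj_mem x.2⟩ rfl, C.norm_conj y ⟨_, C.conj_mem y.2⟩ rfl]
  form_mul_left x y z := by
    have := C.form_mul_left ⟨_, C.conj_mem x.2⟩ (C.conj y) (C.conj z)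
    rw [C.norm_conj x ⟨_, C.conj_mem x.2⟩ rfl, C.form_conj_conj] at this
    exact this
  form_mul_right x y z := by
    have := C.form_mul_right ⟨_, C.conj_mem x.2⟩ (C.conj y) (C.conj z)
    rw [C.norm_conj x ⟨_, C.conj_mem x.2⟩ rfl, C.form_conj_conj] at this
    exact this
  form_mul_mul i j l x hx y hy z hz t := by
    have := C.form_mul_mul i j l _ (C.conj_mem hx) _ (C.conj_mem hy) _ (C.conj_mem hz) (C.conj t)
    rw [C.form_conj_conj, C.form_conj_conj] at this
    exact this
  form_assoc := C.para_assoc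

end HurwitzSuperalgebra

end Composition

section Triality

variable {k S : Type*} [Field k] [AddCommGroup S] [Module k S]

namespace SymmetricCompositionSuperalgebra

variable (A : SymmetricCompositionSuperalgebra k S)

theorem mul_mul_left {i j l : ZMod 2} {x y z : S} (hx : x ∈ A.part i) (hy : y ∈ A.part j)
    (hz : z ∈ A.part l) :
    A.mul (A.mul x y) z + sgn k (i * j + i * l + j * l) • A.mul (A.mul z y) x =
      (sgn k (j * l) * A.form x z) • y := by
  rw [← sub_eq_zero]
  refine A.nondegenerate.1 _ fun t => ?_
  have h := A.form_mul_mul i j l x hx y hy z hz t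
  rw [← A.form_assoc, ← A.form_assoc] at h
  simp only [map_sub, map_add, map_smul, LinearMap.sub_apply, LinearMap.add_apply,
    LinearMap.smul_apply, smul_eq_mul]
  linear_combination h

theorem zmod2_add_self (i : ZMod 2) : i + i = 0 := by revert i; decide

theorem mul_mul_right {i j l : ZMod 2} {x y z : S} (hx : x ∈ A.part i) (hy : y ∈ A.part j)
    (hz : z ∈ A.part l) :
    A.mul x (A.mul y z) + sgn k (i * j + i * l + j * l) • A.mul z (A.mul y x) =
      (sgn k (i * j) * A.form x z) • y := by
  rw [← sub_eq_zero]
  refine A.nondegenerate.2 _ fun w => ?_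
  induction w using A.hom_induction with
  | add u v hu hv => simp only [map_add, LinearMap.add_apply, hu, hv, add_zero]
  | hom m w hw =>
    have h := A.form_mul_mul m i j w hw x hx y hy z
    have h1 := A.form_symm _ _ _ (A.mul_mem _ _ _ hy _ hx) _ (A.mul_mem _ _ _ hw _ hz)
    have h2 : i + j + l ≠ m → A.form w (A.mul x (A.mul y z) +
        sgn k (i * j + i * l + j * l) • A.mul z (A.mul y x) -
          (sgn k (i * j) * A.form x z) • y) = 0 := fun hm => by
      rw [map_sub, map_add, map_smul, map_smul,
        A.form_even _ _ hm.symm _ hw _ (add_assoc i j l ▸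
          A.mul_mem _ _ _ hx _ (A.mul_mem _ _ _ hy _ hz)),
        A.form_even _ _ hm.symm _ hw _ ((by ring : l + (j + i) = i + j + l) ▸
          A.mul_mem _ _ _ hz _ (A.mul_mem _ _ _ hy _ hx))]
      by_cases hil : i = l
      · have hmj : m ≠ j := by
          rintro rfl
          subst hil
          exact hm (by rw [add_right_comm, zmod2_add_self, zero_add])
        rw [A.form_even _ _ hmj _ hw _ hy]; simp
      · rw [A.form_even _ _ hil _ hx _ hz]; simp
    by_cases hm : i + j + l = m
    · subst hm
      rw [h1, A.form_assoc, A.form_assoc] at h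
      simp only [map_sub, map_add, map_smul, smul_eq_mul]
      rcases zmod2_cases i with rfl | rfl <;> rcases zmod2_cases j with rfl | rfl <;>
        rcases zmod2_cases l with rfl | rfl <;>
        simp [show (1 + 1 : ZMod 2) = 0 from rfl] at h ⊢ <;> linear_combination h
    · exact h2 hm

/-- The homogeneous part of parity `i` of the orthosymplectic Lie superalgebra of the form. -/
def ospPart (i : ZMod 2) : Submodule k (Module.End k S) where
  carrier := {f | f ∈ A.endPart i ∧
    ∀ j, ∀ x ∈ A.part j, ∀ y, A.form (f x) y + sgn k (i * j) * A.form x (f y) = 0}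
  add_mem' {f g} hf hg := ⟨add_mem hf.1 hg.1, fun j x hx y => by
    have h1 := hf.2 j x hx y
    have h2 := hg.2 j x hx y
    simp only [LinearMap.add_apply, map_add]
    linear_combination h1 + h2⟩
  zero_mem' := ⟨zero_mem _, by simp⟩
  smul_mem' c f hf := ⟨Submodule.smul_mem _ c hf.1, fun j x hx y => by
    have h1 := hf.2 j x hx y
    simp only [LinearMap.smul_apply, map_smul, smul_eq_mul]
    linear_combination c * h1⟩

/-- The homogeneous part of parity `i` of the triality Lie superalgebra. -/
def triPart (i : ZMod 2) : Submodule k (Fin 3 → Module.End k S) where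
  carrier := {d | (∀ n, d n ∈ A.ospPart i) ∧ ∀ j, ∀ x ∈ A.part j, ∀ y,
    d 0 (A.mul x y) = A.mul (d 1 x) y + sgn k (i * j) • A.mul x (d 2 y)}
  add_mem' {d e} hd he := ⟨fun n => add_mem (hd.1 n) (he.1 n), fun j x hx y => by
    simp only [Pi.add_apply, LinearMap.add_apply, map_add, hd.2 j x hx y, he.2 j x hx y]
    module⟩
  zero_mem' := ⟨fun _ => zero_mem _, by simp⟩
  smul_mem' c d hd := ⟨fun n => Submodule.smul_mem _ c (hd.1 n), fun j x hx y => by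
    simp only [Pi.smul_apply, LinearMap.smul_apply, map_smul, hd.2 j x hx y]
    module⟩

/-- The triality Lie superalgebra `tri(S)`, as a space of triples of endomorphisms. -/
def tri : Submodule k (Fin 3 → Module.End k S) := A.triPart 0 ⊔ A.triPart 1

theorem triPart_le (i : ZMod 2) : A.triPart i ≤ A.tri := by
  rcases zmod2_cases i with rfl | rfl
  · exact le_sup_left
  · exact le_sup_right

/-- The componentwise supercommutator of triples of endomorphisms. -/
noncomputable def tripleBracket : (Fin 3 → Module.End k S) →ₗ[k] (Fin 3 → Module.End k S) →ₗ[k]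
    (Fin 3 → Module.End k S) :=
  LinearMap.mk₂ k (fun d e n => A.superComm (d n) (e n))
    (fun _ _ _ => by ext; simp) (fun _ _ _ => by ext; simp)
    (fun _ _ _ => by ext; simp) (fun _ _ _ => by ext; simp)

theorem mul_mem_endPart {i j : ZMod 2} {f g : Module.End k S} (hf : f ∈ A.endPart i)
    (hg : g ∈ A.endPart j) : f * g ∈ A.endPart (i + j) := fun l x hx => by
  rw [add_assoc]
  exact hf _ _ (hg l x hx)

theorem superComm_mem_endPart {i j : ZMod 2} {f g : Module.End k S} (hf : f ∈ A.endPart i)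
    (hg : g ∈ A.endPart j) : A.superComm f g ∈ A.endPart (i + j) := by
  rw [A.superComm_of_mem hf hg]
  exact sub_mem (A.mul_mem_endPart hf hg)
    (Submodule.smul_mem _ _ (add_comm j i ▸ A.mul_mem_endPart hg hf))

theorem superComm_mem_ospPart {i j : ZMod 2} {f g : Module.End k S} (hf : f ∈ A.ospPart i)
    (hg : g ∈ A.ospPart j) : A.superComm f g ∈ A.ospPart (i + j) := by
  refine ⟨A.superComm_mem_endPart hf.1 hg.1, fun l x hx y => ?_⟩
  rw [A.superComm_of_mem hf.1 hg.1]
  have h1 := hf.2 _ _ (hg.1 l x hx) y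
  have h2 := hg.2 _ _ hx (f y)
  have h3 := hg.2 _ _ (hf.1 l x hx) y
  have h4 := hf.2 _ _ hx (g y)
  simp only [LinearMap.sub_apply, LinearMap.smul_apply, Module.End.mul_apply, map_sub, map_smul,
    smul_eq_mul]
  have h7 : (1 + 1 : ZMod 2) = 0 := rfl
  rcases zmod2_cases i with rfl | rfl <;> rcases zmod2_cases j with rfl | rfl <;>
      rcases zmod2_cases l with rfl | rfl <;> simp [h7] at h1 h2 h3 h4 ⊢
  all_goals first
    | linear_combination h1 + h2 + h3 + h4
    | linear_combination h1 + h2 - h3 - h4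
    | linear_combination h1 - h2 + h3 - h4
    | linear_combination h1 - h2 - h3 + h4
    | linear_combination h1 - h2 - h3 - h4
    | linear_combination h1 + h2 - h3 + h4

theorem tripleBracket_mem_triPart {i j : ZMod 2} {d e : Fin 3 → Module.End k S}
    (hd : d ∈ A.triPart i) (he : e ∈ A.triPart j) :
    A.tripleBracket d e ∈ A.triPart (i + j) := by
  refine ⟨fun n => A.superComm_mem_ospPart (hd.1 n) (he.1 n), fun l x hx y => ?_⟩
  simp only [tripleBracket, LinearMap.mk₂_apply]
  rw [A.superComm_of_mem (hd.1 0).1 (he.1 0).1, A.superComm_of_mem (hd.1 1).1 (he.1 1).1,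
    A.superComm_of_mem (hd.1 2).1 (he.1 2).1]
  simp only [LinearMap.sub_apply, LinearMap.smul_apply, Module.End.mul_apply, map_sub, map_smul]
  rw [hd.2 l x hx y, he.2 l x hx y]
  simp only [map_add, map_smul]
  rw [hd.2 _ _ ((he.1 1).1 l x hx) y, hd.2 _ _ hx (e 2 y),
    he.2 _ _ ((hd.1 1).1 l x hx) y, he.2 _ _ hx (d 2 y)]
  simp only [sgn_add, mul_add, add_mul, mul_comm j i]
  rcases zmod2_cases i with rfl | rfl <;> rcases zmod2_cases j with rfl | rfl <;>
      rcases zmod2_cases l with rfl | rfl <;> simp <;> module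

theorem tripleBracket_mem_tri {d e : Fin 3 → Module.End k S} (hd : d ∈ A.tri) (he : e ∈ A.tri) :
    A.tripleBracket d e ∈ A.tri := by
  obtain ⟨d0, hd0, d1, hd1, rfl⟩ := Submodule.mem_sup.1 hd
  obtain ⟨e0, he0, e1, he1, rfl⟩ := Submodule.mem_sup.1 he
  simp only [map_add, LinearMap.add_apply]
  exact add_mem (add_mem (A.triPart_le _ (A.tripleBracket_mem_triPart hd0 he0))
    (A.triPart_le _ (A.tripleBracket_mem_triPart hd1 he0)))
    (add_mem (A.triPart_le _ (A.tripleBracket_mem_triPart hd0 he1))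
    (A.triPart_le _ (A.tripleBracket_mem_triPart hd1 he1)))

/-- The bracket of `tri(S)`. -/
noncomputable def triBracket : A.tri →ₗ[k] A.tri →ₗ[k] A.tri :=
  LinearMap.mk₂ k (fun d e => ⟨A.tripleBracket d e, A.tripleBracket_mem_tri d.2 e.2⟩)
    (fun _ _ _ => by ext1; simp) (fun _ _ _ => by ext1; simp)
    (fun _ _ _ => by ext1; simp) (fun _ _ _ => by ext1; simp)

end SymmetricCompositionSuperalgebra

/-- The power `θ ^ i` of the cyclic shift `θ (d₀, d₁, d₂) = (d₂, d₀, d₁)`. -/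
def theta (k S : Type*) [Field k] [AddCommGroup S] [Module k S] (i : Fin 3) :
    (Fin 3 → Module.End k S) →ₗ[k] (Fin 3 → Module.End k S) :=
  LinearMap.funLeft k (Module.End k S) (fun n => n - i)

namespace SymmetricCompositionSuperalgebra

variable (A : SymmetricCompositionSuperalgebra k S)

theorem theta_one_mem {i : ZMod 2} {d : Fin 3 → Module.End k S} (hd : d ∈ A.triPart i) :
    theta k S 1 d ∈ A.triPart i := by
  refine ⟨fun n => hd.1 _, fun j x hx y => ?_⟩
  change d 2 (A.mul x y) = A.mul (d 0 x) y + sgn k (i * j) • A.mul x (d 1 y)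
  induction y using A.hom_induction with
  | add y z hy hz => simp only [map_add, hy, hz]; module
  | hom l y hy =>
    rw [← sub_eq_zero]
    refine A.nondegenerate.1 _ fun z => ?_
    have h1 := (hd.1 2).2 _ _ (A.mul_mem _ _ _ hx _ hy) z
    have h2 := hd.2 _ _ hy z
    have h3 := (hd.1 0).2 _ _ hx (A.mul y z)
    rw [A.form_assoc] at h1
    rw [h2] at h3
    simp only [map_sub, map_add, map_smul, LinearMap.sub_apply, LinearMap.add_apply,
      LinearMap.smul_apply, smul_eq_mul, ← A.form_assoc] at h1 h3 ⊢
    rcases zmod2_cases i with rfl | rfl <;> rcases zmod2_cases j with rfl | rfl <;>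
      rcases zmod2_cases l with rfl | rfl <;>
      simp [show (1 + 1 : ZMod 2) = 0 from rfl] at h1 h3 ⊢
    all_goals linear_combination h1 - h3

theorem theta_mem_triPart (n : Fin 3) {i : ZMod 2} {d : Fin 3 → Module.End k S}
    (hd : d ∈ A.triPart i) : theta k S n d ∈ A.triPart i := by
  fin_cases n
  · convert hd using 1
    ext m : 1
    simp [theta, LinearMap.funLeft]
  · exact A.theta_one_mem hd
  · convert A.theta_one_mem (A.theta_one_mem hd) using 1
    ext m : 1
    simp only [theta, LinearMap.funLeft_apply]
    congr 1
    revert m; decide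

/-- The left multiplications `l_x (y) = x • y`. -/
def leftMul : S →ₗ[k] Module.End k S := A.mul

/-- The right multiplications: `r_x (y) = (-1) ^ (|x| |y|) y • x` for homogeneous `x`, `y`. -/
noncomputable def rightMul : S →ₗ[k] Module.End k S :=
  ∑ i, ∑ j, sgn k (i * j) • A.mul.flip.compl₁₂ (A.proj i) (A.proj j)

/-- `sigma x y z = (-1) ^ (|y| |z|) form(x, z) y - (-1) ^ (|x| (|y| + |z|)) form(y, z) x` for
homogeneous `x`, `y`, `z`. -/
noncomputable def sigma : S →ₗ[k] S →ₗ[k] Module.End k S :=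
  (∑ j, ∑ l, sgn k (j * l) • (LinearMap.smulRightₗ (R := k) (M₂ := S) (M := S)).compl₁₂
      (LinearMap.lcomp k k (A.proj l) ∘ₗ A.form) (A.proj j)) -
    ∑ i, ∑ j, ∑ l, sgn k (i * (j + l)) •
      ((LinearMap.smulRightₗ (R := k) (M₂ := S) (M := S)).compl₁₂
        (LinearMap.lcomp k k (A.proj l) ∘ₗ A.form ∘ₗ A.proj j) (A.proj i)).flip

/-- The triples
`t_{x,y} = (σ_{x,y}, (1/2) form(x, y) 1 - r_x l_y, (1/2) form(x, y) 1 - l_x r_y)`. -/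
noncomputable def t : S →ₗ[k] S →ₗ[k] (Fin 3 → Module.End k S) :=
  LinearMap.mk₂ k (fun x y => ![A.sigma x y,
      (2⁻¹ * A.form x y) • 1 - A.rightMul x * A.leftMul y,
      (2⁻¹ * A.form x y) • 1 - A.leftMul x * A.rightMul y])
    (fun x y z => by
      ext n : 1
      fin_cases n <;> simp [add_mul, mul_add, add_smul] <;> abel)
    (fun c x y => by
      ext n : 1
      fin_cases n <;> simp [smul_sub, smul_smul, mul_left_comm])
    (fun x y z => by
      ext n : 1
      fin_cases n <;> simp [mul_add, add_smul] <;> abel)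
    (fun c x y => by
      ext n : 1
      fin_cases n <;> simp [smul_sub, smul_smul, mul_left_comm])

theorem rightMul_apply {i j : ZMod 2} {x y : S} (hx : x ∈ A.part i) (hy : y ∈ A.part j) :
    A.rightMul x y = sgn k (i * j) • A.mul y x := by
  rcases zmod2_cases i with rfl | rfl <;> rcases zmod2_cases j with rfl | rfl <;>
    simp [rightMul, zmod2_sum, A.proj_eq hx, A.proj_eq hy]

theorem sigma_apply {i j l : ZMod 2} {x y z : S} (hx : x ∈ A.part i) (hy : y ∈ A.part j)
    (hz : z ∈ A.part l) : A.sigma x y z =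
      (sgn k (j * l) * A.form x z) • y - (sgn k (i * (j + l)) * A.form y z) • x := by
  have h7 : (1 + 1 : ZMod 2) = 0 := rfl
  rcases zmod2_cases i with rfl | rfl <;> rcases zmod2_cases j with rfl | rfl <;>
    rcases zmod2_cases l with rfl | rfl <;>
    simp [sigma, zmod2_sum, A.proj_eq hx, A.proj_eq hy, A.proj_eq hz, h7]

theorem t_apply_one {i j l : ZMod 2} {x y z : S} (hx : x ∈ A.part i) (hy : y ∈ A.part j)
    (hz : z ∈ A.part l) : A.t x y 1 z =
      (2⁻¹ * A.form x y) • z - sgn k (i * (j + l)) • A.mul (A.mul y z) x := by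
  simp [t, leftMul, A.rightMul_apply hx (A.mul_mem _ _ _ hy _ hz)]

theorem t_apply_two {i j l : ZMod 2} {x y z : S} (_hx : x ∈ A.part i) (hy : y ∈ A.part j)
    (hz : z ∈ A.part l) : A.t x y 2 z =
      (2⁻¹ * A.form x y) • z - sgn k (j * l) • A.mul x (A.mul z y) := by
  simp [t, leftMul, A.rightMul_apply hy hz]

theorem smul_form_mem {i j l : ZMod 2} {x y z : S} (hx : x ∈ A.part i) (hy : y ∈ A.part j)
    (hz : z ∈ A.part l) (c : k) : (c * A.form x y) • z ∈ A.part (i + j + l) := by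
  by_cases h : i = j
  · subst h
    rw [zmod2_add_self, zero_add]
    exact Submodule.smul_mem _ _ hz
  · rw [A.form_even _ _ h _ hx _ hy]; simp

theorem t_mem_endPart {i j : ZMod 2} {x y : S} (hx : x ∈ A.part i)
    (hy : y ∈ A.part j) (n : Fin 3) : A.t x y n ∈ A.endPart (i + j) := by
  intro l z hz
  fin_cases n
  · change A.sigma x y z ∈ _
    rw [A.sigma_apply hx hy hz]
    refine sub_mem ?_ ?_
    · exact (by ring : i + l + j = i + j + l) ▸ A.smul_form_mem hx hz hy _
    · exact (by ring : j + l + i = i + j + l) ▸ A.smul_form_mem hy hz hx _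
  · change A.t x y 1 z ∈ _
    rw [A.t_apply_one hx hy hz]
    refine sub_mem (A.smul_form_mem hx hy hz _) (Submodule.smul_mem _ _ ?_)
    exact (by ring : j + l + i = i + j + l) ▸ A.mul_mem _ _ _ (A.mul_mem _ _ _ hy _ hz) _ hx
  · change A.t x y 2 z ∈ _
    rw [A.t_apply_two hx hy hz]
    refine sub_mem (A.smul_form_mem hx hy hz _) (Submodule.smul_mem _ _ ?_)
    exact (by ring : i + (l + j) = i + j + l) ▸ A.mul_mem _ _ _ hx _ (A.mul_mem _ _ _ hz _ hy)

theorem sigma_skew {i j l m : ZMod 2} {x y z w : S} (hx : x ∈ A.part i) (hy : y ∈ A.part j)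
    (hz : z ∈ A.part l) (hw : w ∈ A.part m) :
    A.form (A.sigma x y z) w + sgn k ((i + j) * l) * A.form z (A.sigma x y w) = 0 := by
  rw [A.sigma_apply hx hy hz, A.sigma_apply hx hy hw]
  have h1 := A.form_symm _ _ _ hz _ hx
  have h2 := A.form_symm _ _ _ hz _ hy
  have h3 := fun h => A.form_even _ _ h _ hx _ hz
  have h4 := fun h => A.form_even _ _ h _ hy _ hz
  have h5 := fun h => A.form_even _ _ h _ hx _ hw
  have h6 := fun h => A.form_even _ _ h _ hy _ hw
  simp only [map_sub, map_smul, LinearMap.sub_apply, LinearMap.smul_apply, smul_eq_mul,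
    h1, h2]
  clear h1 h2 hx hy hz hw
  rcases zmod2_cases i with rfl | rfl <;> rcases zmod2_cases j with rfl | rfl <;>
    rcases zmod2_cases l with rfl | rfl <;> rcases zmod2_cases m with rfl | rfl <;>
    simp [show (1 + 1 : ZMod 2) = 0 from rfl] at h3 h4 h5 h6 ⊢ <;>
    (try simp only [h3, h4, h5, h6]) <;> ring

end SymmetricCompositionSuperalgebra

end Triality

section Triality

variable {k S : Type*} [Field k] [AddCommGroup S] [Module k S]

namespace SymmetricCompositionSuperalgebra

variable (A : SymmetricCompositionSuperalgebra k S)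

theorem t_one_skew [NeZero (2 : k)] {i j l m : ZMod 2} {x y z w : S} (hx : x ∈ A.part i)
    (hy : y ∈ A.part j) (hz : z ∈ A.part l) (hw : w ∈ A.part m) :
    A.form (A.t x y 1 z) w + sgn k ((i + j) * l) * A.form z (A.t x y 1 w) = 0 := by
  have two : (2 : k)⁻¹ * 2 = 1 := inv_mul_cancel₀ (NeZero.ne 2)
  rw [A.t_apply_one hx hy hz, A.t_apply_one hx hy hw]
  have h := A.form_mul_mul _ _ _ _ hy _ hz _ hx w
  have h1 := A.form_symm _ _ _ hz _ (A.mul_mem _ _ _ (A.mul_mem _ _ _ hy _ hw) _ hx)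
  have h2 := A.form_symm _ _ _ hy _ hx
  have h3 := fun h => A.form_even _ _ h _ hx _ hy
  have h4 := fun h => A.form_even _ _ h _ hz _ hw
  have h5 := A.form_symm _ _ _ (A.mul_mem _ _ _ hy _ hw) _ (A.mul_mem _ _ _ hx _ hz)
  simp only [map_sub, map_smul, LinearMap.sub_apply, LinearMap.smul_apply, smul_eq_mul,
    h1, A.form_assoc (A.mul y z), A.form_assoc (A.mul y w), h5]
  rw [h2] at h
  clear h1 h2 h5 hx hy hz hw
  rcases zmod2_cases i with rfl | rfl <;> rcases zmod2_cases j with rfl | rfl <;>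
    rcases zmod2_cases l with rfl | rfl <;> rcases zmod2_cases m with rfl | rfl <;>
    simp [show (1 + 1 : ZMod 2) = 0 from rfl] at h h3 h4 ⊢ <;>
    (try simp only [h3, h4, mul_zero, zero_mul] at h ⊢)
  all_goals clear h3 h4
  all_goals first
    | linear_combination -h
    | linear_combination h
    | linear_combination -h + (A.form x y * A.form z w) * two
    | linear_combination h + (A.form x y * A.form z w) * two

theorem t_two_skew [NeZero (2 : k)] {i j l m : ZMod 2} {x y z w : S} (hx : x ∈ A.part i)
    (hy : y ∈ A.part j) (hz : z ∈ A.part l) (hw : w ∈ A.part m) :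
    A.form (A.t x y 2 z) w + sgn k ((i + j) * l) * A.form z (A.t x y 2 w) = 0 := by
  have two : (2 : k)⁻¹ * 2 = 1 := inv_mul_cancel₀ (NeZero.ne 2)
  rw [A.t_apply_two hx hy hz, A.t_apply_two hx hy hw]
  have h := A.form_mul_mul _ _ _ _ hz _ hx _ hw y
  have h1 := A.form_symm _ _ _ (A.mul_mem _ _ _ hx _ (A.mul_mem _ _ _ hz _ hy)) _ hw
  have h3 := fun h => A.form_even _ _ h _ hx _ hy
  have h4 := fun h => A.form_even _ _ h _ hz _ hw
  simp only [map_sub, map_smul, LinearMap.sub_apply, LinearMap.smul_apply, smul_eq_mul,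
    h1, ← A.form_assoc w, ← A.form_assoc z]
  clear h1 hx hy hz hw
  rcases zmod2_cases i with rfl | rfl <;> rcases zmod2_cases j with rfl | rfl <;>
    rcases zmod2_cases l with rfl | rfl <;> rcases zmod2_cases m with rfl | rfl <;>
    simp [show (1 + 1 : ZMod 2) = 0 from rfl] at h h3 h4 ⊢ <;>
    (try simp only [h3, h4, mul_zero, zero_mul] at h ⊢)
  all_goals clear h3 h4
  all_goals first
    | linear_combination -h
    | linear_combination h
    | linear_combination -h + (A.form x y * A.form z w) * two
    | linear_combination h + (A.form x y * A.form z w) * two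

theorem t_triality [NeZero (2 : k)] {i j l m : ZMod 2} {x y z w : S} (hx : x ∈ A.part i)
    (hy : y ∈ A.part j) (hz : z ∈ A.part l) (hw : w ∈ A.part m) :
    A.sigma x y (A.mul z w) =
      A.mul (A.t x y 1 z) w + sgn k ((i + j) * l) • A.mul z (A.t x y 2 w) := by
  have two : ∀ v : S, (2 : k)⁻¹ • v + (2 : k)⁻¹ • v = v := fun v => by
    rw [← add_smul, ← two_mul, mul_inv_cancel₀ (NeZero.ne 2), one_smul]
  have h1 := eq_sub_of_add_eq (A.mul_mul_left (A.mul_mem _ _ _ hy _ hz) hx hw)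
  have h2 := eq_sub_of_add_eq (A.mul_mul_right (A.mul_mem _ _ _ hw _ hx) hy hz)
  have h3 := eq_sub_of_add_eq (A.mul_mul_right hy hw hx)
  have h4 := A.form_symm _ _ _ hw _ (A.mul_mem _ _ _ hx _ hz)
  have h5 := fun h => A.form_even _ _ h _ hx _ hy
  have h6 := A.form_symm _ _ _ hy _ hx
  have h8 := fun h => A.form_even _ _ h _ hx _ (A.mul_mem _ _ _ hz _ hw)
  have h9 := fun h => A.form_even _ _ h _ hy _ (A.mul_mem _ _ _ hz _ hw)
  rw [A.sigma_apply hx hy (A.mul_mem _ _ _ hz _ hw), A.t_apply_one hx hy hz,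
    A.t_apply_two hx hy hw]
  simp only [map_sub, map_smul, LinearMap.sub_apply, LinearMap.smul_apply, h1, h2, h3,
    A.form_assoc, h4, h6]
  have h7 := two (A.form x y • A.mul z w)
  clear h1 h2 h3 h4 h6 hx hy hz hw two
  rcases zmod2_cases i with rfl | rfl <;> rcases zmod2_cases j with rfl | rfl <;>
    rcases zmod2_cases l with rfl | rfl <;> rcases zmod2_cases m with rfl | rfl <;>
    simp [show (1 + 1 : ZMod 2) = 0 from rfl] at h5 h8 h9 ⊢ <;>
    (try simp only [h5, h8, h9, mul_zero, zero_smul]) <;> clear h5 h8 h9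
  all_goals first | module | linear_combination (norm := module) (-1 : k) • h7

theorem t_mem_triPart [NeZero (2 : k)] {i j : ZMod 2} {x y : S} (hx : x ∈ A.part i)
    (hy : y ∈ A.part j) : A.t x y ∈ A.triPart (i + j) := by
  refine ⟨fun n => ⟨A.t_mem_endPart hx hy n, fun l z hz w => ?_⟩, fun l z hz w => ?_⟩
  · induction w using A.hom_induction with
    | add u v hu hv => simp only [map_add]; linear_combination hu + hv
    | hom m w hw =>
      fin_cases n
      · exact A.sigma_skew hx hy hz hw
      · exact A.t_one_skew hx hy hz hw
      · exact A.t_two_skew hx hy hz hw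
  · induction w using A.hom_induction with
    | add u v hu hv => simp only [map_add, smul_add, hu, hv]; abel
    | hom m w hw => exact A.t_triality hx hy hz hw

theorem theta_t_mem_tri [NeZero (2 : k)] (n : Fin 3) (x y : S) :
    theta k S n (A.t x y) ∈ A.tri := by
  induction x using A.hom_induction with
  | add u v hu hv => simp only [map_add, LinearMap.add_apply]; exact add_mem hu hv
  | hom i x hx =>
  induction y using A.hom_induction with
  | add u v hu hv => simp only [map_add]; exact add_mem hu hv
  | hom j y hy => exact A.triPart_le _ (A.theta_mem_triPart n (A.t_mem_triPart hx hy))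

/-- The elements `θ ^ n (t_{x,y})` of `tri(S)`. -/
noncomputable def thetaT [NeZero (2 : k)] (n : Fin 3) : S →ₗ[k] S →ₗ[k] A.tri :=
  LinearMap.mk₂ k (fun x y => ⟨theta k S n (A.t x y), A.theta_t_mem_tri n x y⟩)
    (fun _ _ _ => by ext1; simp) (fun _ _ _ => by ext1; simp)
    (fun _ _ _ => by ext1; simp) (fun _ _ _ => by ext1; simp)

end SymmetricCompositionSuperalgebra

end Triality

section MagicSquare

variable {k S S' : Type*} [Field k] [AddCommGroup S] [Module k S] [AddCommGroup S'] [Module k S']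

/-- For a bilinear map `B` and superspaces with parity components `P`, `Q`, the bilinear extension
of `(x, y) ↦ (-1) ^ (|x| |y|) B y x`. -/
noncomputable def superFlip {U W Z : Type*} [AddCommGroup U] [Module k U] [AddCommGroup W]
    [Module k W] [AddCommGroup Z] [Module k Z] (P : ZMod 2 → U →ₗ[k] U) (Q : ZMod 2 → W →ₗ[k] W)
    (B : W →ₗ[k] U →ₗ[k] Z) : U →ₗ[k] W →ₗ[k] Z :=
  ∑ i, ∑ j, sgn k (i * j) • B.flip.compl₁₂ (P i) (Q j)

variable (A : SymmetricCompositionSuperalgebra k S) (A' : SymmetricCompositionSuperalgebra k S')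

/-- The underlying space `(tri(S) ⊕ tri(S')) ⊕ (⨁ᵢ ιᵢ(S ⊗ S'))` of `g(S, S')`; the third
component of an element is the family of its coordinates in the three copies of `S ⊗ S'`. -/
def MagicSpace : Type _ := A.tri × A'.tri × (Fin 3 → S ⊗[k] S')

noncomputable instance : AddCommGroup (MagicSpace A A') :=
  inferInstanceAs (AddCommGroup (A.tri × A'.tri × (Fin 3 → S ⊗[k] S')))

noncomputable instance : Module k (MagicSpace A A') :=
  inferInstanceAs (Module k (A.tri × A'.tri × (Fin 3 → S ⊗[k] S')))

namespace MagicSquare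

/-- The homogeneous part of parity `c` of `S ⊗ S'`. -/
def tensorPart (c : ZMod 2) : Submodule k (S ⊗[k] S') :=
  ⨆ a, Submodule.map₂ (TensorProduct.mk k S S') (A.part a) (A'.part (c - a))

/-- The homogeneous component of parity `c` of an element of `S ⊗ S'`. -/
noncomputable def tensorProj (c : ZMod 2) : S ⊗[k] S' →ₗ[k] S ⊗[k] S' :=
  ∑ a, TensorProduct.map (A.proj a) (A'.proj (c - a))

/-- The action of an endomorphism of `S` on `S ⊗ S'`: `d · (x ⊗ x') = d x ⊗ x'`. -/
noncomputable def actLeft (k S S' : Type*) [Field k] [AddCommGroup S] [Module k S]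
    [AddCommGroup S'] [Module k S'] : Module.End k S →ₗ[k] S ⊗[k] S' →ₗ[k] S ⊗[k] S' :=
  LinearMap.rTensorHom S'

/-- The action of an endomorphism of `S'` on `S ⊗ S'`:
`d' · (x ⊗ x') = (-1) ^ (|d'| |x|) x ⊗ d' x'`. -/
noncomputable def actRight : Module.End k S' →ₗ[k] S ⊗[k] S' →ₗ[k] S ⊗[k] S' :=
  ∑ c, ∑ a, sgn k (c * a) •
    (TensorProduct.mapBilinear (RingHom.id k) S S' S S' (A.proj a) ∘ₗ A'.comp c)

/-- The product `(x ⊗ x') (y ⊗ y') = (-1) ^ (|x'| |y|) (x • y) ⊗ (x' • y')`. -/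
noncomputable def tensorMul : S ⊗[k] S' →ₗ[k] S ⊗[k] S' →ₗ[k] S ⊗[k] S' :=
  ∑ a', ∑ b, sgn k (a' * b) •
    TensorProduct.map₂ (A.mul.compl₂ (A.proj b)) (A'.mul ∘ₗ A'.proj a')

/-- The map `(x ⊗ x', y ⊗ y') ↦
(-1) ^ (|x| |x'| + |x| |y'| + |y| |y'|) form'(x', y') θ ^ n (t_{x,y})`. -/
noncomputable def tensorT [NeZero (2 : k)] (n : Fin 3) :
    S ⊗[k] S' →ₗ[k] S ⊗[k] S' →ₗ[k] A.tri :=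
  ∑ a, ∑ a', ∑ b, ∑ b', sgn k (a * a' + a * b' + b * b') •
    (TensorProduct.map₂ ((A.thetaT n).compl₁₂ (A.proj a) (A.proj b))
      (A'.form.compl₁₂ (A'.proj a') (A'.proj b'))).compr₂ (TensorProduct.rid k A.tri).toLinearMap

/-- The map `(x ⊗ x', y ⊗ y') ↦ (-1) ^ (|y| |x'|) form(x, y) θ' ^ n (t'_{x',y'})`. -/
noncomputable def tensorT' [NeZero (2 : k)] (n : Fin 3) :
    S ⊗[k] S' →ₗ[k] S ⊗[k] S' →ₗ[k] A'.tri :=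
  ∑ b, ∑ a', sgn k (b * a') •
    (TensorProduct.map₂ (A.form.compl₂ (A.proj b)) (A'.thetaT n ∘ₗ A'.proj a')).compr₂
      (TensorProduct.lid k A'.tri).toLinearMap

/-- The bracket of `g(S, S')`. In the third component, the terms with `superFlip` are the brackets
`[ιᵢ(x ⊗ x'), d]`, `[ιᵢ(x ⊗ x'), d']` and `[ι_{i+1}(x ⊗ x'), ιᵢ(y ⊗ y')]`, which are given by
super-anticommutativity. -/
noncomputable def bracket [NeZero (2 : k)] :
    (A.tri × A'.tri × (Fin 3 → S ⊗[k] S')) →ₗ[k] (A.tri × A'.tri × (Fin 3 → S ⊗[k] S')) →ₗ[k]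
      (A.tri × A'.tri × (Fin 3 → S ⊗[k] S')) :=
  LinearMap.mk₂ k
    (fun X Y =>
      (A.triBracket X.1 Y.1 + ∑ n, tensorT A A' n (X.2.2 n) (Y.2.2 n),
        A'.triBracket X.2.1 Y.2.1 + ∑ n, tensorT' A A' n (X.2.2 n) (Y.2.2 n),
        fun n =>
          actLeft k S S' (X.1.1 n) (Y.2.2 n) + actRight A A' (X.2.1.1 n) (Y.2.2 n)
          - superFlip (tensorProj A A') A.comp (actLeft k S S') (X.2.2 n) (Y.1.1 n)
          - superFlip (tensorProj A A') A'.comp (actRight A A') (X.2.2 n) (Y.2.1.1 n)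
          + tensorMul A A' (X.2.2 (n + 1)) (Y.2.2 (n + 2))
          - superFlip (tensorProj A A') (tensorProj A A') (tensorMul A A')
              (X.2.2 (n + 2)) (Y.2.2 (n + 1))))
    (fun X Y Z => by
      ext1
      · simp [Finset.sum_add_distrib]; abel
      · ext1
        · simp [Finset.sum_add_distrib]; abel
        · ext n : 1
          simp; abel)
    (fun c X Y => by
      ext1
      · simp [Finset.smul_sum]
      · ext1
        · simp [Finset.smul_sum]
        · ext n : 1
          simp [smul_add, smul_sub])
    (fun X Y Z => by
      ext1
      · simp [Finset.sum_add_distrib]; abel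
      · ext1
        · simp [Finset.sum_add_distrib]; abel
        · ext n : 1
          simp; abel)
    (fun c X Y => by
      ext1
      · simp [Finset.smul_sum]
      · ext1
        · simp [Finset.smul_sum]
        · ext n : 1
          simp [smul_add, smul_sub])

end MagicSquare

/-- The superalgebra `g(S, S')`. -/
noncomputable def magic [NeZero (2 : k)] : Superalgebra k (MagicSpace A A') where
  part c :=
    (((A.triPart c).comap A.tri.subtype).prod
      (((A'.triPart c).comap A'.tri.subtype).prod
        (Submodule.pi Set.univ fun _ => MagicSquare.tensorPart A A' c)) :
      Submodule k (A.tri × A'.tri × (Fin 3 → S ⊗[k] S')))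
  bracket := MagicSquare.bracket A A'

end MagicSquare

section HurwitzAlgebras

/-- A Hurwitz algebra over a field of characteristic different from `2`: a unital algebra with a
regular quadratic form (the norm) that permits composition. -/
structure HurwitzAlgebra (k C : Type*) [Field k] [AddCommGroup C] [Module k C] where
  mul : C →ₗ[k] C →ₗ[k] C
  one : C
  norm : QuadraticForm k C
  one_mul : ∀ x, mul one x = x
  mul_one : ∀ x, mul x one = x
  norm_mul : ∀ x y, norm (mul x y) = norm x * norm y
  nondegenerate : norm.polarBilin.Nondegenerate

namespace HurwitzAlgebra

variable {k C : Type*} [Field k] [AddCommGroup C] [Module k C] (H : HurwitzAlgebra k C)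

/-- The polar form of the norm. -/
def form : C →ₗ[k] C →ₗ[k] k := H.norm.polarBilin

theorem form_apply (x y : C) : H.form x y = H.norm (x + y) - H.norm x - H.norm y := rfl

theorem form_comm (x y : C) : H.form x y = H.form y x := by
  simp only [form_apply, add_comm]; ring

theorem form_mul_left (x y z : C) :
    H.form (H.mul x y) (H.mul x z) = H.norm x * H.form y z := by
  simp only [form_apply, ← map_add, H.norm_mul]; ring

theorem form_mul_right (x y z : C) :
    H.form (H.mul y x) (H.mul z x) = H.norm x * H.form y z := by
  simp only [form_apply, ← map_add, ← LinearMap.add_apply, H.norm_mul]; ring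

theorem form_mul_mul (x y z t : C) :
    H.form (H.mul x y) (H.mul z t) + H.form (H.mul z y) (H.mul x t) =
      H.form x z * H.form y t := by
  have h := H.form_mul_left (x + z) y t
  have h1 := H.form_mul_left x y t
  have h2 := H.form_mul_left z y t
  have h3 := H.form_apply x z
  simp only [map_add, LinearMap.add_apply] at h
  linear_combination h - h1 - h2 - H.form y t * h3

/-- A Hurwitz algebra as a Hurwitz superalgebra with zero odd part. -/
def toSuper : HurwitzSuperalgebra k C where
  toSuperspace := Superspace.ofEven k C
  mul := H.mul
  mul_mem i j x hx y hy := by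
    rcases zmod2_cases i with rfl | rfl <;> rcases zmod2_cases j with rfl | rfl <;>
      simp_all [Superspace.ofEven]
  norm := H.norm.comp (Submodule.subtype _)
  form := H.form
  form_even i j hij x hx y hy := by
    rcases zmod2_cases i with rfl | rfl <;> rcases zmod2_cases j with rfl | rfl <;>
      simp_all [Superspace.ofEven]
  form_symm i j x hx y hy := by
    rcases zmod2_cases i with rfl | rfl <;> rcases zmod2_cases j with rfl | rfl <;>
      simp_all [Superspace.ofEven, H.form_comm x y]
  form_polar x y := rfl
  nondegenerate := H.nondegenerate
  norm_mul x y z h := by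
    change H.norm z = H.norm x * H.norm y
    rw [← h, H.norm_mul]
  form_mul_left x y z := H.form_mul_left x y z
  form_mul_right x y z := H.form_mul_right x y z
  form_mul_mul i j l x hx y hy z hz t := by
    have h := H.form_mul_mul x y z t
    rcases zmod2_cases i with rfl | rfl <;> rcases zmod2_cases j with rfl | rfl <;>
      rcases zmod2_cases l with rfl | rfl <;> simp_all [Superspace.ofEven]
  one := H.one
  one_mem := by simp [Superspace.ofEven]
  one_mul := H.one_mul
  mul_one := H.mul_one

/-- The symmetric composition superalgebra (with zero odd part) given by the para-Hurwitz algebra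
of a Hurwitz algebra. -/
noncomputable def para [NeZero (2 : k)] : SymmetricCompositionSuperalgebra k C := H.toSuper.para

/-- The standard involution `x ↦ form(x, 1) 1 - x`. -/
def conj : C →ₗ[k] C := H.toSuper.conj

theorem mem_part_zero (x : C) : x ∈ H.toSuper.part 0 := by simp [toSuper, Superspace.ofEven]

theorem conj_conj (x : C) : H.conj (H.conj x) = x := H.toSuper.conj_conj x

theorem conj_mul (x y : C) : H.conj (H.mul x y) = H.mul (H.conj y) (H.conj x) := by
  have := H.toSuper.conj_mul (H.mem_part_zero x) (H.mem_part_zero y)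
  rwa [mul_zero, sgn_zero, one_smul] at this

theorem conj_one : H.conj H.one = H.one := by
  have h := H.conj_mul H.one (H.conj H.one)
  rwa [H.one_mul, H.conj_conj, H.one_mul, eq_comm] at h

theorem form_conj_conj (x y : C) : H.form (H.conj x) (H.conj y) = H.form x y :=
  H.toSuper.form_conj_conj x y

theorem form_mul_adj_left (x y z : C) :
    H.form (H.mul x y) z = H.form y (H.mul (H.conj x) z) := by
  have := H.toSuper.form_mul_adj_left (H.mem_part_zero x) (H.mem_part_zero y) z
  rwa [mul_zero, sgn_zero, _root_.one_mul] at this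

theorem form_mul_adj_right (x y z : C) :
    H.form (H.mul x y) z = H.form x (H.mul z (H.conj y)) := by
  have := H.toSuper.form_mul_adj_right (H.mem_part_zero x) (H.mem_part_zero y)
    (H.mem_part_zero z)
  rwa [mul_zero, sgn_zero, _root_.one_mul] at this

theorem form_mul_one_comm (x y : C) : H.form (H.mul x y) H.one = H.form (H.mul y x) H.one := by
  rw [H.form_mul_adj_left, H.mul_one, H.form_mul_adj_left, H.mul_one, ← H.form_conj_conj x,
    H.conj_conj, H.form_comm]

theorem form_mul_mul_one (x y z : C) :
    H.form (H.mul (H.mul x y) z) H.one = H.form (H.mul x (H.mul y z)) H.one := by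
  rw [H.form_mul_adj_right, H.form_mul_adj_right, H.form_mul_adj_right x (H.mul y z), H.one_mul,
    H.one_mul, H.conj_mul]

end HurwitzAlgebra

section Split

variable (k : Type*) [Field k]

theorem nondegenerate_of_symm {C : Type*} [AddCommGroup C] [Module k C] (q : QuadraticForm k C)
    (h : ∀ x, (∀ y, QuadraticMap.polar q x y = 0) → x = 0) : q.polarBilin.Nondegenerate :=
  ⟨h, fun y hy => h y fun x => by rw [QuadraticMap.polar_comm]; exact hy x⟩

/-- The Hurwitz algebra `k`, with norm `x ↦ x ^ 2`. -/
def hurwitz1 [NeZero (2 : k)] : HurwitzAlgebra k k where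
  mul := LinearMap.mul k k
  one := 1
  norm := QuadraticMap.sq
  one_mul x := by simp
  mul_one x := by simp
  norm_mul x y := by simp; ring
  nondegenerate := nondegenerate_of_symm k _ fun x hx => by
    have := hx 1
    simp only [QuadraticMap.polar, QuadraticMap.sq_apply] at this
    have h : (2 : k) * x = 0 := by linear_combination this
    exact (mul_eq_zero.1 h).resolve_left (NeZero.ne 2)

/-- The split Hurwitz algebra `k × k`, with norm `(a, b) ↦ a b`. -/
def hurwitz2 : HurwitzAlgebra k (k × k) where
  mul := LinearMap.mul k (k × k)
  one := 1
  norm := QuadraticMap.linMulLin (LinearMap.fst k k k) (LinearMap.snd k k k)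
  one_mul x := by simp
  mul_one x := by simp
  norm_mul x y := by simp; ring
  nondegenerate := nondegenerate_of_symm k _ fun x hx => by
    have h1 := hx (1, 0)
    have h2 := hx (0, 1)
    simp [QuadraticMap.polar] at h1 h2
    ext
    · simp; linear_combination h2
    · simp; linear_combination h1

/-- The determinant of `2 × 2` matrices as a quadratic form. -/
def detForm : QuadraticForm k (Matrix (Fin 2) (Fin 2) k) :=
  QuadraticMap.linMulLin (Matrix.entryLinearMap k k 0 0) (Matrix.entryLinearMap k k 1 1) -
    QuadraticMap.linMulLin (Matrix.entryLinearMap k k 0 1) (Matrix.entryLinearMap k k 1 0)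

theorem detForm_apply (X : Matrix (Fin 2) (Fin 2) k) : detForm k X = X.det := by
  simp [detForm, Matrix.det_fin_two]

/-- The split quaternion algebra `Mat₂(k)`, with norm the determinant. -/
def hurwitz4 : HurwitzAlgebra k (Matrix (Fin 2) (Fin 2) k) where
  mul := LinearMap.mul k (Matrix (Fin 2) (Fin 2) k)
  one := 1
  norm := detForm k
  one_mul x := by simp
  mul_one x := by simp
  norm_mul x y := by simp [detForm_apply]
  nondegenerate := nondegenerate_of_symm k _ fun x hx => by
    have h1 := hx !![1, 0; 0, 0]
    have h2 := hx !![0, 1; 0, 0]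
    have h3 := hx !![0, 0; 1, 0]
    have h4 := hx !![0, 0; 0, 1]
    simp [QuadraticMap.polar, detForm_apply, Matrix.det_fin_two] at h1 h2 h3 h4
    ext i j
    fin_cases i <;> fin_cases j <;> simp
    · linear_combination h4
    · linear_combination -h3
    · linear_combination -h2
    · linear_combination h1

/-- The space of Zorn's vector matrices `(a, u; v, b)`, written as `(a, b, u, v)`. -/
abbrev ZornSpace := k × k × (Fin 3 → k) × (Fin 3 → k)

/-- Zorn's multiplication
`(a, u; v, b) (c, w; z, d) = (a c + u · z, a w + d u - v × z; c v + b z + u × w, b d + v · w)`. -/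
def zornMul : ZornSpace k →ₗ[k] ZornSpace k →ₗ[k] ZornSpace k :=
  LinearMap.mk₂ k (fun x y =>
    (x.1 * y.1 + x.2.2.1 ⬝ᵥ y.2.2.2, x.2.1 * y.2.1 + x.2.2.2 ⬝ᵥ y.2.2.1,
      x.1 • y.2.2.1 + y.2.1 • x.2.2.1 - crossProduct x.2.2.2 y.2.2.2,
      y.1 • x.2.2.2 + x.2.1 • y.2.2.2 + crossProduct x.2.2.1 y.2.2.1))
    (fun _ _ _ => by
      refine Prod.ext ?_ (Prod.ext ?_ (Prod.ext ?_ ?_)) <;> simp <;> first | ring1 | module)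
    (fun _ _ _ => by
      refine Prod.ext ?_ (Prod.ext ?_ (Prod.ext ?_ ?_)) <;> simp <;> first | ring1 | module)
    (fun _ _ _ => by
      refine Prod.ext ?_ (Prod.ext ?_ (Prod.ext ?_ ?_)) <;> simp <;> first | ring1 | module)
    (fun _ _ _ => by
      refine Prod.ext ?_ (Prod.ext ?_ (Prod.ext ?_ ?_)) <;> simp <;> first | ring1 | module)

/-- The norm `a b - u · v` of the vector matrix `(a, u; v, b)`. -/
def zornNorm : QuadraticForm k (ZornSpace k) :=
  QuadraticMap.linMulLin (LinearMap.fst k _ _) (LinearMap.fst k _ _ ∘ₗ LinearMap.snd k _ _) -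
    ∑ i : Fin 3, QuadraticMap.linMulLin
      (LinearMap.proj i ∘ₗ LinearMap.fst k _ _ ∘ₗ LinearMap.snd k _ _ ∘ₗ LinearMap.snd k _ _)
      (LinearMap.proj i ∘ₗ LinearMap.snd k _ _ ∘ₗ LinearMap.snd k _ _ ∘ₗ LinearMap.snd k _ _)

theorem zornNorm_apply (x : ZornSpace k) :
    zornNorm k x = x.1 * x.2.1 - x.2.2.1 ⬝ᵥ x.2.2.2 := by
  simp [zornNorm, dotProduct]

/-- The split Cayley algebra `C(k)`: Zorn's vector matrices. -/
def hurwitz8 : HurwitzAlgebra k (ZornSpace k) where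
  mul := zornMul k
  one := (1, 1, 0, 0)
  norm := zornNorm k
  one_mul x := by simp [zornMul]
  mul_one x := by simp [zornMul]
  norm_mul x y := by
    simp only [zornNorm_apply, zornMul, LinearMap.mk₂_apply, Matrix.vec3_dotProduct, cross_apply,
      Pi.sub_apply, Pi.add_apply, Pi.smul_apply, smul_eq_mul, Matrix.cons_val]
    ring
  nondegenerate := nondegenerate_of_symm k _ fun x hx => by
    have h1 := hx (1, 0, 0, 0)
    have h2 := hx (0, 1, 0, 0)
    have h3 := fun i => hx (0, 0, Pi.single i 1, 0)
    have h4 := fun i => hx (0, 0, 0, Pi.single i 1)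
    simp [QuadraticMap.polar, zornNorm_apply] at h1 h2 h3 h4
    refine Prod.ext ?_ (Prod.ext ?_ (Prod.ext ?_ ?_))
    · simp; linear_combination h2
    · simp; linear_combination h1
    · ext i; simp; exact h4 i
    · ext i; simp; exact h3 i

end Split

end HurwitzAlgebras

section Small

variable (k : Type*) [Field k]

/-- The nonzero alternating form `⟨u | v⟩ = u₀ v₁ - u₁ v₀` on `V = k²`. -/
def symp : (Fin 2 → k) →ₗ[k] (Fin 2 → k) →ₗ[k] k :=
  LinearMap.mk₂ k (fun u v => u 0 * v 1 - u 1 * v 0)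
    (fun _ _ _ => by simp; ring) (fun _ _ _ => by simp; ring)
    (fun _ _ _ => by simp; ring) (fun _ _ _ => by simp; ring)

theorem symp_apply (u v : Fin 2 → k) : symp k u v = u 0 * v 1 - u 1 * v 0 := rfl

theorem symp_swap (u v : Fin 2 → k) : symp k u v = -symp k v u := by
  simp only [symp_apply]; ring

/-- The multiplication `(a 1 + u) (b 1 + v) = (a b + ⟨u | v⟩) 1 + (a v + b u)` of `B(1,2)`. -/
def b12Mul : (k × (Fin 2 → k)) →ₗ[k] (k × (Fin 2 → k)) →ₗ[k] (k × (Fin 2 → k)) :=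
  LinearMap.mk₂ k (fun x y => (x.1 * y.1 + symp k x.2 y.2, x.1 • y.2 + y.1 • x.2))
    (fun _ _ _ => by ext <;> simp <;> ring) (fun _ _ _ => by ext <;> simp <;> ring)
    (fun _ _ _ => by ext <;> simp <;> ring) (fun _ _ _ => by ext <;> simp <;> ring)

/-- The supersymmetric form of `B(1,2)`, with `form(1, 1) = 2` and `form(u, v) = ⟨u | v⟩`. -/
def b12Form : (k × (Fin 2 → k)) →ₗ[k] (k × (Fin 2 → k)) →ₗ[k] k :=
  LinearMap.mk₂ k (fun x y => 2 * (x.1 * y.1) + symp k x.2 y.2)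
    (fun _ _ _ => by simp; ring) (fun _ _ _ => by simp; ring)
    (fun _ _ _ => by simp; ring) (fun _ _ _ => by simp; ring)

/-- The superspace `k 1 ⊕ V` with even part `k 1` and odd part `V = k²`. -/
def b12Space : Superspace k (k × (Fin 2 → k)) where
  part i := if i = 0 then Submodule.prod ⊤ ⊥ else Submodule.prod ⊥ ⊤
  isCompl := by
    simp only [if_true, one_ne_zero, if_false]
    refine ⟨?_, ?_⟩
    · rw [disjoint_iff, Submodule.prod_inf_prod]; simp
    · rw [codisjoint_iff, Submodule.prod_sup_prod]; simp

theorem b12_mem_zero {x : k × (Fin 2 → k)} : x ∈ (b12Space k).part 0 ↔ x.2 = 0 := by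
  simp [b12Space, Submodule.mem_prod]

theorem b12_mem_one {x : k × (Fin 2 → k)} : x ∈ (b12Space k).part 1 ↔ x.1 = 0 := by
  simp [b12Space, Submodule.mem_prod]

/-- The Hurwitz superalgebra `B(1,2)` in characteristic `3`. -/
def b12 [CharP k 3] : HurwitzSuperalgebra k (k × (Fin 2 → k)) where
  toSuperspace := b12Space k
  mul := b12Mul k
  mul_mem i j x hx y hy := by
    rcases zmod2_cases i with rfl | rfl <;> rcases zmod2_cases j with rfl | rfl <;>
      simp_all [b12_mem_zero, b12_mem_one, b12Mul, show (1 + 1 : ZMod 2) = 0 from rfl]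
  norm := QuadraticMap.sq.comp (LinearMap.fst k k (Fin 2 → k) ∘ₗ Submodule.subtype _)
  form := b12Form k
  form_even i j hij x hx y hy := by
    rcases zmod2_cases i with rfl | rfl <;> rcases zmod2_cases j with rfl | rfl <;>
      simp_all [b12_mem_zero, b12_mem_one, b12Form]
  form_symm i j x hx y hy := by
    have h := symp_swap k x.2 y.2
    rcases zmod2_cases i with rfl | rfl <;> rcases zmod2_cases j with rfl | rfl <;>
      simp_all [b12_mem_zero, b12_mem_one, b12Form, mul_comm]
  form_polar x y := by
    have h1 := (b12_mem_zero k).1 x.2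
    have h2 := (b12_mem_zero k).1 y.2
    simp [b12Form, h1]
    ring
  nondegenerate := by
    have two : (2 : k) ≠ 0 := by
      have := CharP.cast_eq_zero_iff k 3 2
      norm_num at this
      exact this
    constructor
    · intro x hx
      have h1 := hx (1, 0)
      have h2 := hx (0, ![1, 0])
      have h3 := hx (0, ![0, 1])
      simp [b12Form, symp_apply, two] at h1 h2 h3
      ext i
      · simpa using h1
      · fin_cases i <;> simp [h2, h3]
    · intro x hx
      have h1 := hx (1, 0)
      have h2 := hx (0, ![1, 0])
      have h3 := hx (0, ![0, 1])
      simp [b12Form, symp_apply, two] at h1 h2 h3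
      ext i
      · simpa using h1
      · fin_cases i <;> simp [h2, h3]
  norm_mul x y z h := by
    have h1 := (b12_mem_zero k).1 x.2
    have h2 : (z : k × (Fin 2 → k)).1 = _ := (congrArg Prod.fst h).symm
    simp [h2, b12Mul, h1]
    ring
  form_mul_left x y z := by
    have h1 := (b12_mem_zero k).1 x.2
    simp [b12Form, b12Mul, h1]
    ring
  form_mul_right x y z := by
    have h1 := (b12_mem_zero k).1 x.2
    simp [b12Form, b12Mul, h1]
    ring
  form_mul_mul i j l x hx y hy z hz t := by
    have three : (3 : k) = 0 := by exact_mod_cast CharP.cast_eq_zero k 3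
    rcases zmod2_cases i with rfl | rfl <;> rcases zmod2_cases j with rfl | rfl <;>
      rcases zmod2_cases l with rfl | rfl <;>
      simp only [b12_mem_zero, b12_mem_one] at hx hy hz <;>
      simp [b12Form, b12Mul, symp_apply, hx, hy, hz, show (1 + 1 : ZMod 2) = 0 from rfl]
    all_goals first
      | ring1
      | linear_combination (x.1 * y.1 * (z.2 0 * t.2 1 - z.2 1 * t.2 0)) * three
      | linear_combination (x.1 * t.1 * (y.2 0 * z.2 1 - y.2 1 * z.2 0)) * three
      | linear_combination (y.1 * z.1 * (x.2 0 * t.2 1 - x.2 1 * t.2 0)) * three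
      | linear_combination (z.1 * t.1 * (x.2 0 * y.2 1 - x.2 1 * y.2 0)) * three
      | linear_combination (-(x.2 0 * y.2 1 * z.2 1 * t.2 0) + x.2 0 * y.2 0 * t.2 1 * z.2 1 +
          y.2 1 * x.2 1 * z.2 0 * t.2 0 - x.2 1 * y.2 0 * z.2 0 * t.2 1) * three
  one := (1, 0)
  one_mem := by simp [b12_mem_zero]
  one_mul x := by simp [b12Mul]
  mul_one x := by simp [b12Mul]

/-- The symmetric composition superalgebra `S_{1,2}`: the para-Hurwitz superalgebra of `B(1,2)`. -/
noncomputable def s12 [CharP k 3] [NeZero (2 : k)] :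
    SymmetricCompositionSuperalgebra k (k × (Fin 2 → k)) := (b12 k).para

end Small

section TripleSystems

attribute [local instance] LieRing.ofAssociativeRing

/-- A vector space with a bilinear form `(x | y)` and a triple product `[x y z]`. -/
structure TripleSystem (k T : Type*) [Field k] [AddCommGroup T] [Module k T] where
  form : T →ₗ[k] T →ₗ[k] k
  triple : T →ₗ[k] T →ₗ[k] Module.End k T

variable {k T : Type*} [Field k] [AddCommGroup T] [Module k T]

/-- The axioms of orthogonal triple systems. -/
structure TripleSystem.IsOrthogonal (R : TripleSystem k T) : Prop where
  form_ne_zero : R.form ≠ 0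
  form_symm : ∀ x y, R.form x y = R.form y x
  triple_self : ∀ x y, R.triple x x y = 0
  triple_right : ∀ x y, R.triple x y y = R.form x y • y - R.form y y • x
  triple_triple : ∀ x y u v w, R.triple x y (R.triple u v w) =
    R.triple (R.triple x y u) v w + R.triple u (R.triple x y v) w + R.triple u v (R.triple x y w)
  triple_form : ∀ x y u v, R.form (R.triple x y u) v + R.form u (R.triple x y v) = 0

/-- The Lie algebra of inner derivations, generated by the maps `z ↦ [x y z]`. In an orthogonal
triple system the fifth axiom shows that these maps already span a Lie algebra. -/
def TripleSystem.inder (R : TripleSystem k T) : LieSubalgebra k (Module.End k T) :=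
  LieSubalgebra.lieSpan k (Module.End k T) {d | ∃ x y, d = R.triple x y}

/-- The symplectic Lie algebra `sp(V)` of `V = k²`. -/
noncomputable def spV (k : Type*) [Field k] : LieSubalgebra k (Module.End k (Fin 2 → k)) :=
  skewAdjointLieSubalgebra (symp k)

/-- The maps `γ_{u,v} = ⟨u | ·⟩ v + ⟨v | ·⟩ u` in `sp(V)`. -/
noncomputable def gamma (k : Type*) [Field k] : (Fin 2 → k) →ₗ[k] (Fin 2 → k) →ₗ[k] spV k :=
  LinearMap.mk₂ k
    (fun u v => ⟨(symp k u).smulRight v + (symp k v).smulRight u, by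
      intro x y
      simp [symp_apply]
      ring⟩)
    (fun _ _ _ => by
      ext1; apply LinearMap.ext; intro; simp; module)
    (fun _ _ _ => by
      ext1; apply LinearMap.ext; intro; simp; module)
    (fun _ _ _ => by
      ext1; apply LinearMap.ext; intro; simp; module)
    (fun _ _ _ => by
      ext1; apply LinearMap.ext; intro; simp; module)

/-- The action of `sp(V) ⊕ End T` on `V ⊗ T`. -/
noncomputable def orthoAct (f : Module.End k (Fin 2 → k)) (d : Module.End k T) :
    Module.End k ((Fin 2 → k) ⊗[k] T) :=
  LinearMap.rTensor T f + LinearMap.lTensor (Fin 2 → k) d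

/-- The superalgebra `g(T, s) = (sp(V) ⊕ s) ⊕ (V ⊗ T)` of a triple system `T`, for a Lie subalgebra
`s` of `gl(T)` that contains the maps `d_{x,y} = [x y ·]`. -/
noncomputable def TripleSystem.superalgebra (R : TripleSystem k T)
    (s : LieSubalgebra k (Module.End k T)) (hs : ∀ x y, R.triple x y ∈ s) :
    Superalgebra k ((spV k × s) × (Fin 2 → k) ⊗[k] T) where
  part i := if i = 0 then Submodule.prod ⊤ ⊥ else Submodule.prod ⊥ ⊤
  bracket :=
    letI d : T →ₗ[k] T →ₗ[k] s := LinearMap.mk₂ k (fun x y => ⟨R.triple x y, hs x y⟩)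
      (fun _ _ _ => by ext1; simp) (fun _ _ _ => by ext1; simp)
      (fun _ _ _ => by ext1; simp) (fun _ _ _ => by ext1; simp)
    /- `(u ⊗ x, v ⊗ y) ↦ (x | y) γ_{u,v}` -/
    letI G := (TensorProduct.map₂ (gamma k) R.form).compr₂ (TensorProduct.rid k (spV k)).toLinearMap
    /- `(u ⊗ x, v ⊗ y) ↦ ⟨u | v⟩ d_{x,y}` -/
    letI D := (TensorProduct.map₂ (symp k) d).compr₂ (TensorProduct.lid k s).toLinearMap
    LinearMap.mk₂ k
      (fun X Y => ((⁅X.1.1, Y.1.1⁆ - G X.2 Y.2, ⁅X.1.2, Y.1.2⁆ + D X.2 Y.2),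
        orthoAct X.1.1.1 X.1.2.1 Y.2 - orthoAct Y.1.1.1 Y.1.2.1 X.2))
      (fun X Y Z => by
        refine Prod.ext (Prod.ext ?_ ?_) ?_
        · simp; abel
        · simp; abel
        · simp [orthoAct, LinearMap.rTensor_add, LinearMap.lTensor_add]; abel)
      (fun c X Y => by
        refine Prod.ext (Prod.ext ?_ ?_) ?_
        · simp [smul_sub]
        · simp
        · simp [orthoAct, LinearMap.rTensor_smul, LinearMap.lTensor_smul, smul_sub])
      (fun X Y Z => by
        refine Prod.ext (Prod.ext ?_ ?_) ?_
        · simp; abel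
        · simp; abel
        · simp [orthoAct, LinearMap.rTensor_add, LinearMap.lTensor_add]; abel)
      (fun c X Y => by
        refine Prod.ext (Prod.ext ?_ ?_) ?_
        · simp [smul_sub]
        · simp
        · simp [orthoAct, LinearMap.rTensor_smul, LinearMap.lTensor_smul, smul_sub])

/-- The superalgebra `g(T) = g(T, inder T)`. -/
noncomputable def TripleSystem.g (R : TripleSystem k T) :
    Superalgebra k ((spV k × R.inder) × (Fin 2 → k) ⊗[k] T) :=
  R.superalgebra R.inder fun x y => LieSubalgebra.subset_lieSpan ⟨x, y, rfl⟩

end TripleSystems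

section JordanAlgebras

/-- A bilinear map that vanishes when one of its arguments lies in `U`, on the quotient by `U`. -/
def liftQ₂ {k M N : Type*} [Field k] [AddCommGroup M] [Module k M] [AddCommGroup N] [Module k N]
    (U : Submodule k M) (B : M →ₗ[k] M →ₗ[k] N) (h1 : ∀ x ∈ U, ∀ y, B x y = 0)
    (h2 : ∀ x, ∀ y ∈ U, B x y = 0) : (M ⧸ U) →ₗ[k] (M ⧸ U) →ₗ[k] N :=
  U.liftQ (U.liftQ B.flip (fun y hy => by ext x; exact h2 x y hy)).flip
    (fun x hx => by
      ext y
      exact h1 x hx y)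

namespace HurwitzAlgebra

variable {k C : Type*} [Field k] [AddCommGroup C] [Module k C] (H : HurwitzAlgebra k C)

/-- The product of `3 × 3` matrices over `C`. -/
def matMul : Matrix (Fin 3) (Fin 3) C →ₗ[k] Matrix (Fin 3) (Fin 3) C →ₗ[k]
    Matrix (Fin 3) (Fin 3) C :=
  LinearMap.mk₂ k (fun X Y => Matrix.of fun i l => ∑ j, H.mul (X i j) (Y j l))
    (fun _ _ _ => by ext; simp [Finset.sum_add_distrib])
    (fun _ _ _ => by ext; simp [Finset.smul_sum])
    (fun _ _ _ => by ext; simp [Finset.sum_add_distrib])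
    (fun _ _ _ => by ext; simp [Finset.smul_sum])

theorem matMul_apply (X Y : Matrix (Fin 3) (Fin 3) C) (i l : Fin 3) :
    H.matMul X Y i l = ∑ j, H.mul (X i j) (Y j l) := rfl

/-- The space `H₃(C, *)` of hermitian `3 × 3` matrices over `C`. -/
def hermitian : Submodule k (Matrix (Fin 3) (Fin 3) C) where
  carrier := {X | ∀ i j, X i j = H.conj (X j i)}
  add_mem' hX hY i j := by simp [← hX i j, ← hY i j]
  zero_mem' := by simp
  smul_mem' c X hX i j := by simp [← hX i j]

theorem jordan_mem {X Y : Matrix (Fin 3) (Fin 3) C} (hX : X ∈ H.hermitian)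
    (hY : Y ∈ H.hermitian) :
    (2⁻¹ : k) • (H.matMul X Y + H.matMul Y X) ∈ H.hermitian := by
  refine Submodule.smul_mem _ _ fun i j => ?_
  simp only [Matrix.add_apply, matMul_apply, map_add, map_sum, H.conj_mul, ← hX _ _, ← hY _ _]
  exact add_comm _ _

/-- The space of the Jordan algebra `J = H₃(C, *)`. -/
def J : Type _ := H.hermitian

noncomputable instance : AddCommGroup H.J := inferInstanceAs (AddCommGroup H.hermitian)

noncomputable instance : Module k H.J := inferInstanceAs (Module k H.hermitian)

/-- The inclusion of `J` in the space of matrices. -/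
noncomputable def toMat : H.J →ₗ[k] Matrix (Fin 3) (Fin 3) C := H.hermitian.subtype

theorem toMat_injective : Function.Injective H.toMat := Subtype.val_injective

/-- The Jordan product `x ∘ y = (1/2) (x y + y x)` of `J = H₃(C, *)`; as a map to `End J`, it sends
`x` to the multiplication `L_x`. -/
noncomputable def jordan : H.J →ₗ[k] Module.End k H.J :=
  LinearMap.mk₂ k (fun x y => ⟨(2⁻¹ : k) • (H.matMul x.1 y.1 + H.matMul y.1 x.1),
      H.jordan_mem x.2 y.2⟩)
    (fun x y z => H.toMat_injective (by
      change (2⁻¹ : k) • (H.matMul (x.1 + y.1) z.1 + H.matMul z.1 (x.1 + y.1)) =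
        (2⁻¹ : k) • (H.matMul x.1 z.1 + H.matMul z.1 x.1) +
        (2⁻¹ : k) • (H.matMul y.1 z.1 + H.matMul z.1 y.1)
      simp; module))
    (fun c x y => H.toMat_injective (by
      change (2⁻¹ : k) • (H.matMul (c • x.1) y.1 + H.matMul y.1 (c • x.1)) =
        c • (2⁻¹ : k) • (H.matMul x.1 y.1 + H.matMul y.1 x.1)
      simp; module))
    (fun z x y => H.toMat_injective (by
      change (2⁻¹ : k) • (H.matMul z.1 (x.1 + y.1) + H.matMul (x.1 + y.1) z.1) =
        (2⁻¹ : k) • (H.matMul z.1 x.1 + H.matMul x.1 z.1) +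
        (2⁻¹ : k) • (H.matMul z.1 y.1 + H.matMul y.1 z.1)
      simp; module))
    (fun c y x => H.toMat_injective (by
      change (2⁻¹ : k) • (H.matMul y.1 (c • x.1) + H.matMul (c • x.1) y.1) =
        c • (2⁻¹ : k) • (H.matMul y.1 x.1 + H.matMul x.1 y.1)
      simp; module))

theorem jordan_coe (x y : H.J) : H.toMat (H.jordan x y) =
    (2⁻¹ : k) • (H.matMul (H.toMat x) (H.toMat y) + H.matMul (H.toMat y) (H.toMat x)) := rfl

theorem jordan_comm (x y : H.J) : H.jordan x y = H.jordan y x :=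
  H.toMat_injective (by rw [jordan_coe, jordan_coe, add_comm])

/-- The trace `J → k`: the diagonal entries `α 1` of an element of `J` lie in `k 1`, and
`α = (1/2) form(α 1, 1)`. -/
noncomputable def trace : H.J →ₗ[k] k :=
  ∑ i, (2⁻¹ : k) • (H.form.flip H.one ∘ₗ (Matrix.entryLinearMap k C i i) ∘ₗ H.toMat)

theorem trace_apply (x : H.J) :
    H.trace x = ∑ i, (2⁻¹ : k) * H.form (H.toMat x i i) H.one := by
  simp [trace]

theorem trace_jordan_assoc (x y z : H.J) :
    H.trace (H.jordan (H.jordan x y) z) = H.trace (H.jordan x (H.jordan y z)) := by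
  have h1 : ∀ X Y : Matrix (Fin 3) (Fin 3) C, ∑ i, H.form (H.matMul X Y i i) H.one =
      ∑ i, H.form (H.matMul Y X i i) H.one := fun X Y => by
    simp only [matMul_apply, map_sum, LinearMap.sum_apply]
    rw [Finset.sum_comm]
    exact Finset.sum_congr rfl fun i _ => Finset.sum_congr rfl fun j _ =>
      H.form_mul_one_comm _ _
  have h2 : ∀ X Y Z : Matrix (Fin 3) (Fin 3) C, ∑ i, H.form (H.matMul (H.matMul X Y) Z i i) H.one =
      ∑ i, H.form (H.matMul X (H.matMul Y Z) i i) H.one := fun X Y Z => by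
    simp only [matMul_apply, map_sum, LinearMap.sum_apply, H.form_mul_mul_one]
    exact Finset.sum_congr rfl fun i _ => Finset.sum_comm
  have h3 : ∀ x y z : H.J, H.trace (H.jordan x (H.jordan y z)) = 2⁻¹ * (2⁻¹ *
      (∑ i, H.form (H.matMul (H.toMat x) (H.matMul (H.toMat y) (H.toMat z)) i i) H.one +
        ∑ i, H.form (H.matMul (H.toMat x) (H.matMul (H.toMat z) (H.toMat y)) i i) H.one)) := fun x y z => by
    have h4 := h1 (H.matMul (H.toMat y) (H.toMat z) + H.matMul (H.toMat z) (H.toMat y)) (H.toMat x)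
    simp only [map_add, LinearMap.add_apply, Matrix.add_apply, Finset.sum_add_distrib] at h4
    simp only [trace_apply, jordan_coe, ← Finset.mul_sum, map_smul, LinearMap.smul_apply,
      Matrix.smul_apply, Matrix.add_apply, map_add, LinearMap.add_apply, smul_eq_mul,
      Finset.sum_add_distrib, h4]
    rcases eq_or_ne (2 : k) 0 with h | h
    · simp [h]
    · field_simp
      ring
  rw [H.jordan_comm _ z, h3, h3, h1 (H.toMat z), h2, ← h2 (H.toMat z), h1 _ (H.toMat x)]

/-- The identity matrix, the unity of `J`. -/
noncomputable def unity : H.J :=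
  ⟨Matrix.of fun i j => if i = j then H.one else 0, fun i j => by
    by_cases h : i = j <;> simp [h, Ne.symm, H.conj_one]⟩

theorem jordan_unity [NeZero (2 : k)] (x : H.J) : H.jordan H.unity x = x := by
  refine H.toMat_injective (Matrix.ext fun i j => ?_)
  have h0 : H.toMat H.unity = Matrix.of fun i j => if i = j then H.one else 0 := rfl
  rw [jordan_coe, h0]
  have h (l m : Fin 3) (y : C) : H.mul (if l = m then H.one else 0) y = if l = m then y else 0 := by
    split_ifs <;> simp [H.one_mul]
  have h' (l m : Fin 3) (y : C) : H.mul y (if l = m then H.one else 0) = if l = m then y else 0 := by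
    split_ifs <;> simp [H.mul_one]
  simp only [Matrix.smul_apply, Matrix.add_apply, matMul_apply, Matrix.of_apply, h, h']
  rw [Finset.sum_ite_eq, Finset.sum_ite_eq']
  simp only [Finset.mem_univ, if_true]
  rw [← two_smul k, smul_smul, inv_mul_cancel₀ (NeZero.ne 2), one_smul]

/-- The space `J₀` of the elements of trace zero. -/
noncomputable def traceless : Submodule k H.J := LinearMap.ker H.trace

/-- The subspace `k 1 ∩ J₀` of `J₀`; in characteristic `3` it is all of `k 1`. -/
noncomputable def scalars : Submodule k H.traceless :=
  (Submodule.span k {H.unity}).comap H.traceless.subtype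

theorem mem_scalars {x : H.traceless} (hx : x ∈ H.scalars) : ∃ c : k, x.1 = c • H.unity := by
  obtain ⟨c, hc⟩ := Submodule.mem_span_singleton.1 hx
  exact ⟨c, hc.symm⟩

/-- The commutator `[L_x, L_y]` of multiplications of `J`. -/
noncomputable def commL : H.J →ₗ[k] H.J →ₗ[k] Module.End k H.J :=
  (LinearMap.mul k (Module.End k H.J) -
    (LinearMap.mul k (Module.End k H.J)).flip).compl₁₂ H.jordan H.jordan

theorem commL_apply (x y z : H.J) :
    H.commL x y z = H.jordan x (H.jordan y z) - H.jordan y (H.jordan x z) := rfl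

theorem trace_commL (x y z : H.J) : H.trace (H.commL x y z) = 0 := by
  rw [commL_apply, map_sub, ← H.trace_jordan_assoc, ← H.trace_jordan_assoc, H.jordan_comm x y,
    sub_self]

/-- The restriction of `[L_x, L_y]` to `J₀`. -/
noncomputable def commL₀ : H.traceless →ₗ[k] H.traceless →ₗ[k] Module.End k H.traceless :=
  LinearMap.mk₂ k (fun x y => (H.commL x y).restrict fun z _ => H.trace_commL x y z)
    (fun _ _ _ => by ext1; exact Subtype.ext (by simp; rfl))
    (fun _ _ _ => by ext1; exact Subtype.ext (by simp; rfl))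
    (fun _ _ _ => by ext1; exact Subtype.ext (by simp; rfl))
    (fun _ _ _ => by ext1; exact Subtype.ext (by simp; rfl))

theorem commL₀_coe (x y z : H.traceless) : (H.commL₀ x y z : H.J) = H.commL x y z := rfl

variable [NeZero (2 : k)]

theorem jordan_scalars {x : H.traceless} (hx : x ∈ H.scalars) (y : H.J) :
    ∃ c : k, H.jordan x y = c • y ∧ H.jordan y x = c • y := by
  obtain ⟨c, hc⟩ := H.mem_scalars hx
  refine ⟨c, ?_, ?_⟩
  · rw [hc, map_smul, LinearMap.smul_apply, H.jordan_unity]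
  · rw [hc, map_smul, H.jordan_comm, H.jordan_unity]

/-- The bilinear form of `T_J = J₀ / (k 1 ∩ J₀)`: the class of `x` and that of `y` have product
`t(x ∘ y)`. -/
noncomputable def tripleForm : (H.traceless ⧸ H.scalars) →ₗ[k] (H.traceless ⧸ H.scalars) →ₗ[k] k :=
  liftQ₂ H.scalars ((H.jordan.compr₂ H.trace).compl₁₂ H.traceless.subtype H.traceless.subtype)
    (fun x hx y => by
      obtain ⟨c, hc, -⟩ := H.jordan_scalars hx y.1
      have hy : H.trace y = 0 := y.2
      change H.trace (H.jordan x y) = 0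
      rw [hc, map_smul, hy, smul_zero])
    (fun x y hy => by
      obtain ⟨c, -, hc⟩ := H.jordan_scalars hy x.1
      have hx : H.trace x = 0 := x.2
      change H.trace (H.jordan x y) = 0
      rw [hc, map_smul, hx, smul_zero])

theorem commL_scalars_left {x : H.traceless} (hx : x ∈ H.scalars) (y z : H.J) :
    H.commL x y z = 0 := by
  obtain ⟨c, hc⟩ := H.mem_scalars hx
  rw [commL_apply, hc]
  simp [H.jordan_unity]

theorem commL_scalars_mid {y : H.traceless} (hy : y ∈ H.scalars) (x z : H.J) :
    H.commL x y z = 0 := by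
  obtain ⟨c, hc⟩ := H.mem_scalars hy
  rw [commL_apply, hc]
  simp [H.jordan_unity]

theorem commL_scalars_right {z : H.traceless} (hz : z ∈ H.scalars) (x y : H.J) :
    H.commL x y z = 0 := by
  obtain ⟨c, hc⟩ := H.mem_scalars hz
  have h (w : H.J) : H.jordan w H.unity = w := by rw [H.jordan_comm, H.jordan_unity]
  rw [commL_apply, hc]
  simp [h, H.jordan_comm x y]

theorem commL₀_scalars (x y : H.traceless) : H.scalars ≤ H.scalars.comap (H.commL₀ x y) := by
  intro z hz
  have : H.commL₀ x y z = 0 := Subtype.ext (H.commL_scalars_right hz x y)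
  rw [Submodule.mem_comap, this]
  exact zero_mem _

/-- The orthogonal triple system of the Jordan algebra `J = H₃(C, *)`: the space is
`T_J = J₀ / (k 1 ∩ J₀)`, the form is that induced by `t(x ∘ y)`, and the triple product of the
classes of `x`, `y`, `z` is the class of `[L_x, L_y](z) = x ∘ (y ∘ z) - y ∘ (x ∘ z)`. -/
noncomputable def tripleSystem : TripleSystem k (H.traceless ⧸ H.scalars) where
  form := H.tripleForm
  triple := liftQ₂ H.scalars
    (LinearMap.mk₂ k (fun x y => H.scalars.mapQ H.scalars (H.commL₀ x y) (H.commL₀_scalars x y))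
      (fun _ _ _ => by ext; simp) (fun _ _ _ => by ext; simp)
      (fun _ _ _ => by ext; simp) (fun _ _ _ => by ext; simp))
    (fun x hx y => by
      have h : H.commL₀ x y = 0 := by ext1 z; exact Subtype.ext (H.commL_scalars_left hx y z)
      ext z
      simp [h])
    (fun x y hy => by
      have h : H.commL₀ x y = 0 := by ext1 z; exact Subtype.ext (H.commL_scalars_mid hy x z)
      ext z
      simp [h])

end HurwitzAlgebra

end JordanAlgebras

section ProjectiveSpecialLinear

variable (k : Type*) [Field k]

/-- The `4 × 4` matrices, split in blocks of size `2 × 2`. -/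
abbrev Mat22 : Type _ := Matrix (Fin 2 ⊕ Fin 2) (Fin 2 ⊕ Fin 2) k

/-- The parity of an index. -/
def indexParity : Fin 2 ⊕ Fin 2 → ZMod 2 := Sum.elim (fun _ => 0) (fun _ => 1)

/-- The homogeneous component of parity `i` of a matrix: the diagonal blocks (`i = 0`) or the
off-diagonal blocks (`i = 1`). -/
def matComp (i : ZMod 2) : Mat22 k →ₗ[k] Mat22 k where
  toFun X := Matrix.of fun a b => if indexParity a + indexParity b = i then X a b else 0
  map_add' X Y := by ext a b; simp only [Matrix.of_apply, Matrix.add_apply]; split_ifs <;> simp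
  map_smul' c X := by ext a b; simp

/-- The general linear Lie superalgebra `gl_{2,2}(k)`, with
`[X, Y] = X Y - (-1) ^ (|X| |Y|) Y X` for homogeneous `X`, `Y`. -/
def gl22 : Superalgebra k (Mat22 k) where
  part i := LinearMap.range (matComp k i)
  bracket := LinearMap.mul k (Mat22 k) -
    ∑ i, ∑ j, sgn k (i * j) • (LinearMap.mul k (Mat22 k)).flip.compl₁₂ (matComp k i) (matComp k j)

theorem gl22_bracket (X Y : Mat22 k) : (gl22 k).bracket X Y =
    X * Y - (matComp k 0 Y * matComp k 0 X + matComp k 1 Y * matComp k 0 X +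
      (matComp k 0 Y * matComp k 1 X - matComp k 1 Y * matComp k 1 X)) := by
  simp [gl22, zmod2_sum, sub_eq_add_neg]

/-- The supertrace. -/
def supertrace : Mat22 k →ₗ[k] k :=
  ∑ a, sgn k (indexParity a) • Matrix.entryLinearMap k k a a

theorem supertrace_apply (X : Mat22 k) :
    supertrace k X = X (.inl 0) (.inl 0) + X (.inl 1) (.inl 1)
      - X (.inr 0) (.inr 0) - X (.inr 1) (.inr 1) := by
  simp [supertrace, indexParity]
  ring

theorem supertrace_bracket (X Y : Mat22 k) : supertrace k ((gl22 k).bracket X Y) = 0 := by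
  have h2 : (1 + 1 : ZMod 2) = 0 := rfl
  rw [gl22_bracket, supertrace_apply]
  simp [Matrix.mul_apply, matComp, indexParity, h2]
  ring

/-- The special linear Lie superalgebra `sl_{2,2}(k)`: the matrices of supertrace zero. -/
def sl22 : Superalgebra k (LinearMap.ker (supertrace k)) :=
  (gl22 k).restrict _ fun X _ Y _ => supertrace_bracket k X Y

/-- The scalar matrices, which lie in `sl_{2,2}(k)`. -/
def scalars22 : Submodule k (LinearMap.ker (supertrace k)) :=
  (Submodule.span k {(1 : Mat22 k)}).comap (LinearMap.ker (supertrace k)).subtype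

theorem matComp_one : matComp k 0 1 = 1 ∧ matComp k 1 1 = 0 := by
  have h2 : (1 + 1 : ZMod 2) = 0 := rfl
  constructor <;> ext a b <;> rcases a with a | a <;> rcases b with b | b <;>
    simp [matComp, indexParity, h2]

theorem matComp_add (X : Mat22 k) : matComp k 0 X + matComp k 1 X = X := by
  have h2 : (1 + 1 : ZMod 2) = 0 := rfl
  ext a b
  rcases a with a | a <;> rcases b with b | b <;> simp [matComp, indexParity, h2]

theorem sl22_bracket_scalars {X : LinearMap.ker (supertrace k)} (hX : X ∈ scalars22 k)
    (Y : LinearMap.ker (supertrace k)) :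
    (sl22 k).bracket X Y = 0 ∧ (sl22 k).bracket Y X = 0 := by
  obtain ⟨c, hc⟩ := Submodule.mem_span_singleton.1 hX
  obtain ⟨h0, h1⟩ := matComp_one k
  have hX' : X.1 = c • (1 : Mat22 k) := hc.symm
  have h : (gl22 k).bracket X.1 Y.1 = 0 := by
    rw [gl22_bracket, hX', map_smul, map_smul, h0, h1]
    simp [← smul_add, matComp_add]
  have h' : (gl22 k).bracket Y.1 X.1 = 0 := by
    rw [gl22_bracket, hX', map_smul, map_smul, h0, h1]
    simp [← smul_add, matComp_add]
  exact ⟨Subtype.ext h, Subtype.ext h'⟩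

/-- The projective special linear Lie superalgebra `psl_{2,2}(k) = sl_{2,2}(k) / k 1`. -/
def psl22 : Superalgebra k (LinearMap.ker (supertrace k) ⧸ scalars22 k) :=
  (sl22 k).quotient (scalars22 k)
    (fun Y X hX => by rw [(sl22_bracket_scalars k hX Y).2]; exact zero_mem _)
    (fun X hX Y => by rw [(sl22_bracket_scalars k hX Y).1]; exact zero_mem _)

end ProjectiveSpecialLinear

/-- `2 ≠ 0` in characteristic `3`. -/
instance instNeZeroTwo (k : Type*) [Field k] [CharP k 3] : NeZero (2 : k) :=
  ⟨fun h => by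
    have := (CharP.cast_eq_zero_iff k 3 2).1 (by exact_mod_cast h)
    omega⟩

end Supersquare

open Supersquare

open scoped TensorProduct

namespace Supersquare

/-! ### Transport of the notions along isomorphisms; derived algebras. -/

section Transfer

variable {k G H L : Type*} [Field k] [AddCommGroup G] [Module k G] [AddCommGroup H] [Module k H]
  [AddCommGroup L] [Module k L] {A : Superalgebra k G} {B : Superalgebra k H} {D : Superalgebra k L}

/-! Everything is compared with one explicit model. For a Hurwitz algebra `C` in characteristic 3
put `T = k × C³` and `s = tri(C) ⊕ C³`, where `tri(C)` is the triality Lie algebra of the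
para-Hurwitz algebra of `C`. `modelAct` lets `s` act faithfully on `T` by maps skew for `modelForm`
(`modelAct_bracket`, `modelForm_act`), and `modelDer : T × T → s` is equivariant
(`modelBracket_der`). So `[x y z] = modelDer(x, y) · z` satisfies the derivation axioms, and `[x y
y]` is a direct computation: `model_isOrthogonal`. These computations rest on `x • (y • z) + z • (y
• x) = b(x, z) y` and its mirror image, on the associativity of the form, and on `3 = 0`.

Jordan side. In characteristic 3 the diagonal of a trace zero hermitian matrix is an arithmetic
progression, so modulo scalars it is one element of `k`; the off-diagonal entries give `C³`. These
coordinates identify `T_J^o` with the model (`form_coord`, `coord_comm`). An orthogonal triple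
system yields a Lie superalgebra because the Jacobi identity on odd elements is the polarization of
a cubic identity that reduces to the axiom on `[x y y]`; the superalgebra `g(T)` is simple as soon
as the form is nondegenerate.

Magic square side. The triples in `tri(S_{1,2})` are constant, so `tri(S_{1,2})` is `sp(V) ⊕ V`, and
`S_{1,2} ⊗ C` is `C ⊕ (V ⊗ C)`. Collecting parities, `g(S_{1,2}, S)` becomes `(sp(V) ⊕ tri(C) ⊕ C³)
⊕ V ⊗ (k ⊕ C³)`, which is `g(T, s)` (`magic_iso_model`). In particular it is a Lie superalgebra.

What remains is to compare `s` with the inner derivations of `T`, which contain `C³` and the span of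
all `θⁱ(t_{x,y})`. For `Mat₂(k)` and `C(k)` that span is `tri(C)`: the maps `σ_{x,y}` reduce the
question to triples with `d₀ = 0`; these are `(0, L_a, -R_a)` with `a` skew in the middle nucleus,
and `a` is zero in the Cayley case and a sum of commutators in the matrix case. For `k × k` the
algebra `tri(C)` is abelian, hence `[s, s]` consists of inner derivations and the derived algebra of
`g(T, s)` is `g(T)`. For `C = k` one has `tri(C) = 0`; quaternion units turn `T` into `Mat₂(k)` and
`s` into `sl₂` acting by left multiplication, and the two columns of the matrices give the two
off-diagonal blocks of `psl_{2,2}(k)`. -/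

theorem Superalgebra.Iso.refl (A : Superalgebra k G) : A.Iso A :=
  ⟨LinearEquiv.refl k G, fun _ _ => Iff.rfl, fun _ _ => rfl⟩

theorem Superalgebra.Iso.symm (h : A.Iso B) : B.Iso A := by
  obtain ⟨e, h1, h2⟩ := h
  refine ⟨e.symm, fun i x => ?_, fun x y => ?_⟩
  · rw [← h1, e.apply_symm_apply]
  · rw [e.symm_apply_eq, h2, e.apply_symm_apply, e.apply_symm_apply]

theorem Superalgebra.Iso.trans (h : A.Iso B) (h' : B.Iso D) : A.Iso D := by
  obtain ⟨e, h1, h2⟩ := h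
  obtain ⟨f, h3, h4⟩ := h'
  exact ⟨e.trans f, fun i x => (h3 i _).trans (h1 i x), fun x y => by
    rw [LinearEquiv.trans_apply, h2, h4]; rfl⟩

theorem Superalgebra.IsLie.of_iso (hB : B.IsLie) (h : A.Iso B) : A.IsLie := by
  obtain ⟨e, h1, h2⟩ := h
  have hp : ∀ i, A.part i = (B.part i).comap e.toLinearMap := fun i => by
    ext x; exact (h1 i x).symm
  refine ⟨?_, fun i j x hx y hy => ?_, fun i j x hx y hy => ?_, fun i j x hx y hy z => ?_,
    fun x hx => ?_⟩
  · rw [hp, hp]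
    exact (Submodule.orderIsoMapComap e).symm.isCompl hB.isCompl
  · rw [← h1, h2]
    exact hB.bracket_mem i j _ ((h1 i x).2 hx) _ ((h1 j y).2 hy)
  · apply e.injective
    rw [map_neg, map_smul, h2, h2]
    exact hB.anticomm i j _ ((h1 i x).2 hx) _ ((h1 j y).2 hy)
  · apply e.injective
    simp only [map_add, map_smul, h2]
    exact hB.jacobi i j _ ((h1 i x).2 hx) _ ((h1 j y).2 hy) _
  · apply e.injective
    simp only [map_zero, h2]
    exact hB.cube _ ((h1 1 x).2 hx)

theorem Superalgebra.IsSimple.of_iso (hB : B.IsSimple) (h : A.Iso B) : A.IsSimple := by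
  obtain ⟨e, h1, h2⟩ := h
  have hp : ∀ i, (A.part i).map e.toLinearMap = B.part i := fun i => by
    ext x
    constructor
    · rintro ⟨y, hy, rfl⟩
      exact (h1 i y).2 hy
    · intro hx
      exact ⟨e.symm x, (h1 i _).1 (by simpa using hx), by simp⟩
  constructor
  · obtain ⟨x, y, hxy⟩ := hB.nonabelian
    refine ⟨e.symm x, e.symm y, fun h => hxy ?_⟩
    have := h2 (e.symm x) (e.symm y)
    simpa [h] using this.symm
  · intro I hI
    have hI' : B.IsIdeal (I.map e.toLinearMap) := by
      refine ⟨?_, ?_, ?_⟩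
      · conv_lhs => rw [hI.graded, Submodule.map_sup, Submodule.map_inf _ e.injective,
          Submodule.map_inf _ e.injective, hp, hp]
      · rintro x _ ⟨y, hy, rfl⟩
        exact ⟨_, hI.left (e.symm x) y hy, by simp [h2]⟩
      · rintro _ ⟨y, hy, rfl⟩ x
        exact ⟨_, hI.right y hy (e.symm x), by simp [h2]⟩
    rcases hB.ideal _ hI' with h | h
    · left
      exact (Submodule.map_eq_bot_iff (e := e)).1 h
    · right
      rw [eq_top_iff]
      intro x _
      have : e x ∈ I.map e.toLinearMap := by rw [h]; trivial
      obtain ⟨y, hy, hxy⟩ := this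
      rwa [← e.injective hxy]

theorem Superalgebra.derived_iso_of_injective (f : H →ₗ[k] G) (hf : Function.Injective f)
    (hp : ∀ i x, f x ∈ A.part i ↔ x ∈ B.part i)
    (hb : ∀ x y, f (B.bracket x y) = A.bracket (f x) (f y))
    (hr : LinearMap.range f = A.derivedSpace) : A.derived.Iso B := by
  refine Superalgebra.Iso.symm
    ⟨(LinearEquiv.ofInjective f hf).trans (LinearEquiv.ofEq _ _ hr), fun i x => ?_, fun x y => ?_⟩
  · exact hp i x
  · exact Subtype.ext (hb x y)

theorem Superalgebra.Iso.map_derivedSpace {e : G ≃ₗ[k] H}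
    (h : ∀ x y, e (A.bracket x y) = B.bracket (e x) (e y)) :
    A.derivedSpace.map e.toLinearMap = B.derivedSpace := by
  rw [Superalgebra.derivedSpace, Superalgebra.derivedSpace, Submodule.map_span]
  congr 1
  ext z
  constructor
  · rintro ⟨_, ⟨x, y, rfl⟩, rfl⟩
    exact ⟨e x, e y, h x y⟩
  · rintro ⟨x, y, rfl⟩
    exact ⟨_, ⟨e.symm x, e.symm y, rfl⟩, by simp [h]⟩

theorem Superalgebra.Iso.derived (h : A.Iso B) : A.derived.Iso B.derived := by
  obtain ⟨e, h1, h2⟩ := h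
  refine ⟨(e.submoduleMap A.derivedSpace).trans
    (LinearEquiv.ofEq _ _ (Superalgebra.Iso.map_derivedSpace h2)), fun i x => h1 i x, fun x y => ?_⟩
  exact Subtype.ext (h2 x y)

/-- The span of all brackets is an ideal, graded because the bracket is even, and it is nonzero
because the product is; simplicity leaves no other choice. -/
theorem Superalgebra.derivedSpace_eq_top (hA : A.IsSimple)
    (hg : ∀ i j, ∀ x ∈ A.part i, ∀ y ∈ A.part j, A.bracket x y ∈ A.part (i + j))
    (hc : A.part 0 ⊔ A.part 1 = ⊤) : A.derivedSpace = ⊤ := by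
  have hmem : ∀ x y, A.bracket x y ∈ A.derivedSpace := fun x y => Submodule.subset_span ⟨x, y, rfl⟩
  refine (hA.ideal A.derivedSpace ⟨le_antisymm ?_ (sup_le inf_le_left inf_le_left),
    fun x y _ => hmem x y, fun x _ y => hmem x y⟩).resolve_left fun h => ?_
  · rw [Superalgebra.derivedSpace, Submodule.span_le]
    rintro _ ⟨x, y, rfl⟩
    have key : ∀ i j, ∀ x ∈ A.part i, ∀ y ∈ A.part j, A.bracket x y ∈
        A.derivedSpace ⊓ A.part 0 ⊔ A.derivedSpace ⊓ A.part 1 := fun i j x hx y hy => by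
      have h := hg i j x hx y hy
      rcases zmod2_cases (i + j) with h0 | h0 <;> rw [h0] at h
      · exact Submodule.mem_sup_left ⟨hmem x y, h⟩
      · exact Submodule.mem_sup_right ⟨hmem x y, h⟩
    obtain ⟨x0, hx0, x1, hx1, rfl⟩ := Submodule.mem_sup.1 (hc ▸ Submodule.mem_top : x ∈ A.part 0 ⊔
      A.part 1)
    obtain ⟨y0, hy0, y1, hy1, rfl⟩ := Submodule.mem_sup.1 (hc ▸ Submodule.mem_top : y ∈ A.part 0 ⊔
      A.part 1)
    simp only [map_add, LinearMap.add_apply]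
    exact add_mem (add_mem (key _ _ _ hx0 _ hy0) (key _ _ _ hx1 _ hy0))
      (add_mem (key _ _ _ hx0 _ hy1) (key _ _ _ hx1 _ hy1))
  · obtain ⟨x, y, hxy⟩ := hA.nonabelian
    have := hmem x y
    rw [h] at this
    exact hxy this

end Transfer

/-! ### Lie superalgebras from a Lie algebra, a module and a symmetric equivariant map. -/

section Construction

variable {k L M : Type*} [Field k] [NeZero (2 : k)] [LieRing L] [LieAlgebra k L] [AddCommGroup M]
  [Module k M]

/-- A Lie superalgebra from a Lie algebra `L`, an `L`-module `M` and an equivariant symmetric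
bilinear map `M × M → L`. -/
theorem Superalgebra.isLie_of_cube (A : Superalgebra k (L × M)) (B : M →ₗ[k] M →ₗ[k] L)
    (act : L →ₗ[k] Module.End k M)
    (hpart : ∀ i, A.part i = if i = 0 then Submodule.prod ⊤ ⊥ else Submodule.prod ⊥ ⊤)
    (hbr : ∀ X Y, A.bracket X Y = (⁅X.1, Y.1⁆ + B X.2 Y.2, act X.1 Y.2 - act Y.1 X.2))
    (hact : ∀ a b w, act ⁅a, b⁆ w = act a (act b w) - act b (act a w))
    (hsymm : ∀ w w', B w w' = B w' w)
    (hequiv : ∀ a w w', ⁅a, B w w'⁆ = B (act a w) w' + B w (act a w'))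
    (hcube : ∀ w, act (B w w) w = 0) : A.IsLie := by
  have h2 : (1 + 1 : ZMod 2) = 0 := rfl
  have h0 : ∀ X, X ∈ A.part 0 → X.2 = 0 := fun X hX => by
    rw [hpart] at hX; simpa [Submodule.mem_prod] using hX
  have h1 : ∀ X, X ∈ A.part 1 → X.1 = 0 := fun X hX => by
    rw [hpart] at hX; simpa [Submodule.mem_prod] using hX
  -- Since `B` is symmetric, the full polarization of the cubic map `w ↦ B(w, w) · w` is twice the
  -- cyclic sum. Only 2 has to be invertible, so the argument survives in characteristic 3.
  have pol : ∀ a b c, act (B a b) c + act (B b c) a + act (B c a) b = 0 := fun a b c => by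
    have e1 := hcube (a + b + c)
    have e2 := hcube (a + b)
    have e3 := hcube (b + c)
    have e4 := hcube (a + c)
    simp only [map_add, LinearMap.add_apply, hcube, hsymm b a, hsymm c a,
      hsymm c b] at e1 e2 e3 e4 ⊢
    have : (2 : k) • (act (B a b) c + act (B b c) a + act (B a c) b) = 0 := by
      linear_combination (norm := module) e1 - e2 - e3 - e4
    exact (smul_eq_zero.1 this).resolve_left (NeZero.ne 2)
  refine ⟨?_, fun i j x hx y hy => ?_, fun i j x hx y hy => ?_, fun i j x hx y hy z => ?_,
    fun x hx => ?_⟩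
  · rw [hpart, hpart]
    simp only [if_true, one_ne_zero, if_false]
    refine ⟨?_, ?_⟩
    · rw [disjoint_iff, Submodule.prod_inf_prod]; simp
    · rw [codisjoint_iff, Submodule.prod_sup_prod]; simp
  · rw [hbr, hpart]
    rcases zmod2_cases i with rfl | rfl <;> rcases zmod2_cases j with rfl | rfl <;>
      first | rw [h0 x hx] | rw [h1 x hx]
    all_goals first | rw [h0 y hy] | rw [h1 y hy]
    all_goals simp [h2, Submodule.mem_prod]
  · rw [hbr, hbr]
    rcases zmod2_cases i with rfl | rfl <;> rcases zmod2_cases j with rfl | rfl <;>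
      first | rw [h0 x hx] | rw [h1 x hx]
    all_goals first | rw [h0 y hy] | rw [h1 y hy]
    all_goals simp [hsymm x.2 y.2]
  · obtain ⟨x1, x2⟩ := x
    obtain ⟨y1, y2⟩ := y
    obtain ⟨z1, z2⟩ := z
    simp only [hbr]
    rcases zmod2_cases i with rfl | rfl <;> rcases zmod2_cases j with rfl | rfl
    · obtain rfl : x2 = 0 := h0 _ hx
      obtain rfl : y2 = 0 := h0 _ hy
      refine Prod.ext ?_ ?_ <;> simp [hact]
    · obtain rfl : x2 = 0 := h0 _ hx
      obtain rfl : y1 = 0 := h1 _ hy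
      refine Prod.ext ?_ ?_ <;> simp [hact, hequiv]
      abel
    · obtain rfl : x1 = 0 := h1 _ hx
      obtain rfl : y2 = 0 := h0 _ hy
      refine Prod.ext ?_ ?_ <;> simp [hact, hequiv]
      abel
    · obtain rfl : x1 = 0 := h1 _ hx
      obtain rfl : y1 = 0 := h1 _ hy
      refine Prod.ext ?_ ?_
      -- Jacobi for two odd elements and an even one is the equivariance of `B`; for three odd
      -- elements it is the polarized cubic identity.
      · have e := lie_skew (B x2 y2) z1
        rw [hequiv, neg_add] at e
        simp [← e, hsymm y2, neg_add_eq_sub]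
      · have p := pol x2 y2 z2
        rw [hsymm z2 x2] at p
        simp
        linear_combination (norm := module) -p
  · rw [hbr, hbr, h1 x hx]
    simp [hcube]

end Construction

end Supersquare

namespace Supersquare

/-! ### The superalgebra of an orthogonal triple system: Lie property and simplicity. -/

section OrthogonalTripleSystems

attribute [local instance] LieRing.ofAssociativeRing

section SubalgebraInstances

variable {k M : Type*} [Field k] [AddCommGroup M] [Module k M] (s : LieSubalgebra k (Module.End k
  M))

abbrev subalgebraAddCommGroup : AddCommGroup s := by infer_instance

abbrev subalgebraAddCommMonoid : AddCommMonoid s := by infer_instance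

abbrev subalgebraAddGroup : AddGroup s := by infer_instance

abbrev subalgebraSubNegMonoid : SubNegMonoid s := by infer_instance

abbrev subalgebraAddMonoid : AddMonoid s := by infer_instance

abbrev subalgebraAddZeroClass : AddZeroClass s := by infer_instance

abbrev subalgebraAdd : Add s := by infer_instance

abbrev subalgebraZero : Zero s := by infer_instance

abbrev subalgebraSub : Sub s := by infer_instance

abbrev subalgebraNeg : Neg s := by infer_instance

abbrev subalgebraModule : Module k s := by infer_instance

abbrev subalgebraSMul : SMul k s := by infer_instance

end SubalgebraInstances

attribute [local instance] subalgebraAddCommGroup subalgebraAddCommMonoid subalgebraAddGroup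
  subalgebraSubNegMonoid subalgebraAddMonoid subalgebraAddZeroClass subalgebraAdd subalgebraZero
  subalgebraSub subalgebraNeg subalgebraModule subalgebraSMul
attribute [local instance 2000] Prod.instAddCommMonoid Prod.instAddCommGroup Prod.instModule

variable {k T : Type*} [Field k] [AddCommGroup T] [Module k T]

theorem mem_spV {f : Module.End k (Fin 2 → k)} :
    f ∈ spV k ↔ ∀ x y, symp k (f x) y + symp k x (f y) = 0 := by
  constructor
  · intro h x y
    have := h x y
    simp only [LinearMap.neg_apply, map_neg] at this
    rw [this]; ring
  · intro h x y
    have := h x y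
    simp only [LinearMap.neg_apply, map_neg]
    linear_combination this

theorem gamma_apply (u v z : Fin 2 → k) :
    (gamma k u v).1 z = symp k u z • v + symp k v z • u := by
  simp [gamma]

theorem gamma_symm (u v : Fin 2 → k) : gamma k u v = gamma k v u := by
  ext1; apply LinearMap.ext; intro z
  rw [gamma_apply, gamma_apply, add_comm]

theorem lie_gamma (f : spV k) (u v : Fin 2 → k) :
    ⁅f, gamma k u v⁆ = gamma k (f.1 u) v + gamma k u (f.1 v) := by
  ext1; apply LinearMap.ext; intro z
  have hu := mem_spV.1 f.2 u z
  have hv := mem_spV.1 f.2 v z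
  change f.1 ((gamma k u v).1 z) - (gamma k u v).1 (f.1 z) =
    (gamma k (f.1 u) v).1 z + (gamma k u (f.1 v)).1 z
  simp only [gamma_apply, map_add, map_smul, eq_neg_of_add_eq_zero_left hu,
    eq_neg_of_add_eq_zero_left hv]
  module

theorem spV_trace (f : spV k) : f.1 (Pi.single 0 1) 0 + f.1 (Pi.single 1 1) 1 = 0 := by
  have := mem_spV.1 f.2 (Pi.single 0 1) (Pi.single 1 1)
  simpa [symp_apply] using this

/-- On the standard basis, `γ_{0,0}` sends `e₁` to `2 e₀`, `γ_{1,1}` sends `e₀` to `-2 e₁` (both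
kill the other vector) and `γ_{0,1}` is diagonal with entries `-1, 1`. These span the trace zero
maps, which explains the coefficients. -/
theorem spV_eq_gamma [NeZero (2 : k)] (f : spV k) : f =
    (2⁻¹ * f.1 (Pi.single 1 1) 0) • gamma k (Pi.single 0 1) (Pi.single 0 1) -
    f.1 (Pi.single 0 1) 0 • gamma k (Pi.single 0 1) (Pi.single 1 1) -
    (2⁻¹ * f.1 (Pi.single 0 1) 1) • gamma k (Pi.single 1 1) (Pi.single 1 1) := by
  have h2 : (2 : k)⁻¹ * 2 = 1 := inv_mul_cancel₀ (NeZero.ne 2)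
  have h := spV_trace f
  ext1
  refine LinearMap.pi_ext' fun i => LinearMap.ext_ring ?_
  ext j
  change f.1 (Pi.single i 1) j = ((2⁻¹ * f.1 (Pi.single 1 1) 0) •
      (gamma k (Pi.single 0 1) (Pi.single 0 1)).1 (Pi.single i 1) -
    f.1 (Pi.single 0 1) 0 • (gamma k (Pi.single 0 1) (Pi.single 1 1)).1 (Pi.single i 1) -
    (2⁻¹ * f.1 (Pi.single 0 1) 1) •
      (gamma k (Pi.single 1 1) (Pi.single 1 1)).1 (Pi.single i 1)) j
  simp only [gamma_apply]
  fin_cases i <;> fin_cases j <;> simp [symp_apply]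
  · linear_combination -f.1 (Pi.single 0 1) 1 * h2
  · linear_combination -f.1 (Pi.single 1 1) 0 * h2
  · linear_combination h

/-- The coordinates of the elements of `V ⊗ T`, for the standard basis of `V = k²`. -/
noncomputable def tensorCoord (i : Fin 2) : (Fin 2 → k) ⊗[k] T →ₗ[k] T :=
  (TensorProduct.lid k T).toLinearMap ∘ₗ LinearMap.rTensor T (LinearMap.proj i)

@[simp] theorem tensorCoord_tmul (i : Fin 2) (u : Fin 2 → k) (x : T) :
    tensorCoord i (u ⊗ₜ[k] x) = u i • x := by
  simp [tensorCoord]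

theorem tensor_eq (w : (Fin 2 → k) ⊗[k] T) : w =
    Pi.single 0 1 ⊗ₜ[k] tensorCoord 0 w + Pi.single 1 1 ⊗ₜ[k] tensorCoord 1 w := by
  induction w using TensorProduct.induction_on with
  | zero => simp
  | add x y hx hy =>
    rw [map_add, map_add, TensorProduct.tmul_add, TensorProduct.tmul_add]
    nth_rewrite 1 [hx, hy]
    abel
  | tmul u x =>
    rw [tensorCoord_tmul, tensorCoord_tmul, ← TensorProduct.smul_tmul, ← TensorProduct.smul_tmul,
      ← TensorProduct.add_tmul]
    congr 1
    ext i
    fin_cases i <;> simp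

theorem tensor_ext {w w' : (Fin 2 → k) ⊗[k] T} (h : ∀ i, tensorCoord i w = tensorCoord i w') :
    w = w' := by
  rw [tensor_eq w, tensor_eq w', h, h]

namespace TripleSystem

variable (R : TripleSystem k T)

/-- The Lie algebra of the derivations of a triple system that are skew for the form. -/
def derivations : LieSubalgebra k (Module.End k T) where
  carrier := {d | (∀ x y, R.form (d x) y + R.form x (d y) = 0) ∧
    ∀ x y z, d (R.triple x y z) = R.triple (d x) y z + R.triple x (d y) z + R.triple x y (d z)}
  add_mem' {a b} ha hb := ⟨fun x y => by
    simp only [LinearMap.add_apply, map_add]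
    linear_combination ha.1 x y + hb.1 x y, fun x y z => by
    simp only [LinearMap.add_apply, map_add, ha.2, hb.2]
    abel⟩
  zero_mem' := ⟨by simp, by simp⟩
  smul_mem' c a ha := ⟨fun x y => by
    simp only [LinearMap.smul_apply, map_smul, smul_eq_mul]
    linear_combination c * ha.1 x y, fun x y z => by
    simp only [LinearMap.smul_apply, map_smul, ha.2]
    module⟩
  lie_mem' {a b} ha hb := by
    have e : ∀ x, (⁅a, b⁆ : Module.End k T) x = a (b x) - b (a x) := fun x => rfl
    refine ⟨fun x y => ?_, fun x y z => ?_⟩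
    · simp only [e, map_sub, LinearMap.sub_apply]
      linear_combination ha.1 (b x) y - hb.1 (a x) y + hb.1 x (a y) * (-1) + ha.1 x (b y)
    · simp only [e, map_sub, LinearMap.sub_apply, ha.2, hb.2, map_add]
      abel

/-- As `d_{x,y}` is a derivation, `[d_{x,y}, d_{u,v}] = d_{[xyu],v} + d_{u,[xyv]}`. The span of
these maps is therefore already a Lie algebra, and generation adds nothing. -/
theorem span_triple_lie (hR : ∀ x y, R.triple x y ∈ R.derivations) {d : Module.End k T}
    (hd : d ∈ R.inder) : d ∈ Submodule.span k {d | ∃ x y, d = R.triple x y} := by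
  have key : ∀ a b, a ∈ Submodule.span k {d | ∃ x y, d = R.triple x y} →
      b ∈ Submodule.span k {d | ∃ x y, d = R.triple x y} →
      ⁅a, b⁆ ∈ Submodule.span k {d | ∃ x y, d = R.triple x y} := fun a b ha hb => by
    induction ha using Submodule.span_induction with
    | zero => simp
    | add _ _ _ _ h h' => rw [add_lie]; exact add_mem h h'
    | smul c _ _ h => rw [smul_lie]; exact Submodule.smul_mem _ _ h
    | mem a ha =>
      induction hb using Submodule.span_induction with
      | zero => simp
      | add _ _ _ _ h h' => rw [lie_add]; exact add_mem h h'
      | smul c _ _ h => rw [lie_smul]; exact Submodule.smul_mem _ _ h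
      | mem b hb =>
        obtain ⟨x, y, rfl⟩ := ha
        obtain ⟨u, v, rfl⟩ := hb
        have : ⁅R.triple x y, R.triple u v⁆ =
            R.triple (R.triple x y u) v + R.triple u (R.triple x y v) := by
          ext z
          change R.triple x y (R.triple u v z) - R.triple u v (R.triple x y z) = _
          rw [(hR x y).2]
          simp
        rw [this]
        exact add_mem (Submodule.subset_span ⟨_, _, rfl⟩) (Submodule.subset_span ⟨_, _, rfl⟩)
  let K : LieSubalgebra k (Module.End k T) :=
    { Submodule.span k {d | ∃ x y, d = R.triple x y} with
      lie_mem' := fun {a b} ha hb => key a b ha hb }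
  have : R.inder ≤ K := LieSubalgebra.lieSpan_le.2 Submodule.subset_span
  exact this hd

variable {R}

theorem IsOrthogonal.triple_mem (hR : R.IsOrthogonal) (x y : T) : R.triple x y ∈ R.derivations :=
  ⟨fun u v => hR.triple_form x y u v, fun u v w => hR.triple_triple x y u v w⟩

theorem IsOrthogonal.inder_le (hR : R.IsOrthogonal) : R.inder ≤ R.derivations :=
  LieSubalgebra.lieSpan_le.2 (by rintro _ ⟨x, y, rfl⟩; exact hR.triple_mem x y)

theorem IsOrthogonal.triple_skew (hR : R.IsOrthogonal) (x y : T) :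
    R.triple x y = -R.triple y x := by
  have h := hR.triple_self (x + y)
  ext z
  have := h z
  simp only [map_add, LinearMap.add_apply, hR.triple_self, zero_add, add_zero] at this
  exact eq_neg_of_add_eq_zero_right this

variable (R)

/-- The symmetric map `(u ⊗ x, v ⊗ y) ↦ -(x | y) γ_{u,v} + ⟨u | v⟩ d_{x,y}`. -/
noncomputable def oddBracket (s : LieSubalgebra k (Module.End k T)) (hs : ∀ x y, R.triple x y ∈ s) :
    (Fin 2 → k) ⊗[k] T →ₗ[k] (Fin 2 → k) ⊗[k] T →ₗ[k] spV k × s :=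
  letI d : T →ₗ[k] T →ₗ[k] s := LinearMap.mk₂ k (fun x y => ⟨R.triple x y, hs x y⟩)
    (fun _ _ _ => by ext1; simp) (fun _ _ _ => by ext1; simp)
    (fun _ _ _ => by ext1; simp) (fun _ _ _ => by ext1; simp)
  ((TensorProduct.map₂ (symp k) d).compr₂ (TensorProduct.lid k s).toLinearMap).compr₂
      (LinearMap.inr k (spV k) s) -
    ((TensorProduct.map₂ (gamma k) R.form).compr₂ (TensorProduct.rid k (spV k)).toLinearMap).compr₂
      (LinearMap.inl k (spV k) s)

theorem oddBracket_tmul (s : LieSubalgebra k (Module.End k T)) (hs : ∀ x y, R.triple x y ∈ s)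
    (u v : Fin 2 → k) (x y : T) : R.oddBracket s hs (u ⊗ₜ x) (v ⊗ₜ y) =
      (-(R.form x y • gamma k u v), symp k u v • ⟨R.triple x y, hs x y⟩) := by
  simp [oddBracket]

/-- The action of `sp(V) ⊕ s` on `V ⊗ T`. -/
noncomputable def evenAct (s : LieSubalgebra k (Module.End k T)) :
    (spV k × s) →ₗ[k] Module.End k ((Fin 2 → k) ⊗[k] T) :=
  LinearMap.rTensorHom T ∘ₗ (spV k).toSubmodule.subtype ∘ₗ LinearMap.fst k _ _ +
    LinearMap.lTensorHom (Fin 2 → k) ∘ₗ s.toSubmodule.subtype ∘ₗ LinearMap.snd k _ _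

theorem evenAct_tmul (s : LieSubalgebra k (Module.End k T)) (a : spV k × s) (u : Fin 2 → k)
    (x : T) : evenAct s a (u ⊗ₜ x) = a.1.1 u ⊗ₜ x + u ⊗ₜ a.2.1 x := by
  simp [evenAct]

theorem superalgebra_bracket (s : LieSubalgebra k (Module.End k T)) (hs : ∀ x y, R.triple x y ∈ s)
    (X Y : (spV k × s) × (Fin 2 → k) ⊗[k] T) : (R.superalgebra s hs).bracket X Y =
      (⁅X.1, Y.1⁆ + R.oddBracket s hs X.2 Y.2, evenAct s X.1 Y.2 - evenAct s Y.1 X.2) := by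
  refine Prod.ext (Prod.ext ?_ ?_) rfl
  · simp [superalgebra, oddBracket, sub_eq_add_neg]
  · simp [superalgebra, oddBracket]

variable {R}

/-- Skewness of `s` for the form gives equivariance of the `γ` part, and the derivation property
that of the `d` part. The statement allows any `s` between the inner derivations and all skew
derivations, because `g(S_{1,2}, S)` is first identified with such an algebra for `s = tri(C) ⊕ C³`.
-/
theorem IsOrthogonal.superalgebra_isLie [NeZero (2 : k)] (hR : R.IsOrthogonal)
    (s : LieSubalgebra k (Module.End k T)) (hs : ∀ x y, R.triple x y ∈ s)
    (hd : s ≤ R.derivations) : (R.superalgebra s hs).IsLie := by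
  refine Superalgebra.isLie_of_cube _ (R.oddBracket s hs) (evenAct s) (fun i => rfl)
    (R.superalgebra_bracket s hs) (fun a b w => ?_) (fun w w' => ?_) (fun a w w' => ?_)
    (fun w => ?_)
  · induction w using TensorProduct.induction_on with
    | zero => simp
    | add x y hx hy => simp only [map_add, hx, hy]; abel
    | tmul u x =>
      have h1 : (⁅a, b⁆ : spV k × s).1.1 u = a.1.1 (b.1.1 u) - b.1.1 (a.1.1 u) := rfl
      have h2 : (⁅a, b⁆ : spV k × s).2.1 x = a.2.1 (b.2.1 x) - b.2.1 (a.2.1 x) := rfl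
      simp only [evenAct_tmul, map_add, h1, h2, TensorProduct.sub_tmul, TensorProduct.tmul_sub]
      abel
  · induction w using TensorProduct.induction_on with
    | zero => simp
    | add x y hx hy => simp only [map_add, LinearMap.add_apply, hx, hy]
    | tmul u x =>
      induction w' using TensorProduct.induction_on with
      | zero => simp
      | add x y hx hy => simp only [map_add, LinearMap.add_apply, hx, hy]
      | tmul v y =>
        rw [oddBracket_tmul, oddBracket_tmul, hR.form_symm x y, gamma_symm u v, symp_swap k u v]
        refine Prod.ext rfl (Subtype.ext ?_)
        simp [hR.triple_skew x y]
  · induction w using TensorProduct.induction_on with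
    | zero => simp
    | add x y hx hy => simp only [map_add, LinearMap.add_apply, lie_add, hx, hy]; abel
    | tmul u x =>
      induction w' using TensorProduct.induction_on with
      | zero => simp
      | add x y hx hy => simp only [map_add, lie_add, hx, hy]; abel
      | tmul v y =>
        have h1 := (hd a.2.2).1 x y
        have h2 := mem_spV.1 a.1.2 u v
        simp only [evenAct_tmul, map_add, LinearMap.add_apply, oddBracket_tmul]
        refine Prod.ext ?_ (Subtype.ext ?_)
        · change ⁅a.1, -(R.form x y • gamma k u v)⁆ = _
          simp only [lie_neg, lie_smul, lie_gamma, Prod.fst_add]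
          rw [eq_neg_of_add_eq_zero_left h1]
          module
        · change ⁅a.2.1, symp k u v • R.triple x y⁆ = symp k (a.1.1 u) v • R.triple x y +
            symp k u v • R.triple (a.2.1 x) y + (symp k u (a.1.1 v) • R.triple x y +
            symp k u v • R.triple x (a.2.1 y))
          have h3 : ⁅a.2.1, R.triple x y⁆ = R.triple (a.2.1 x) y + R.triple x (a.2.1 y) := by
            ext z
            change a.2.1 (R.triple x y z) - R.triple x y (a.2.1 z) = _
            rw [(hd a.2.2).2]
            simp
          rw [lie_smul, h3, eq_neg_of_add_eq_zero_left h2]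
          module
  -- For `w = e₀ ⊗ x + e₁ ⊗ y` the cube involves only `[x y x]` and `[x y y]`; the axiom on `[x y
  -- y]`, with skewness in the first two arguments, expresses both through the form, and everything
  -- cancels.
  · rw [tensor_eq w]
    set x := tensorCoord 0 w
    set y := tensorCoord 1 w
    have e1 := hR.triple_right x y
    have e2 : R.triple x y x = R.form x x • y - R.form x y • x := by
      rw [hR.triple_skew, LinearMap.neg_apply, hR.triple_right, hR.form_symm]; abel
    have e3 := hR.triple_self
    refine tensor_ext fun i => ?_
    simp only [map_add, LinearMap.add_apply, oddBracket_tmul, evenAct_tmul]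
    have g : ∀ (c : k) (u v z : Fin 2 → k), (-(c • gamma k u v) : spV k).1 z =
      -(c • (symp k u z • v + symp k v z • u)) := fun c u v z => by
        rw [← gamma_apply]; rfl
    have d : ∀ (c : k) (x y z : T), (c • (⟨R.triple x y, hs x y⟩ : s)).1 z = c • R.triple x y z :=
      fun c x y z => rfl
    simp only [g, d, e1, e2, e3, tensorCoord_tmul, hR.triple_skew y x, LinearMap.neg_apply,
      hR.form_symm y x]
    fin_cases i <;> simp [symp_apply, e1, e2] <;> module

theorem IsOrthogonal.g_isLie [NeZero (2 : k)] (hR : R.IsOrthogonal) : R.g.IsLie :=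
  hR.superalgebra_isLie _ _ hR.inder_le

variable (R) in
theorem triple_mem_inder (x y : T) : R.triple x y ∈ R.inder :=
  LieSubalgebra.subset_lieSpan ⟨x, y, rfl⟩

variable (R) in
theorem g_bracket (X Y : (spV k × R.inder) × (Fin 2 → k) ⊗[k] T) : R.g.bracket X Y =
    (⁅X.1, Y.1⁆ + R.oddBracket R.inder R.triple_mem_inder X.2 Y.2,
      evenAct R.inder X.1 Y.2 - evenAct R.inder Y.1 X.2) := R.superalgebra_bracket _ _ _ _

/-- If an ideal has no nonzero odd element, its even elements `(f, d)` act trivially on `V ⊗ T`,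
since their brackets with odd elements are odd and stay in the ideal. Then `f ⊗ 1 + 1 ⊗ d = 0`: the
off-diagonal entries of `f` vanish, its two diagonal entries agree, trace zero and `2 ≠ 0` give `f =
0`, and `d = 0` follows. -/
theorem IsOrthogonal.ideal_eq_bot [NeZero (2 : k)] (hR : R.IsOrthogonal)
    {I : Submodule k ((spV k × R.inder) × (Fin 2 → k) ⊗[k] T)} (hI : R.g.IsIdeal I)
    (hodd : ∀ X ∈ I, X.1 = 0 → X = 0) : I = ⊥ := by
  obtain ⟨x₀, hx₀⟩ : ∃ x : T, x ≠ 0 := by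
    by_contra! h
    exact hR.form_ne_zero (by ext x; simp [h x])
  have h2 : (2 : k) ≠ 0 := NeZero.ne 2
  rw [eq_bot_iff]
  intro X hX
  rw [hI.graded] at hX
  obtain ⟨⟨⟨f, d⟩, w⟩, ⟨hX0, hX0'⟩, X1, ⟨hX1, hX1'⟩, rfl⟩ := Submodule.mem_sup.1 hX
  obtain rfl : w = 0 := hX0'.2
  obtain rfl : X1 = 0 := hodd X1 hX1 hX1'.1
  have hact : ∀ w, evenAct R.inder (f, d) w = 0 := fun w => by
    have h3 := hI.right _ hX0 (0, w)
    rw [g_bracket] at h3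
    have h4 := hodd _ h3 (by simp)
    simpa using congrArg Prod.snd h4
  have hc : ∀ i j x, f.1 (Pi.single i 1) j • x + (Pi.single i 1 : Fin 2 → k) j • d.1 x = 0 :=
    fun i j x => by
      have h3 := congrArg (tensorCoord j) (hact (Pi.single i 1 ⊗ₜ x))
      rw [evenAct_tmul] at h3
      simpa only [map_add, tensorCoord_tmul, map_zero] using h3
  have f01 : f.1 (Pi.single 0 1) 1 = 0 := by
    have := hc 0 1 x₀
    simpa [hx₀] using this
  have f10 : f.1 (Pi.single 1 1) 0 = 0 := by
    have := hc 1 0 x₀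
    simpa [hx₀] using this
  have f00 : f.1 (Pi.single 0 1) 0 = 0 := by
    have h3 := hc 0 0 x₀
    have h4 := hc 1 1 x₀
    have h5 := spV_trace f
    simp only [Pi.single_eq_same, one_smul] at h3 h4
    have h6 : (2 * f.1 (Pi.single 0 1) 0) • x₀ = 0 := by
      linear_combination (norm := module) h3 - h4 + h5 • x₀
    simpa [hx₀, h2] using h6
  have hf : f = 0 := by
    rw [spV_eq_gamma f, f00, f01, f10]; simp
  have hd : d = 0 := by
    ext x
    have := hc 0 0 x
    simpa [f00] using this
  simp [hf, hd]

theorem gamma_act_mem_ideal {I : Submodule k ((spV k × R.inder) × (Fin 2 → k) ⊗[k] T)}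
    (hI : R.g.IsIdeal I) (u v : Fin 2 → k) {w : (Fin 2 → k) ⊗[k] T} (hw : (0, w) ∈ I) :
    (0, evenAct R.inder (gamma k u v, 0) w) ∈ I := by
  have := hI.left ((gamma k u v, 0), 0) _ hw
  rw [g_bracket] at this
  simpa using this

/-- `γ_{1,1}` sends `e₀` to `-2 e₁`, so `sp(V)` carries `e₀ ⊗ x` to `v ⊗ x` for every `v`. -/
theorem tmul_mem_ideal [NeZero (2 : k)] {I : Submodule k ((spV k × R.inder) × (Fin 2 → k) ⊗[k] T)}
    (hI : R.g.IsIdeal I) {x : T} (hx : (0, (Pi.single 0 1 : Fin 2 → k) ⊗ₜ x) ∈ I)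
    (v : Fin 2 → k) : (0, v ⊗ₜ x) ∈ I := by
  have h3 := gamma_act_mem_ideal hI (Pi.single 1 1) (Pi.single 1 1) hx
  rw [evenAct_tmul, gamma_apply] at h3
  simp [symp_apply] at h3
  have h4 := I.add_mem (I.smul_mem (v 0) hx) (I.smul_mem (-(2⁻¹ * v 1)) h3)
  convert h4 using 1
  refine Prod.ext (by simp) (tensor_ext fun i => ?_)
  fin_cases i
  · simp
  · simp
    match_scalars <;> field_simp <;> ring

/-- A pure tensor is extracted with the nilpotent map `γ_{0,0}`: it kills `e₀` and sends `e₁` to `2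
e₀`, so `e₀ ⊗ x + e₁ ⊗ y` becomes `2 e₀ ⊗ y`. If `y = 0` the element is pure already. -/
theorem exists_tmul_mem_ideal [NeZero (2 : k)]
    {I : Submodule k ((spV k × R.inder) × (Fin 2 → k) ⊗[k] T)} (hI : R.g.IsIdeal I)
    {w : (Fin 2 → k) ⊗[k] T} (hw : (0, w) ∈ I) (hw0 : w ≠ 0) :
    ∃ x, x ≠ 0 ∧ ∀ v : Fin 2 → k, (0, v ⊗ₜ x) ∈ I := by
  have hg : ∀ u v z, (gamma k u v).1 z = symp k u z • v + symp k v z • u := gamma_apply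
  have hw' := hw
  rw [tensor_eq w] at hw' hw0
  by_cases hy : tensorCoord 1 w = 0
  · rw [hy, TensorProduct.tmul_zero, add_zero] at hw' hw0
    exact ⟨_, fun h => hw0 (by rw [h]; simp), tmul_mem_ideal hI hw'⟩
  · refine ⟨_, hy, tmul_mem_ideal hI ?_⟩
    have h3 := gamma_act_mem_ideal hI (Pi.single 0 1) (Pi.single 0 1) hw'
    rw [map_add, evenAct_tmul, evenAct_tmul, hg, hg] at h3
    simp [symp_apply] at h3
    have h4 := I.smul_mem (2⁻¹ : k) h3
    convert h4 using 1
    refine Prod.ext (by simp) (tensor_ext fun i => ?_)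
    fin_cases i
    · simp
      match_scalars <;> field_simp <;> ring
    · simp

/-- One nonzero odd element spreads over the whole algebra: a pure tensor `u ⊗ x`, paired with `u ⊗
y` for some `(x | y) ≠ 0`, yields `γ_{u,u}`; acting on `e₁ ⊗ z`, `γ_{0,0}` yields all `e₀ ⊗ z` and
hence the odd part; polarization yields all of `sp(V)`, and brackets of odd elements yield the
`d_{x,y}`. -/
theorem IsOrthogonal.ideal_eq_top [NeZero (2 : k)] (hR : R.IsOrthogonal)
    (hnd : ∀ x, (∀ y, R.form x y = 0) → x = 0)
    {I : Submodule k ((spV k × R.inder) × (Fin 2 → k) ⊗[k] T)} (hI : R.g.IsIdeal I)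
    {w : (Fin 2 → k) ⊗[k] T} (hw : (0, w) ∈ I) (hw0 : w ≠ 0) : I = ⊤ := by
  have hg : ∀ u v z, (gamma k u v).1 z = symp k u z • v + symp k v z • u := gamma_apply
  obtain ⟨x, hx0, hx⟩ := exists_tmul_mem_ideal hI hw hw0
  obtain ⟨y, hxy⟩ : ∃ y, R.form x y ≠ 0 := by
    by_contra! h
    exact hx0 (hnd x h)
  -- Because `⟨u | u⟩ = 0`, the bracket `[u ⊗ x, u ⊗ y]` has no `d_{x,y}` term; it equals `-(x | y)
  -- γ_{u,u}`.
  have hgg : ∀ u, ((gamma k u u, 0), 0) ∈ I := fun u => by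
    have h3 := hI.right _ (hx u) (0, u ⊗ₜ y)
    rw [g_bracket, oddBracket_tmul] at h3
    have h4 := I.smul_mem (-(R.form x y)⁻¹) h3
    convert h4 using 1
    have : symp k u u = 0 := by simp [symp_apply, mul_comm]
    simp [this, hxy]
  have hodd : ∀ w, (0, w) ∈ I := fun w => by
    have h0 : ∀ x, (0, (Pi.single 0 1 : Fin 2 → k) ⊗ₜ x) ∈ I := fun x => by
      have h3 := hI.right _ (hgg (Pi.single 0 1)) (0, Pi.single 1 1 ⊗ₜ x)
      rw [g_bracket] at h3
      simp [evenAct_tmul, hg, symp_apply] at h3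
      have h4 := I.smul_mem (2⁻¹ : k) h3
      convert h4 using 1
      refine Prod.ext (by simp) (tensor_ext fun i => ?_)
      fin_cases i
      · simp
        match_scalars <;> field_simp <;> ring
      · simp
    have h3 := I.add_mem (tmul_mem_ideal hI (h0 (tensorCoord 0 w)) (Pi.single 0 1)) (tmul_mem_ideal
      hI (h0 (tensorCoord 1 w)) (Pi.single 1 1))
    rw [tensor_eq w]
    simpa using h3
  have hgg' : ∀ u v, ((gamma k u v, 0), 0) ∈ I := fun u v => by
    have h3 := I.smul_mem (2⁻¹ : k) (I.sub_mem (I.sub_mem (hgg (u + v)) (hgg u)) (hgg v))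
    convert h3 using 1
    refine Prod.ext (Prod.ext ?_ (by simp)) (by simp)
    simp [gamma_symm v u]
    match_scalars <;> field_simp <;> ring
  have hf : ∀ f : spV k, ((f, 0), 0) ∈ I := fun f => by
    have h3 := I.sub_mem (I.sub_mem
      (I.smul_mem (2⁻¹ * f.1 (Pi.single 1 1) 0) (hgg' (Pi.single 0 1) (Pi.single 0 1)))
      (I.smul_mem (f.1 (Pi.single 0 1) 0) (hgg' (Pi.single 0 1) (Pi.single 1 1))))
      (I.smul_mem (2⁻¹ * f.1 (Pi.single 0 1) 1) (hgg' (Pi.single 1 1) (Pi.single 1 1)))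
    convert h3 using 1
    refine Prod.ext (Prod.ext (spV_eq_gamma f) (by simp)) (by simp)
  have hd : ∀ d : R.inder, ((0, d), 0) ∈ I := fun d => by
    have h3 : d.1 ∈ (I.comap (LinearMap.inl k _ _ ∘ₗ LinearMap.inr k _ _)).map
        R.inder.toSubmodule.subtype := by
      refine Submodule.span_le.2 ?_ (R.span_triple_lie hR.triple_mem d.2)
      rintro _ ⟨x, y, rfl⟩
      refine ⟨⟨R.triple x y, R.triple_mem_inder x y⟩, ?_, rfl⟩
      -- Here `⟨e₀ | e₁⟩ = 1`, so this bracket is `d_{x,y}` up to an element of `sp(V)`, which is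
      -- already known to lie in the ideal.
      have h4 := hI.right _ (hodd (Pi.single 0 1 ⊗ₜ x)) (0, Pi.single 1 1 ⊗ₜ y)
      rw [g_bracket, oddBracket_tmul] at h4
      have h5 := I.add_mem h4 (hf (R.form x y • gamma k (Pi.single 0 1) (Pi.single 1 1)))
      change ((0, _), 0) ∈ I
      convert h5 using 1
      simp [symp_apply]
    obtain ⟨d', hd', hdd⟩ := h3
    obtain rfl : d' = d := Subtype.ext hdd
    exact hd'
  rw [eq_top_iff]
  rintro ⟨⟨f, d⟩, w⟩ -
  have := I.add_mem (I.add_mem (hf f) (hd d)) (hodd w)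
  simpa using this

theorem IsOrthogonal.g_isSimple [NeZero (2 : k)] (hR : R.IsOrthogonal)
    (hnd : ∀ x, (∀ y, R.form x y = 0) → x = 0) : R.g.IsSimple := by
  have h2 : (2 : k) ≠ 0 := NeZero.ne 2
  have hg : ∀ u v z, (gamma k u v).1 z = symp k u z • v + symp k v z • u := gamma_apply
  constructor
  · obtain ⟨x, hx⟩ : ∃ x : T, ∃ y, R.form x y ≠ 0 := by
      by_contra! h
      exact hR.form_ne_zero (by ext x y; exact h x y)
    obtain ⟨y, hxy⟩ := hx
    refine ⟨((0 : spV k × R.inder), Pi.single 0 1 ⊗ₜ[k] x), (0, Pi.single 0 1 ⊗ₜ[k] y), fun h => ?_⟩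
    rw [g_bracket, oddBracket_tmul] at h
    have h3 := congrArg (fun X => X.1.1.1 (Pi.single 1 1) 0) h
    have h4 : (⁅(0 : spV k × R.inder), (0 : spV k × R.inder)⁆ + (-(R.form x y • gamma k (Pi.single
      0 1) (Pi.single 0 1)),
      symp k (Pi.single 0 1) (Pi.single 0 1) • (⟨R.triple x y, R.triple_mem_inder x y⟩ :
        R.inder))).1.1 (Pi.single 1 1) 0 =
        -(R.form x y * ((gamma k (Pi.single 0 1) (Pi.single 0 1)).1 (Pi.single 1 1) 0)) := by
      rw [lie_zero, zero_add]; rfl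
    replace h3 := h4.symm.trans h3
    have h5 : R.form x y * 2 = 0 := by simpa [hg, symp_apply, one_add_one_eq_two] using h3
    exact mul_ne_zero hxy h2 h5
  · intro I hI
    by_cases hodd : ∀ X ∈ I, X.1 = 0 → X = 0
    · left
      exact hR.ideal_eq_bot hI hodd
    · right
      push Not at hodd
      obtain ⟨⟨_, w⟩, hw, rfl, hw0⟩ := hodd
      exact hR.ideal_eq_top hnd hI hw fun h => hw0 (by rw [h]; rfl)

end TripleSystem

end OrthogonalTripleSystems

end Supersquare

namespace Supersquare

attribute [local instance] LieRing.ofAssociativeRing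
attribute [local instance] subalgebraAddCommGroup subalgebraAddCommMonoid subalgebraAddGroup
  subalgebraSubNegMonoid subalgebraAddMonoid subalgebraAddZeroClass subalgebraAdd subalgebraZero
  subalgebraSub subalgebraNeg subalgebraModule subalgebraSMul
attribute [local instance 2000] Prod.instAddCommMonoid Prod.instAddCommGroup Prod.instModule

theorem three_eq_zero (k : Type*) [Field k] [CharP k 3] : (3 : k) = 0 := by
  exact_mod_cast CharP.cast_eq_zero k 3

/-- This replaces the factor `1/2` in the triples `t_{x,y}` and in the Jordan product by a sign. -/
theorem inv_two_eq (k : Type*) [Field k] [CharP k 3] : (2 : k)⁻¹ = -1 := by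
  have h2 : (2 : k) ≠ 0 := NeZero.ne 2
  have h3 := three_eq_zero k
  field_simp
  linear_combination h3

theorem fin3_sum {A : Type*} [AddCommMonoid A] (f : Fin 3 → A) (i : Fin 3) :
    ∑ j, f j = f i + f (i + 1) + f (i + 2) := by
  rw [Fin.sum_univ_three]
  fin_cases i
  · rfl
  · change _ = f 1 + f 2 + f 0
    rw [add_comm (f 1 + f 2), add_assoc]
  · change _ = f 2 + f 0 + f 1
    rw [add_comm, add_assoc]

theorem fin3_add_eq (i : Fin 3) : i + 1 + 1 = i + 2 ∧ i + 1 + 2 = i ∧ i + 2 + 1 = i ∧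
    i + 2 + 2 = i + 1 := by revert i; decide

theorem fin3_sub_eq (i : Fin 3) : i - i = 0 ∧ i - (i + 1) = 2 ∧ i - (i + 2) = 1 ∧
    i + 1 - i = 1 ∧ i + 2 - i = 2 := by revert i; decide

namespace HurwitzAlgebra

variable {k C : Type*} [Field k] [AddCommGroup C] [Module k C] (H : HurwitzAlgebra k C)

/-! ### The triality Lie algebra of a para-Hurwitz algebra. -/

section Para

variable [NeZero (2 : k)]

theorem mem_para_part_zero (x : C) : x ∈ H.para.part 0 := H.mem_part_zero x

theorem para_form : H.para.form = H.form := rfl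

/-- The linearization of `(x • y) • x = q(x) y`. Together with its mirror image below, the symmetry
and associativity of the form, and the relations defining `tri(C)`, it is all that the identities of
the model use about the product. -/
theorem para_mul_mul_left (x y z : C) : H.para.mul (H.para.mul x y) z +
    H.para.mul (H.para.mul z y) x = H.form x z • y := by
  have := H.para.mul_mul_left (H.mem_para_part_zero x) (H.mem_para_part_zero y)
    (H.mem_para_part_zero z)
  simpa [para_form] using this

theorem para_mul_mul_right (x y z : C) : H.para.mul x (H.para.mul y z) +
    H.para.mul z (H.para.mul y x) = H.form x z • y := by
  have := H.para.mul_mul_right (H.mem_para_part_zero x) (H.mem_para_part_zero y)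
    (H.mem_para_part_zero z)
  simpa [para_form] using this

theorem form_para_mul (x y z : C) : H.form (H.para.mul x y) z = H.form x (H.para.mul y z) :=
  H.para.form_assoc x y z

theorem form_para_mul' (x y z : C) : H.form x (H.para.mul y z) = H.form y (H.para.mul z x) := by
  rw [← form_para_mul, form_comm, ← form_para_mul, ← form_para_mul, H.form_comm (H.para.mul z x),
    ← form_para_mul]

theorem para_endPart_one {f : Module.End k C} (hf : f ∈ H.para.endPart 1) : f = 0 := by
  ext x
  have := hf 0 x (H.mem_para_part_zero x)
  simpa [para, toSuper, HurwitzSuperalgebra.para, Superspace.ofEven] using this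

theorem mem_para_endPart_zero (f : Module.End k C) : f ∈ H.para.endPart 0 := by
  intro j x hx
  rcases zmod2_cases j with rfl | rfl
  · exact H.mem_para_part_zero _
  · have : x = 0 := by
      simpa [para, toSuper, HurwitzSuperalgebra.para, Superspace.ofEven] using hx
    rw [this, map_zero]; exact zero_mem _

theorem mem_para_triPart_zero {d : Fin 3 → Module.End k C} : d ∈ H.para.triPart 0 ↔
    (∀ n x y, H.form (d n x) y + H.form x (d n y) = 0) ∧
    ∀ x y, d 0 (H.para.mul x y) = H.para.mul (d 1 x) y + H.para.mul x (d 2 y) := by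
  constructor
  · rintro ⟨h1, h2⟩
    refine ⟨fun n x y => ?_, fun x y => ?_⟩
    · simpa [para_form] using (h1 n).2 0 x (H.mem_para_part_zero x) y
    · simpa using h2 0 x (H.mem_para_part_zero x) y
  · rintro ⟨h1, h2⟩
    refine ⟨fun n => ⟨H.mem_para_endPart_zero _, fun j x hx y => ?_⟩, fun j x hx y => ?_⟩
    · simpa [para_form] using h1 n x y
    · simpa using h2 x y

theorem para_tri_eq : H.para.tri = H.para.triPart 0 := by
  refine sup_eq_left.2 fun d hd => ?_
  have : d = 0 := funext fun n => H.para_endPart_one (hd.1 n).1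
  rw [this]; exact zero_mem _

theorem mem_para_tri {d : Fin 3 → Module.End k C} : d ∈ H.para.tri ↔
    (∀ n x y, H.form (d n x) y + H.form x (d n y) = 0) ∧
    ∀ x y, d 0 (H.para.mul x y) = H.para.mul (d 1 x) y + H.para.mul x (d 2 y) := by
  rw [para_tri_eq, mem_para_triPart_zero]

theorem tri_skew (d : H.para.tri) (n : Fin 3) (x y : C) :
    H.form (d.1 n x) y = - H.form x (d.1 n y) :=
  eq_neg_of_add_eq_zero_left ((H.mem_para_tri.1 d.2).1 n x y)

/-- `tri(C)` is stable under the cyclic shift, so the triality relation holds with any of the three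
components in the leading place. -/
theorem tri_mul (d : H.para.tri) (n : Fin 3) (x y : C) : d.1 n (H.para.mul x y) =
    H.para.mul (d.1 (n + 1) x) y + H.para.mul x (d.1 (n + 2) y) := by
  have h := H.para.theta_mem_triPart (-n) (H.para_tri_eq.le d.2)
  have h' := (H.mem_para_triPart_zero.1 h).2 x y
  simp only [theta, LinearMap.funLeft_apply, sub_neg_eq_add, zero_add] at h'
  rwa [add_comm 1, add_comm 2] at h'

theorem triBracket_apply (d e : H.para.tri) (n : Fin 3) (x : C) :
    (H.para.triBracket d e).1 n x = d.1 n (e.1 n x) - e.1 n (d.1 n x) := by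
  have := H.para.superComm_of_mem (H.mem_para_endPart_zero (d.1 n)) (H.mem_para_endPart_zero (e.1
    n))
  change H.para.superComm (d.1 n) (e.1 n) x = _
  rw [this]
  simp

theorem para_t_zero (x y z : C) : H.para.t x y 0 z = H.form x z • y - H.form y z • x := by
  change H.para.sigma x y z = _
  have := H.para.sigma_apply (H.mem_para_part_zero x) (H.mem_para_part_zero y)
    (H.mem_para_part_zero z)
  simpa [para_form] using this

end Para

variable [CharP k 3]

theorem para_t_one (x y z : C) : H.para.t x y 1 z =
    -(H.form x y • z) - H.para.mul (H.para.mul y z) x := by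
  have := H.para.t_apply_one (H.mem_para_part_zero x) (H.mem_para_part_zero y)
    (H.mem_para_part_zero z)
  simpa [inv_two_eq, para_form] using this

theorem para_t_two (x y z : C) : H.para.t x y 2 z =
    -(H.form x y • z) - H.para.mul x (H.para.mul z y) := by
  have := H.para.t_apply_two (H.mem_para_part_zero x) (H.mem_para_part_zero y)
    (H.mem_para_part_zero z)
  simpa [inv_two_eq, para_form] using this

/-- For the last two components the linearized composition identity turns `t_{x,y} + t_{y,x}` into
`-3 b(x, y)` times the identity. -/
theorem para_t_skew (x y : C) (n : Fin 3) (z : C) : H.para.t x y n z = -H.para.t y x n z := by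
  have h3 := three_eq_zero k
  fin_cases n
  · change H.para.t x y 0 z = -H.para.t y x 0 z
    rw [para_t_zero, para_t_zero]; abel
  · change H.para.t x y 1 z = -H.para.t y x 1 z
    rw [para_t_one, para_t_one, H.form_comm y x]
    linear_combination (norm := module) -H.para_mul_mul_left y z x - h3 • (H.form x y • z) +
      (-H.form_comm y x) • z
  · change H.para.t x y 2 z = -H.para.t y x 2 z
    rw [para_t_two, para_t_two, H.form_comm y x]
    linear_combination (norm := module) -H.para_mul_mul_right x z y - h3 • (H.form x y • z)

theorem thetaT_skew (i : Fin 3) (x y : C) : H.para.thetaT i x y = -H.para.thetaT i y x := by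
  ext1; funext n; ext z
  exact H.para_t_skew x y (n - i) z

theorem thetaT_self (i : Fin 3) (x : C) : H.para.thetaT i x x = 0 := by
  have h := H.thetaT_skew i x x
  have h2 : (2 : k) • H.para.thetaT i x x = 0 := by
    linear_combination (norm := module) h
  exact (smul_eq_zero.1 h2).resolve_left (NeZero.ne 2)

/-- This relation is what the Jacobi identity of `g(S, S')` says about three elements lying in the
three different copies of `S ⊗ S'`. Here it provides the equivariance of `modelDer` in the `tri(C)`
component. -/
theorem thetaT_cyclic (i : Fin 3) (u v w : C) : H.para.thetaT i u (H.para.mul v w) +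
    H.para.thetaT (i + 1) v (H.para.mul w u) + H.para.thetaT (i + 2) w (H.para.mul u v) = 0 := by
  have h3 := three_eq_zero k
  -- The component of index `i`: subtracting the shifts `0, 1, 2` modulo 3 selects the entries `0,
  -- 2, 1` of the three triples. The other two components are this one with `u, v, w` permuted
  -- cyclically.
  have key : ∀ u v w z : C, H.para.t u (H.para.mul v w) 0 z + H.para.t v (H.para.mul w u) 2 z +
      H.para.t w (H.para.mul u v) 1 z = 0 := fun u v w z => by
    rw [para_t_zero, para_t_one, para_t_two]
    have e1 := H.para_mul_mul_right (H.para.mul w z) u v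
    have e2 := congrArg (H.para.mul v) (H.para_mul_mul_right u w z)
    have e4 := H.para_mul_mul_left (H.para.mul u v) z w
    simp only [map_add, map_smul] at e2
    rw [H.form_comm _ v, H.form_para_mul' v, H.form_para_mul' w] at e1
    rw [H.form_comm _ w, H.form_para_mul' w] at e4
    rw [H.form_comm (H.para.mul v w) z, H.form_para_mul' v w, H.form_para_mul' w u]
    linear_combination (norm := module) e1 - e2 - e4 - h3 • (H.form u (H.para.mul v w) • z)
  ext1; funext n; ext z
  change H.para.t u (H.para.mul v w) (n - i) z + H.para.t v (H.para.mul w u) (n - (i + 1)) z +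
    H.para.t w (H.para.mul u v) (n - (i + 2)) z = 0
  obtain ⟨j, rfl⟩ : ∃ j, n = i + j := ⟨n - i, by abel⟩
  fin_cases j <;> simp [add_sub_add_left_eq_sub]
  · exact key u v w z
  · have := key v w u z
    linear_combination (norm := module) this
  · have := key w u v z
    linear_combination (norm := module) this

/-- `t_{x,y}` is built from the form and the product alone, both respected by `tri(C)`. The
component of index `i` needs only skewness; the other two need the triality relation in its shifted
forms. -/
theorem triBracket_thetaT (d : H.para.tri) (i : Fin 3) (x y : C) :
    H.para.triBracket d (H.para.thetaT i x y) =
      H.para.thetaT i (d.1 i x) y + H.para.thetaT i x (d.1 i y) := by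
  ext1; funext n; ext z
  rw [triBracket_apply]
  change d.1 n (H.para.t x y (n - i) z) - H.para.t x y (n - i) (d.1 n z) =
    H.para.t (d.1 i x) y (n - i) z + H.para.t x (d.1 i y) (n - i) z
  obtain ⟨j, rfl⟩ : ∃ j, n = i + j := ⟨n - i, by abel⟩
  obtain ⟨a1, a2, a3, a4⟩ := fin3_add_eq i
  rw [add_sub_cancel_left]
  fin_cases j
  · simp [para_t_zero, H.tri_skew]
    module
  · simp only [Fin.mk_one, para_t_one, map_sub, map_neg, map_smul, H.tri_mul, H.tri_skew, a1, a2,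
      a3, a4, map_add, LinearMap.add_apply]
    module
  · simp only [Fin.reduceFinMk, para_t_two, map_sub, map_neg, map_smul, H.tri_mul, H.tri_skew, a1,
      a2, a3, a4, map_add]
    module

/-! ### The model `k × C³` of the orthogonal triple system. -/

section Model

/-- The pairing `-α β + ∑ form(aᵢ, bᵢ)` on `k × C³`. -/
noncomputable def modelForm : (k × (Fin 3 → C)) →ₗ[k] (k × (Fin 3 → C)) →ₗ[k] k :=
  LinearMap.mk₂ k (fun x y => -(x.1 * y.1) + ∑ i, H.form (x.2 i) (y.2 i))
    (fun _ _ _ => by simp [Finset.sum_add_distrib]; ring)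
    (fun _ _ _ => by simp [Finset.mul_sum, mul_add]; ring)
    (fun _ _ _ => by simp [Finset.sum_add_distrib]; ring)
    (fun _ _ _ => by simp [Finset.mul_sum, mul_add]; ring)

theorem modelForm_apply (x y : k × (Fin 3 → C)) :
    H.modelForm x y = -(x.1 * y.1) + ∑ i, H.form (x.2 i) (y.2 i) := rfl

/-- The action of `tri(C) ⊕ C³` on `k × C³`. -/
noncomputable def modelAct : (H.para.tri × (Fin 3 → C)) →ₗ[k] Module.End k (k × (Fin 3 → C)) :=
  LinearMap.mk₂ k (fun p x => (-∑ i, H.form (p.2 i) (x.2 i), fun i => p.1.1 i (x.2 i) -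
      x.1 • p.2 i + H.para.mul (p.2 (i + 1)) (x.2 (i + 2)) -
      H.para.mul (x.2 (i + 1)) (p.2 (i + 2))))
    (fun _ _ _ => by
      refine Prod.ext ?_ (funext fun i => ?_)
      · simp [Finset.sum_add_distrib]; ring
      · simp; module)
    (fun _ _ _ => by
      refine Prod.ext ?_ (funext fun i => ?_)
      · simp [Finset.mul_sum]
      · simp; module)
    (fun _ _ _ => by
      refine Prod.ext ?_ (funext fun i => ?_)
      · simp [Finset.sum_add_distrib]; ring
      · simp; module)
    (fun _ _ _ => by
      refine Prod.ext ?_ (funext fun i => ?_)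
      · simp [Finset.mul_sum]
      · simp; module)

theorem modelAct_fst (p : H.para.tri × (Fin 3 → C)) (x : k × (Fin 3 → C)) :
    (H.modelAct p x).1 = -∑ i, H.form (p.2 i) (x.2 i) := rfl

theorem modelAct_snd (p : H.para.tri × (Fin 3 → C)) (x : k × (Fin 3 → C)) (i : Fin 3) :
    (H.modelAct p x).2 i = p.1.1 i (x.2 i) - x.1 • p.2 i +
      H.para.mul (p.2 (i + 1)) (x.2 (i + 2)) - H.para.mul (x.2 (i + 1)) (p.2 (i + 2)) := rfl

/-- The skew map `k × C³ → tri(C) ⊕ C³` that defines the triple product of the model. -/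
noncomputable def modelDer : (k × (Fin 3 → C)) →ₗ[k] (k × (Fin 3 → C)) →ₗ[k]
    H.para.tri × (Fin 3 → C) :=
  LinearMap.mk₂ k (fun x y => (∑ i, H.para.thetaT i (x.2 i) (y.2 i), fun i =>
      x.1 • y.2 i - y.1 • x.2 i - (H.para.mul (x.2 (i + 1)) (y.2 (i + 2)) -
        H.para.mul (y.2 (i + 1)) (x.2 (i + 2)))))
    (fun _ _ _ => by
      refine Prod.ext ?_ (funext fun i => ?_)
      · simp [Finset.sum_add_distrib]
      · simp; module)
    (fun _ _ _ => by
      refine Prod.ext ?_ (funext fun i => ?_)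
      · simp [Finset.smul_sum]
      · simp; module)
    (fun _ _ _ => by
      refine Prod.ext ?_ (funext fun i => ?_)
      · simp [Finset.sum_add_distrib]
      · simp; module)
    (fun _ _ _ => by
      refine Prod.ext ?_ (funext fun i => ?_)
      · simp [Finset.smul_sum]
      · simp; module)

theorem modelDer_fst (x y : k × (Fin 3 → C)) :
    (H.modelDer x y).1 = ∑ i, H.para.thetaT i (x.2 i) (y.2 i) := rfl

theorem modelDer_snd (x y : k × (Fin 3 → C)) (i : Fin 3) :
    (H.modelDer x y).2 i = x.1 • y.2 i - y.1 • x.2 i -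
      (H.para.mul (x.2 (i + 1)) (y.2 (i + 2)) - H.para.mul (y.2 (i + 1)) (x.2 (i + 2))) := rfl

/-- The bracket of `tri(C) ⊕ C³`. -/
noncomputable def modelBracket (p q : H.para.tri × (Fin 3 → C)) : H.para.tri × (Fin 3 → C) :=
  (H.para.triBracket p.1 q.1 - ∑ i, H.para.thetaT i (p.2 i) (q.2 i), fun i =>
    p.1.1 i (q.2 i) - q.1.1 i (p.2 i) - (H.para.mul (p.2 (i + 1)) (q.2 (i + 2)) -
      H.para.mul (q.2 (i + 1)) (p.2 (i + 2))))

theorem sum_thetaT_apply (f g : Fin 3 → C) (i : Fin 3) (z : C) :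
    (∑ j, H.para.thetaT j (f j) (g j)).1 i z = H.para.t (f i) (g i) 0 z +
      H.para.t (f (i + 1)) (g (i + 1)) 2 z + H.para.t (f (i + 2)) (g (i + 2)) 1 z := by
  obtain ⟨h0, h1, h2, -⟩ := fin3_sub_eq i
  rw [fin3_sum _ i]
  change H.para.t _ _ (i - i) z + H.para.t _ _ (i - (i + 1)) z + H.para.t _ _ (i - (i + 2)) z = _
  rw [h0, h1, h2]

theorem form_para_mul'' (x y z : C) : H.form x (H.para.mul y z) = H.form z (H.para.mul x y) := by
  rw [H.form_para_mul', H.form_para_mul']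

/-- The range of `modelAct` is thereby closed under commutators, so the Jacobi identity for
`modelBracket` need not be checked separately. The first coordinate follows from the associativity
of the form, the others from the composition identities. -/
theorem modelAct_bracket (p q : H.para.tri × (Fin 3 → C)) :
    H.modelAct (H.modelBracket p q) = ⁅H.modelAct p, H.modelAct q⁆ := by
  have h3 := three_eq_zero k
  refine LinearMap.ext fun x => ?_
  change _ = H.modelAct p (H.modelAct q x) - H.modelAct q (H.modelAct p x)
  obtain ⟨d, c⟩ := p
  obtain ⟨d', c'⟩ := q
  obtain ⟨β, b⟩ := x
  refine Prod.ext ?_ (funext fun i => ?_)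
  · simp only [Prod.fst_sub, modelAct_fst, modelAct_snd, modelBracket, Fin.sum_univ_three, map_sub,
      map_add, map_smul, LinearMap.sub_apply, LinearMap.add_apply, smul_eq_mul, H.tri_skew]
    simp only [Fin.reduceAdd, zero_add]
    simp only [H.form_para_mul, fun j x z => H.form_para_mul'' x (b j) z, H.form_comm (c' _) (c _)]
    linear_combination h3 * (H.form (c 1) (H.para.mul (c' 2) (b 0)) +
      H.form (c 2) (H.para.mul (c' 0) (b 1)) + H.form (c 0) (H.para.mul (c' 1) (b 2)) -
      H.form (c' 1) (H.para.mul (c 2) (b 0)) - H.form (c' 2) (H.para.mul (c 0) (b 1)) -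
      H.form (c' 0) (H.para.mul (c 1) (b 2)))
  · obtain ⟨i1, i2, i3, i4⟩ := fin3_add_eq i
    have e : ((H.modelBracket (d, c) (d', c')).1.1 i (b i)) = d.1 i (d'.1 i (b i)) -
        d'.1 i (d.1 i (b i)) - (∑ j, H.para.thetaT j (c j) (c' j)).1 i (b i) := by
      rw [← triBracket_apply]; rfl
    simp only [Prod.snd_sub, Pi.sub_apply, modelAct_snd, modelAct_fst, e, sum_thetaT_apply]
    simp only [modelBracket, para_t_zero, para_t_one, para_t_two, map_sub, map_add, map_smul,
      LinearMap.sub_apply, LinearMap.add_apply, LinearMap.smul_apply, H.tri_mul, i1, i2, i3, i4,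
      fin3_sum _ i]
    -- One composition identity for each pair of triple products of `c`, `c'` and `b` whose outer
    -- factors are interchanged; after these substitutions only multiples of 3 remain.
    have r1 := H.para_mul_mul_right (c (i + 1)) (b i) (c' (i + 1))
    have r2 := H.para_mul_mul_left (c' (i + 2)) (b i) (c (i + 2))
    have r3 := H.para_mul_mul_right (b (i + 1)) (c i) (c' (i + 1))
    have r4 := H.para_mul_mul_right (b (i + 1)) (c' i) (c (i + 1))
    have r5 := H.para_mul_mul_left (c' (i + 2)) (c i) (b (i + 2))
    have r6 := H.para_mul_mul_left (c (i + 2)) (c' i) (b (i + 2))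
    simp only [H.form_comm (b _) (c _), H.form_comm (b _) (c' _), H.form_comm (c' _) (c _)] at *
    linear_combination (norm := module) -r1 - r2 + r3 - r4 + r5 - r6 +
      h3 • (H.para.mul (c (i + 1)) (H.para.mul (b i) (c' (i + 1))) +
        H.para.mul (H.para.mul (c' (i + 2)) (b i)) (c (i + 2)) +
        β • (H.para.mul (c (i + 1)) (c' (i + 2)) - H.para.mul (c' (i + 1)) (c (i + 2))))

/-- The model of the orthogonal triple system of `H₃(C, *)`. -/
noncomputable def model : TripleSystem k (k × (Fin 3 → C)) where
  form := H.modelForm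
  triple := H.modelDer.compr₂ H.modelAct

theorem model_triple (x y : k × (Fin 3 → C)) :
    H.model.triple x y = H.modelAct (H.modelDer x y) := rfl

theorem modelForm_act (p : H.para.tri × (Fin 3 → C)) (x y : k × (Fin 3 → C)) :
    H.modelForm (H.modelAct p x) y + H.modelForm x (H.modelAct p y) = 0 := by
  obtain ⟨d, c⟩ := p
  obtain ⟨β, b⟩ := x
  obtain ⟨γ, g⟩ := y
  simp only [modelForm_apply, modelAct_fst, modelAct_snd, Fin.sum_univ_three, map_sub,
      map_add, map_smul, LinearMap.sub_apply, LinearMap.add_apply, LinearMap.smul_apply,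
      smul_eq_mul, H.tri_skew]
  simp only [Fin.reduceAdd, zero_add]
  simp only [H.form_para_mul, fun x j y => H.form_para_mul'' (b x) (g j) y, H.form_comm (b _) (c _)]
  ring

/-- Equivariance of `modelDer` under `s`. In the `tri(C)` component the part coming from `tri(C)` is
handled by `triBracket_thetaT`, and the terms with entries of `c`, `a`, `b` from three different
copies cancel by `thetaT_cyclic`. -/
theorem modelBracket_der (p : H.para.tri × (Fin 3 → C)) (x y : k × (Fin 3 → C)) :
    H.modelBracket p (H.modelDer x y) =
      H.modelDer (H.modelAct p x) y + H.modelDer x (H.modelAct p y) := by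
  have h3 := three_eq_zero k
  obtain ⟨d, c⟩ := p
  obtain ⟨α, a⟩ := x
  obtain ⟨β, b⟩ := y
  refine Prod.ext ?_ (funext fun i => ?_)
  · simp only [modelBracket, Prod.fst_add, modelDer_fst, modelDer_snd, modelAct_fst, modelAct_snd,
      map_sum, triBracket_thetaT, Fin.sum_univ_three, map_sub, map_add, map_smul,
      LinearMap.sub_apply, LinearMap.add_apply, LinearMap.smul_apply]
    simp only [Fin.reduceAdd, zero_add]
    -- The six cyclic relations correspond to the six ways of distributing the three factors over
    -- the three copies of `C`; odd arrangements enter with the opposite sign.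
    have e0 := H.thetaT_cyclic 0 (c 0) (a 1) (b 2)
    have e1 := H.thetaT_cyclic 1 (c 1) (a 2) (b 0)
    have e2 := H.thetaT_cyclic 2 (c 2) (a 0) (b 1)
    have e3 := H.thetaT_cyclic 0 (c 0) (b 1) (a 2)
    have e4 := H.thetaT_cyclic 1 (c 1) (b 2) (a 0)
    have e5 := H.thetaT_cyclic 2 (c 2) (b 0) (a 1)
    simp only [Fin.reduceAdd, zero_add] at *
    simp only [fun i j x => H.thetaT_skew i (b j) x] at *
    simp only [fun i j l => H.thetaT_skew i (a j) (c l)]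
    linear_combination (norm := module) e0 + e1 + e2 - e3 - e4 - e5
  · obtain ⟨i1, i2, i3, i4⟩ := fin3_add_eq i
    simp only [modelBracket, Prod.snd_add, Pi.add_apply, modelDer_fst, modelDer_snd, modelAct_fst,
      modelAct_snd, sum_thetaT_apply]
    simp only [para_t_zero, para_t_one, para_t_two, map_sub, map_add, map_smul,
      LinearMap.sub_apply, LinearMap.add_apply, LinearMap.smul_apply, H.tri_mul, i1, i2, i3, i4,
      fin3_sum _ i]
    have r1 := H.para_mul_mul_right (a (i + 1)) (c i) (b (i + 1))
    have r2 := H.para_mul_mul_right (c (i + 1)) (a i) (b (i + 1))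
    have r3 := H.para_mul_mul_right (c (i + 1)) (b i) (a (i + 1))
    have r4 := H.para_mul_mul_left (b (i + 2)) (c i) (a (i + 2))
    have r5 := H.para_mul_mul_left (b (i + 2)) (a i) (c (i + 2))
    have r6 := H.para_mul_mul_left (a (i + 2)) (b i) (c (i + 2))
    simp only [H.form_comm (b _) (c _), H.form_comm (a _) (c _), H.form_comm (b _) (a _)] at *
    linear_combination (norm := module) -r1 + r2 - r3 - r4 + r5 - r6 +
      h3 • (H.para.mul (a (i + 1)) (H.para.mul (c i) (b (i + 1))) +
        H.para.mul (H.para.mul (b (i + 2)) (c i)) (a (i + 2)) -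
        α • (H.para.mul (c (i + 1)) (b (i + 2)) - H.para.mul (b (i + 1)) (c (i + 2))) +
        β • (H.para.mul (c (i + 1)) (a (i + 2)) - H.para.mul (a (i + 1)) (c (i + 2))))

/-- The one axiom that does not come from the invariance of the form and the equivariance of the
triple product. -/
theorem model_triple_right (x y : k × (Fin 3 → C)) :
    H.modelAct (H.modelDer x y) y = H.modelForm x y • y - H.modelForm y y • x := by
  have h3 := three_eq_zero k
  obtain ⟨α, a⟩ := x
  obtain ⟨β, b⟩ := y
  refine Prod.ext ?_ (funext fun i => ?_)
  · simp only [Prod.fst_sub, Prod.smul_fst, modelAct_fst, modelDer_snd, modelForm_apply,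
      Fin.sum_univ_three, map_sub, map_smul, LinearMap.sub_apply, LinearMap.smul_apply, smul_eq_mul]
    simp only [Fin.reduceAdd, zero_add]
    simp only [H.form_para_mul]
    linear_combination H.form_para_mul'' (a 1) (b 2) (b 0) + H.form_para_mul'' (a 2) (b 0) (b 1) +
      H.form_para_mul'' (a 0) (b 1) (b 2)
  · obtain ⟨i1, i2, i3, i4⟩ := fin3_add_eq i
    simp only [Prod.snd_sub, Prod.smul_snd, Pi.sub_apply, Pi.smul_apply, modelAct_snd, modelDer_fst,
      modelDer_snd, sum_thetaT_apply, modelForm_apply]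
    simp only [para_t_zero, para_t_one, para_t_two, map_sub, map_add, map_smul,
      LinearMap.sub_apply, LinearMap.add_apply, LinearMap.smul_apply, i1, i2, i3, i4,
      fin3_sum _ i]
    have r1 := H.para_mul_mul_right (a (i + 1)) (b i) (b (i + 1))
    have r2 := H.para_mul_mul_right (b (i + 1)) (a i) (b (i + 1))
    have r3 := H.para_mul_mul_left (b (i + 2)) (b i) (a (i + 2))
    have r4 := H.para_mul_mul_left (b (i + 2)) (a i) (b (i + 2))
    simp only [H.form_comm (b _) (a _)] at *
    linear_combination (norm := module) -r1 - r2 - r3 - r4 +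
      h3 • (H.para.mul (b (i + 1)) (H.para.mul (a i) (b (i + 1))) +
        H.para.mul (H.para.mul (b (i + 2)) (a i)) (b (i + 2)) -
        H.form (a (i + 1)) (b (i + 1)) • b i - H.form (a (i + 2)) (b (i + 2)) • b i)

/-- The fifth axiom is the representation property `modelAct_bracket` for `modelDer(x, y)` and
`modelDer(u, v)`, combined with the equivariance of `modelDer`. -/
theorem model_isOrthogonal : H.model.IsOrthogonal where
  form_ne_zero h := by
    have := congrArg (fun f => f (1, 0) (1, 0)) h
    simp [model, modelForm_apply] at this
  form_symm x y := by
    change H.modelForm x y = H.modelForm y x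
    simp only [modelForm_apply, H.form_comm (x.2 _), mul_comm]
  triple_self x y := by
    have : H.modelDer x x = 0 := by
      refine Prod.ext ?_ (funext fun i => ?_)
      · simp [modelDer_fst, thetaT_self]
      · simp [modelDer_snd]
    rw [model_triple, this]; simp
  triple_right := H.model_triple_right
  triple_triple x y u v w := by
    simp only [model_triple]
    have h := H.modelAct_bracket (H.modelDer x y) (H.modelDer u v)
    rw [modelBracket_der] at h
    have h' := congrArg (fun f => f w) h
    change _ = H.modelAct (H.modelDer x y) (H.modelAct (H.modelDer u v) w) -
      H.modelAct (H.modelDer u v) (H.modelAct (H.modelDer x y) w) at h'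
    rw [eq_sub_iff_add_eq] at h'
    rw [← h', map_add, LinearMap.add_apply]
  triple_form x y u v := H.modelForm_act _ u v

end Model

end HurwitzAlgebra

end Supersquare

namespace Supersquare

attribute [local instance] LieRing.ofAssociativeRing
attribute [local instance] subalgebraAddCommGroup subalgebraAddCommMonoid subalgebraAddGroup
  subalgebraSubNegMonoid subalgebraAddMonoid subalgebraAddZeroClass subalgebraAdd subalgebraZero
  subalgebraSub subalgebraNeg subalgebraModule subalgebraSMul
attribute [local instance 2000] Prod.instAddCommMonoid Prod.instAddCommGroup Prod.instModule

/-! ### Transport along isomorphisms of triple systems. -/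

namespace TripleSystem

variable {k T T' : Type*} [Field k] [AddCommGroup T] [Module k T] [AddCommGroup T'] [Module k T']
  {R : TripleSystem k T} {R' : TripleSystem k T'}

theorem IsOrthogonal.of_equiv (hR' : R'.IsOrthogonal) (e : T ≃ₗ[k] T')
    (hf : ∀ x y, R'.form (e x) (e y) = R.form x y)
    (ht : ∀ x y z, e (R.triple x y z) = R'.triple (e x) (e y) (e z)) : R.IsOrthogonal where
  form_ne_zero h := hR'.form_ne_zero (by
    ext x y
    have := hf (e.symm x) (e.symm y)
    simpa [h] using this)
  form_symm x y := by rw [← hf, hR'.form_symm, hf]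
  triple_self x y := e.injective (by rw [ht, hR'.triple_self, map_zero])
  triple_right x y := e.injective (by
    rw [ht, hR'.triple_right, map_sub, map_smul, map_smul, hf, hf])
  triple_triple x y u v w := e.injective (by
    simp only [ht, map_add]
    exact hR'.triple_triple _ _ _ _ _)
  triple_form x y u v := by
    rw [← hf, ← hf u, ht, ht]
    exact hR'.triple_form _ _ _ _

theorem conj_mem_inder (e : T ≃ₗ[k] T')
    (ht : ∀ x y z, e (R.triple x y z) = R'.triple (e x) (e y) (e z)) {d : Module.End k T}
    (hd : d ∈ R.inder) : e.conj d ∈ R'.inder := by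
  have : R.inder ≤ R'.inder.comap (e.lieConj : Module.End k T →ₗ⁅k⁆ Module.End k T') := by
    refine LieSubalgebra.lieSpan_le.2 ?_
    rintro _ ⟨x, y, rfl⟩
    have h : e.conj (R.triple x y) = R'.triple (e x) (e y) := by
      ext z
      simp [LinearEquiv.conj_apply, ht]
    change e.conj (R.triple x y) ∈ R'.inder
    rw [h]
    exact R'.triple_mem_inder _ _
  exact this hd

/-- An isomorphism of triple systems acts on inner derivations by conjugation and on `V ⊗ T` by `1 ⊗
e`; `sp(V)` is left fixed. -/
theorem g_iso_of_equiv (e : T ≃ₗ[k] T') (hf : ∀ x y, R'.form (e x) (e y) = R.form x y)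
    (ht : ∀ x y z, e (R.triple x y z) = R'.triple (e x) (e y) (e z)) : R.g.Iso R'.g := by
  have ht' : ∀ x y z, e.symm (R'.triple x y z) = R.triple (e.symm x) (e.symm y) (e.symm z) :=
    fun x y z => by rw [e.symm_apply_eq, ht]; simp
  let E : R.inder ≃ₗ[k] R'.inder :=
    { toFun := fun d => ⟨e.conj d.1, conj_mem_inder e ht d.2⟩
      map_add' := fun _ _ => Subtype.ext (by simp)
      map_smul' := fun _ _ => Subtype.ext (by simp)
      invFun := fun d => ⟨e.symm.conj d.1, conj_mem_inder e.symm ht' d.2⟩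
      left_inv := fun d => Subtype.ext (by ext; simp [LinearEquiv.conj_apply])
      right_inv := fun d => Subtype.ext (by ext; simp [LinearEquiv.conj_apply]) }
  have hE : ∀ (d : R.inder) (x : T), (E d).1 (e x) = e (d.1 x) := fun d x => by
    simp [E, LinearEquiv.conj_apply]
  have hlie : ∀ d d', E ⁅d, d'⁆ = ⁅E d, E d'⁆ := fun d d' => Subtype.ext (e.lieConj.map_lie d.1
    d'.1)
  let F : (Fin 2 → k) ⊗[k] T ≃ₗ[k] (Fin 2 → k) ⊗[k] T' := TensorProduct.congr (LinearEquiv.refl k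
    _) e
  have hact : ∀ (a : spV k × R.inder) w, F (evenAct R.inder a w) =
      evenAct R'.inder (a.1, E a.2) (F w) := fun a w => by
    induction w using TensorProduct.induction_on with
    | zero => simp
    | add x y hx hy => simp only [map_add, hx, hy]
    | tmul u x => simp [F, evenAct_tmul, hE]
  have hodd : ∀ w w', R'.oddBracket R'.inder R'.triple_mem_inder (F w) (F w') =
      ((R.oddBracket R.inder R.triple_mem_inder w w').1,
        E (R.oddBracket R.inder R.triple_mem_inder w w').2) := fun w w' => by
    induction w using TensorProduct.induction_on with
    | zero => simp [Prod.ext_iff]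
    | add x y hx hy => simp [Prod.ext_iff, hx, hy]
    | tmul u x =>
      induction w' using TensorProduct.induction_on with
      | zero => simp [Prod.ext_iff]
      | add x y hx hy => simp [Prod.ext_iff, hx, hy]
      | tmul v y =>
        have : (⟨R'.triple (e x) (e y), R'.triple_mem_inder _ _⟩ : R'.inder) =
            E ⟨R.triple x y, R.triple_mem_inder x y⟩ :=
          Subtype.ext (by ext z; obtain ⟨z, rfl⟩ := e.surjective z; simp [hE, ht])
        simp [F, oddBracket_tmul, hf, this, -SetLike.mk_smul_mk, -SetLike.mk_smul_of_tower_mk]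
  refine ⟨((LinearEquiv.refl k (spV k)).prodCongr E).prodCongr F, fun i X => ?_, fun X Y => ?_⟩
  · change _ ∈ (if i = 0 then Submodule.prod ⊤ ⊥ else Submodule.prod ⊥ ⊤ : Submodule k _) ↔
      _ ∈ (if i = 0 then Submodule.prod ⊤ ⊥ else Submodule.prod ⊥ ⊤ : Submodule k _)
    split_ifs <;> simp [Submodule.mem_prod, Prod.ext_iff]
  · rw [g_bracket, g_bracket]
    refine Prod.ext (Prod.ext ?_ ?_) ?_
    · simp [hodd]
    · simp [hodd, hlie]
    · simp [hact]

end TripleSystem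

namespace HurwitzAlgebra

variable {k C : Type*} [Field k] [AddCommGroup C] [Module k C] (H : HurwitzAlgebra k C)
  [CharP k 3]

/-! ### Coordinates on `H₃(C, *)` and the identification of `T_J^o` with the model. -/

section JordanCoordinates

/-- The diagonal coordinates of an element of `J = H₃(C, *)`. -/
noncomputable def diag (i : Fin 3) : H.J →ₗ[k] k :=
  -(H.form.flip H.one ∘ₗ Matrix.entryLinearMap k C i i ∘ₗ H.toMat)

/-- The off-diagonal coordinates of an element of `J = H₃(C, *)`. -/
noncomputable def offDiag (i : Fin 3) : H.J →ₗ[k] C :=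
  -(Matrix.entryLinearMap k C (i + 2) (i + 1) ∘ₗ H.toMat)

theorem diag_apply (i : Fin 3) (x : H.J) : H.diag i x = -H.form (H.toMat x i i) H.one := rfl

theorem offDiag_apply (i : Fin 3) (x : H.J) : H.offDiag i x = -H.toMat x (i + 2) (i + 1) := rfl

theorem toMat_conj (x : H.J) (i j : Fin 3) : H.toMat x i j = H.conj (H.toMat x j i) := x.2 i j

theorem conj_apply (x : C) : H.conj x = H.form x H.one • H.one - x := rfl

/-- A diagonal entry equals its conjugate, so twice it is `b(entry, 1) 1`; since `2 = -1`, the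
coefficient of `1` is `-b(entry, 1)`. -/
theorem toMat_diag (x : H.J) (i : Fin 3) : H.toMat x i i = H.diag i x • H.one := by
  have h := H.toMat_conj x i i
  have h3 := three_eq_zero k
  rw [conj_apply] at h
  rw [diag_apply]
  linear_combination (norm := module) -h + h3 • H.toMat x i i

theorem toMat_offDiag (x : H.J) (i : Fin 3) : H.toMat x (i + 2) (i + 1) = -H.offDiag i x := by
  rw [offDiag_apply, neg_neg]

theorem toMat_offDiag' (x : H.J) (i : Fin 3) :
    H.toMat x (i + 1) (i + 2) = -H.conj (H.offDiag i x) := by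
  rw [toMat_conj, toMat_offDiag, map_neg]

theorem form_one_one (c : k) (h : c • H.one ≠ 0) : H.form H.one H.one = 2 := by
  have h1 := H.conj_one
  rw [conj_apply] at h1
  have h2 : (H.form H.one H.one - 2) • H.one = 0 := by
    linear_combination (norm := module) h1
  rcases smul_eq_zero.1 h2 with h | h
  · linear_combination h
  · simp [h] at *

/-- A substitute for `b(1, 1) = 2` that remains true in the zero algebra, so no nontriviality is
needed for the Jordan product formulas. -/
theorem mul_form_one_one (x : H.J) (i : Fin 3) :
    H.diag i x * H.form H.one H.one = 2 * H.diag i x := by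
  have := H.toSuper.form_one_one (H.toMat x i i)
  change H.form (H.toMat x i i) H.one * H.form H.one H.one =
    2 * H.form (H.toMat x i i) H.one at this
  rw [diag_apply]
  linear_combination -this

theorem para_mul_apply (x y : C) : H.para.mul x y = H.mul (H.conj x) (H.conj y) := rfl

theorem form_conj_mul_one (x y : C) : H.form (H.mul (H.conj x) y) H.one = H.form x y := by
  rw [form_mul_adj_left, conj_conj, mul_one, form_comm]

theorem form_mul_conj_one (x y : C) : H.form (H.mul x (H.conj y)) H.one = H.form x y := by
  rw [form_mul_adj_right, conj_conj, one_mul]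

theorem diag_jordan (x y : H.J) (i : Fin 3) : H.diag i (H.jordan x y) =
    H.diag i x * H.diag i y - H.form (H.offDiag (i + 1) x) (H.offDiag (i + 1) y) -
      H.form (H.offDiag (i + 2) x) (H.offDiag (i + 2) y) := by
  have h3 := three_eq_zero k
  obtain ⟨i1, i2, i3, i4⟩ := fin3_add_eq i
  have e1 := H.mul_form_one_one x i
  have a1 := fun x => H.toMat_offDiag x (i + 2)
  have a2 := fun x => H.toMat_offDiag' x (i + 2)
  have a3 := fun x => H.toMat_offDiag x (i + 1)
  have a4 := fun x => H.toMat_offDiag' x (i + 1)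
  simp only [i1, i2, i3, i4] at a1 a2 a3 a4
  rw [diag_apply, jordan_coe, inv_two_eq]
  simp only [Matrix.smul_apply, Matrix.add_apply, matMul_apply, fin3_sum _ i, toMat_diag, a1, a2,
    a3, a4, map_neg, LinearMap.neg_apply, neg_neg, map_add, map_smul, LinearMap.add_apply,
    LinearMap.smul_apply, smul_eq_mul, form_conj_mul_one, form_mul_conj_one, H.mul_one]
  rw [H.form_comm (H.offDiag (i + 1) y), H.form_comm (H.offDiag (i + 2) y)]
  linear_combination 2 * H.diag i y * e1 + h3 * (H.diag i x * H.diag i y +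
    H.form (H.offDiag (i + 1) x) (H.offDiag (i + 1) y) +
    H.form (H.offDiag (i + 2) x) (H.offDiag (i + 2) y))

/-- The sign in the off-diagonal coordinates cancels the factor `1/2 = -1` of the Jordan product.
The entry `(i+2, i+1)` of a matrix product passes through index `i`, where both factors are
conjugates of coordinates; this is how the para-Hurwitz product appears. -/
theorem offDiag_jordan (x y : H.J) (i : Fin 3) : H.offDiag i (H.jordan x y) =
    H.para.mul (H.offDiag (i + 1) x) (H.offDiag (i + 2) y) +
    H.para.mul (H.offDiag (i + 1) y) (H.offDiag (i + 2) x) -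
    (H.diag (i + 1) y + H.diag (i + 2) y) • H.offDiag i x -
    (H.diag (i + 1) x + H.diag (i + 2) x) • H.offDiag i y := by
  obtain ⟨i1, i2, i3, i4⟩ := fin3_add_eq i
  have a1 := fun x => H.toMat_offDiag x i
  have a2 := fun x => H.toMat_offDiag' x (i + 2)
  have a3 := fun x => H.toMat_offDiag' x (i + 1)
  simp only [i1, i2, i3, i4] at a1 a2 a3
  rw [offDiag_apply, jordan_coe, inv_two_eq]
  simp only [Matrix.smul_apply, Matrix.add_apply, matMul_apply, fin3_sum _ i, toMat_diag, a1, a2,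
    a3, map_neg, LinearMap.neg_apply, neg_neg, map_smul, LinearMap.smul_apply, H.mul_one,
    H.one_mul, para_mul_apply]
  module

theorem trace_eq_diag (x : H.J) : H.trace x = ∑ i, H.diag i x := by
  rw [trace_apply, inv_two_eq]
  simp [diag_apply]

theorem J_ext {x y : H.J} (h1 : ∀ i, H.diag i x = H.diag i y)
    (h2 : ∀ i, H.offDiag i x = H.offDiag i y) : x = y := by
  refine H.toMat_injective (Matrix.ext fun i j => ?_)
  obtain ⟨l, rfl⟩ : ∃ l, j = i + l := ⟨j - i, by abel⟩
  obtain ⟨i1, i2, i3, i4⟩ := fin3_add_eq i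
  fin_cases l
  · simp [toMat_diag, h1]
  · have a := fun x => H.toMat_offDiag' x (i + 2)
    simp only [i3, i4] at a
    simp [a, h2]
  · have a := fun x => H.toMat_offDiag x (i + 1)
    simp only [i1, i2] at a
    simp [a, h2]

end JordanCoordinates

/-- The coordinates on `J₀ / k 1` of an element of `J₀`. -/
noncomputable def coord : H.traceless →ₗ[k] k × (Fin 3 → C) :=
  ((H.diag 1 - H.diag 0).prod (LinearMap.pi H.offDiag)) ∘ₗ H.traceless.subtype

theorem coord_fst (x : H.traceless) : (H.coord x).1 = H.diag 1 x.1 - H.diag 0 x.1 := rfl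

theorem coord_snd (x : H.traceless) (i : Fin 3) : (H.coord x).2 i = H.offDiag i x.1 := rfl

/-- Three elements with sum zero form an arithmetic progression in characteristic 3. The common
difference is the first coordinate, and it does not change when a scalar matrix is added. -/
theorem diag_add_one (x : H.traceless) (i : Fin 3) :
    H.diag (i + 1) x.1 = H.diag i x.1 + (H.coord x).1 := by
  have h3 := three_eq_zero k
  have h : H.trace x.1 = 0 := x.2
  rw [trace_eq_diag, Fin.sum_univ_three] at h
  rw [coord_fst]
  fin_cases i
  · simp
  · simp; linear_combination h - h3 * H.diag 1 x.1
  · simp; linear_combination -h + h3 * H.diag 0 x.1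

theorem diag_add_two (x : H.traceless) (i : Fin 3) :
    H.diag (i + 2) x.1 = H.diag i x.1 - (H.coord x).1 := by
  have h3 := three_eq_zero k
  have h1 := H.diag_add_one x i
  have h2 := H.diag_add_one x (i + 1)
  rw [(fin3_add_eq i).1] at h2
  linear_combination h1 + h2 + h3 * (H.coord x).1

theorem form_coord (x y : H.traceless) :
    H.modelForm (H.coord x) (H.coord y) = H.trace (H.jordan x.1 y.1) := by
  have h3 := three_eq_zero k
  rw [modelForm_apply, trace_eq_diag]
  simp only [Fin.sum_univ_three, diag_jordan, coord_snd]
  have x1 := H.diag_add_one x 0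
  have x2 := H.diag_add_two x 0
  have y1 := H.diag_add_one y 0
  have y2 := H.diag_add_two y 0
  simp only [Fin.reduceAdd, zero_add] at x1 x2 y1 y2 ⊢
  rw [x1, x2, y1, y2, ← sub_eq_zero]
  ring_nf
  reduce_mod_char!

/-- Each diagonal is written as one entry plus multiples of the common difference. The chosen
entries `p`, `q`, `r` represent the scalar ambiguity and cancel; what remains follows from the
composition identities and the associativity of the form, modulo 3. -/
theorem coord_comm (x y z : H.traceless) : H.coord (H.commL₀ x y z) =
    H.modelAct (H.modelDer (H.coord x) (H.coord y)) (H.coord z) := by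
  have h3 := three_eq_zero k
  refine Prod.ext ?_ (funext fun i => ?_)
  · rw [coord_fst, commL₀_coe, commL_apply]
    simp only [modelAct_fst, modelDer_snd, Fin.sum_univ_three, map_sub, map_smul, map_add,
      diag_jordan, offDiag_jordan, coord_snd,
      LinearMap.sub_apply, LinearMap.smul_apply, smul_eq_mul]
    have x1 := H.diag_add_one x 0
    have x2 := H.diag_add_two x 0
    have y1 := H.diag_add_one y 0
    have y2 := H.diag_add_two y 0
    have z1 := H.diag_add_one z 0
    have z2 := H.diag_add_two z 0
    simp only [Fin.reduceAdd, zero_add] at x1 x2 y1 y2 z1 z2 ⊢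
    simp only [x1, x2, y1, y2, z1, z2, H.form_para_mul]
    generalize H.diag 0 x.1 = p
    generalize H.diag 0 y.1 = q
    generalize H.diag 0 z.1 = r
    generalize (H.coord x).1 = α
    generalize (H.coord y).1 = β
    generalize (H.coord z).1 = γ
    generalize H.offDiag 0 x.1 = a0
    generalize H.offDiag 0 y.1 = b0
    generalize H.offDiag 0 z.1 = c0
    generalize H.offDiag 1 x.1 = a1
    generalize H.offDiag 1 y.1 = b1
    generalize H.offDiag 1 z.1 = c1
    generalize H.offDiag 2 x.1 = a2
    generalize H.offDiag 2 y.1 = b2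
    generalize H.offDiag 2 z.1 = c2
    rw [H.form_comm b0 a0, H.form_comm b1 a1, H.form_comm b2 a2, H.form_para_mul' a2 b0 c1,
      H.form_para_mul' a0 b1 c2, H.form_para_mul'' a0 c1 b2, H.form_para_mul' b0 a1 c2]
    rw [← sub_eq_zero]
    ring_nf
    reduce_mod_char!
  · obtain ⟨i1, i2, i3, i4⟩ := fin3_add_eq i
    rw [coord_snd, commL₀_coe, commL_apply]
    simp only [modelAct_snd, modelDer_snd, modelDer_fst, sum_thetaT_apply, coord_snd, map_sub,
      map_add, map_smul, offDiag_jordan, diag_jordan, LinearMap.sub_apply, LinearMap.add_apply,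
      LinearMap.smul_apply, i1, i2, i3, i4, para_t_zero, para_t_one, para_t_two,
      H.diag_add_one _ i, H.diag_add_two _ i]
    generalize H.diag i x.1 = p
    generalize H.diag i y.1 = q
    generalize H.diag i z.1 = r
    generalize (H.coord x).1 = α
    generalize (H.coord y).1 = β
    generalize (H.coord z).1 = γ
    generalize H.offDiag i x.1 = a0
    generalize H.offDiag i y.1 = b0
    generalize H.offDiag i z.1 = c0
    generalize H.offDiag (i + 1) x.1 = a1
    generalize H.offDiag (i + 1) y.1 = b1
    generalize H.offDiag (i + 1) z.1 = c1
    generalize H.offDiag (i + 2) x.1 = a2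
    generalize H.offDiag (i + 2) y.1 = b2
    generalize H.offDiag (i + 2) z.1 = c2
    have r1 := H.para_mul_mul_right a1 c0 b1
    have r2 := H.para_mul_mul_left b2 c0 a2
    have r3 := H.para_mul_mul_right b1 a0 c1
    have r4 := H.para_mul_mul_right a1 b0 c1
    have r5 := H.para_mul_mul_left c2 b0 a2
    have r6 := H.para_mul_mul_left c2 a0 b2
    rw [H.form_comm c2] at r5 r6
    rw [H.form_comm b2] at r2
    linear_combination (norm := (match_scalars <;> ring_nf <;> reduce_mod_char!)) -r1 - r2 - r3 +
      r4 + r5 - r6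

theorem toMat_unity (i j : Fin 3) : H.toMat H.unity i j = if i = j then H.one else 0 := rfl

variable [Nontrivial C]

theorem one_ne_zero : H.one ≠ 0 := fun h => by
  obtain ⟨x, hx⟩ := exists_ne (0 : C)
  exact hx (by rw [← H.mul_one x, h, map_zero])

theorem form_one_one' : H.form H.one H.one = 2 :=
  H.form_one_one 1 (by rw [one_smul]; exact H.one_ne_zero)

theorem diag_unity (i : Fin 3) : H.diag i H.unity = 1 := by
  rw [diag_apply, toMat_unity, if_pos rfl, form_one_one']
  linear_combination -(three_eq_zero k)

omit [Nontrivial C] in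
theorem offDiag_unity (i : Fin 3) : H.offDiag i H.unity = 0 := by
  rw [offDiag_apply, toMat_unity, if_neg, neg_zero]
  revert i
  decide

/-- Common difference zero means a constant diagonal, and vanishing off-diagonal entries then leave
a scalar matrix. So the coordinates descend injectively to `J₀ / k1`. -/
theorem coord_eq_zero_iff (x : H.traceless) : H.coord x = 0 ↔ x ∈ H.scalars := by
  constructor
  · intro h
    refine Submodule.mem_span_singleton.2 ⟨H.diag 0 x.1, H.J_ext (fun i => ?_) fun i => ?_⟩
    · have h1 := H.diag_add_one x 0
      have h2 := H.diag_add_two x 0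
      rw [h] at h1 h2
      rw [map_smul, diag_unity, smul_eq_mul, _root_.mul_one]
      fin_cases i
      · rfl
      · simpa using h1.symm
      · simpa using h2.symm
    · rw [map_smul, offDiag_unity, smul_zero]
      change 0 = H.offDiag i x.1
      rw [← coord_snd, h]
      rfl
  · intro h
    obtain ⟨c, hc⟩ := H.mem_scalars h
    refine Prod.ext ?_ (funext fun i => ?_)
    · rw [coord_fst, hc]
      simp [diag_unity]
    · rw [coord_snd, hc]
      simp [offDiag_unity]

theorem coord_surjective : Function.Surjective H.coord := by
  rintro ⟨c, a⟩
  -- The diagonal `0, c, -c` has trace zero and, modulo 3, common difference `c`; the entry at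
  -- `(i+2, i+1)` is `-a i` and the transposed positions carry the conjugates.
  let X : Matrix (Fin 3) (Fin 3) C := Matrix.of
    ![![0, -H.conj (a 2), -a 1], ![-a 2, c • H.one, -H.conj (a 0)],
      ![-H.conj (a 1), -a 0, -(c • H.one)]]
  have hX : X ∈ H.hermitian := fun i j => by
    fin_cases i <;> fin_cases j <;> simp [X, conj_conj, conj_one]
  let Y : H.J := ⟨X, hX⟩
  have hY : ∀ i j, H.toMat Y i j = X i j := fun i j => rfl
  have h0 : H.trace Y = 0 := by
    rw [trace_apply, Fin.sum_univ_three, hY, hY, hY]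
    simp [X]
  refine ⟨⟨Y, h0⟩, Prod.ext ?_ (funext fun i => ?_)⟩
  · rw [coord_fst, diag_apply, diag_apply, hY, hY]
    simp [X, form_one_one']
    linear_combination -c * three_eq_zero k
  · rw [coord_snd, offDiag_apply, hY]
    fin_cases i <;> simp [X]

/-- The identification of `J₀ / k 1` with `k × C³`. -/
noncomputable def coordEquiv : (H.traceless ⧸ H.scalars) ≃ₗ[k] k × (Fin 3 → C) :=
  (Submodule.quotEquivOfEq _ _ (by ext x; rw [LinearMap.mem_ker, coord_eq_zero_iff])).trans
    (H.coord.quotKerEquivOfSurjective H.coord_surjective)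

theorem modelForm_coordEquiv (x y : H.traceless ⧸ H.scalars) :
    H.model.form (H.coordEquiv x) (H.coordEquiv y) = H.tripleSystem.form x y := by
  induction x using Submodule.Quotient.induction_on
  induction y using Submodule.Quotient.induction_on
  exact H.form_coord _ _

theorem coordEquiv_triple (x y z : H.traceless ⧸ H.scalars) :
    H.coordEquiv (H.tripleSystem.triple x y z) =
      H.model.triple (H.coordEquiv x) (H.coordEquiv y) (H.coordEquiv z) := by
  induction x using Submodule.Quotient.induction_on
  induction y using Submodule.Quotient.induction_on
  induction z using Submodule.Quotient.induction_on
  exact H.coord_comm _ _ _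

theorem modelForm_nondegenerate (x : k × (Fin 3 → C)) (h : ∀ y, H.model.form x y = 0) : x = 0 := by
  refine Prod.ext ?_ (funext fun i => H.nondegenerate.1 _ fun y => ?_)
  · have := h (1, 0)
    change H.modelForm _ _ = 0 at this
    simpa [modelForm_apply] using this
  · have := h (0, Pi.single i y)
    change H.modelForm _ _ = 0 at this
    rw [modelForm_apply, Finset.sum_eq_single i (fun j _ hj => by simp [hj]) (by simp)] at this
    have h' : H.form (x.2 i) y = 0 := by simpa using this
    exact h'

theorem tripleSystem_isOrthogonal : H.tripleSystem.IsOrthogonal :=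
  TripleSystem.IsOrthogonal.of_equiv (R := H.tripleSystem) (R' := H.model) H.model_isOrthogonal
    H.coordEquiv H.modelForm_coordEquiv H.coordEquiv_triple

theorem tripleSystem_g_iso : H.tripleSystem.g.Iso H.model.g :=
  TripleSystem.g_iso_of_equiv (R := H.tripleSystem) (R' := H.model) H.coordEquiv
    H.modelForm_coordEquiv H.coordEquiv_triple

theorem tripleSystem_g_isLie : H.tripleSystem.g.IsLie := H.tripleSystem_isOrthogonal.g_isLie

theorem model_g_isSimple : H.model.g.IsSimple :=
  H.model_isOrthogonal.g_isSimple H.modelForm_nondegenerate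

/-- Simplicity is proved on the model, where nondegeneracy of the form is immediate from that of
`b`, and then transported. -/
theorem tripleSystem_g_isSimple : H.tripleSystem.g.IsSimple :=
  H.model_g_isSimple.of_iso H.tripleSystem_g_iso

end HurwitzAlgebra

end Supersquare

namespace Supersquare

theorem Superspace.superComm_add_add {k M : Type*} [Field k] [AddCommGroup M] [Module k M]
    (X : Superspace k M) {f f' g g' : Module.End k M} (hf : f ∈ X.endPart 0) (hf' : f' ∈ X.endPart
      1)
    (hg : g ∈ X.endPart 0) (hg' : g' ∈ X.endPart 1) : X.superComm (f + f') (g + g') =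
      f * g - g * f + (f * g' - g' * f) + (f' * g - g * f' + (f' * g' + g' * f')) := by
  rw [map_add X.superComm, LinearMap.add_apply, map_add, map_add, X.superComm_of_mem hf hg,
    X.superComm_of_mem hf hg', X.superComm_of_mem hf' hg, X.superComm_of_mem hf' hg']
  simp

theorem SymmetricCompositionSuperalgebra.sigma_eq {k S : Type*} [Field k] [AddCommGroup S]
    [Module k S] (A : SymmetricCompositionSuperalgebra k S) (x y z : S) : A.sigma x y z =
    A.form x (A.proj 0 z) • (A.proj 0 y + A.proj 1 y) +
      A.form x (A.proj 1 z) • (A.proj 0 y - A.proj 1 y) -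
      ((A.form (A.proj 0 y) (A.proj 0 z) + A.form (A.proj 0 y) (A.proj 1 z) +
        A.form (A.proj 1 y) (A.proj 0 z) + A.form (A.proj 1 y) (A.proj 1 z)) • A.proj 0 x +
      (A.form (A.proj 0 y) (A.proj 0 z) - A.form (A.proj 0 y) (A.proj 1 z) -
        A.form (A.proj 1 y) (A.proj 0 z) + A.form (A.proj 1 y) (A.proj 1 z)) • A.proj 1 x) := by
  simp only [sigma, zmod2_sum, LinearMap.sub_apply, LinearMap.add_apply, LinearMap.smul_apply,
    LinearMap.compl₁₂_apply, LinearMap.flip_apply, LinearMap.smulRightₗ_apply, LinearMap.comp_apply,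
    LinearMap.lcomp_apply, mul_zero, mul_one, add_zero, zero_add, sgn_zero, sgn_one,
    show (1 + 1 : ZMod 2) = 0 from rfl, LinearMap.smulRight_apply]
  module

/-! ### The triality Lie superalgebra of `S_{1,2}`. -/

section SmallSymmetricComposition

variable (k : Type*) [Field k] [CharP k 3]

theorem s12_mem_zero {x : k × (Fin 2 → k)} : x ∈ (s12 k).part 0 ↔ x.2 = 0 := b12_mem_zero k

theorem s12_mem_one {x : k × (Fin 2 → k)} : x ∈ (s12 k).part 1 ↔ x.1 = 0 := b12_mem_one k

theorem s12_proj_zero (x : k × (Fin 2 → k)) : (s12 k).proj 0 x = (x.1, 0) := by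
  have h : x = (x.1, 0) + (0, x.2) := by simp
  have h1 : (x.1, 0) ∈ (s12 k).part 0 := (s12_mem_zero k).2 rfl
  have h2 : (0, x.2) ∈ (s12 k).part 1 := (s12_mem_one k).2 rfl
  conv_lhs => rw [h]
  rw [map_add, (s12 k).proj_self h1, (s12 k).proj_ne (by decide) h2, add_zero]

theorem s12_proj_one (x : k × (Fin 2 → k)) : (s12 k).proj 1 x = (0, x.2) := by
  have h := (s12 k).proj_add_proj x
  rw [s12_proj_zero] at h
  have h' : x = (x.1, 0) + (0, x.2) := by simp
  exact add_left_cancel (h.trans h')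

theorem s12_form (x y : k × (Fin 2 → k)) :
    (s12 k).form x y = 2 * (x.1 * y.1) + symp k x.2 y.2 := rfl

theorem s12_mul (x y : k × (Fin 2 → k)) : (s12 k).mul x y =
    (x.1 * y.1 + symp k x.2 y.2, -(x.1 • y.2 + y.1 • x.2)) := by
  have h (x : k × (Fin 2 → k)) : (b12 k).conj x = (x.1, -x.2) := by
    change (2 * (x.1 * 1) + symp k x.2 0) • ((1, 0) : k × (Fin 2 → k)) - x = _
    ext
    · simp; ring
    · simp
  change b12Mul k ((b12 k).conj x) ((b12 k).conj y) = _
  rw [h, h]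
  simp [b12Mul, add_comm]

/-- The endomorphism `1 ↦ v`, `u ↦ ⟨v | u⟩ 1 + f(u)` of `k 1 ⊕ V`. -/
noncomputable def s12End : spV k × (Fin 2 → k) →ₗ[k] Module.End k (k × (Fin 2 → k)) :=
  LinearMap.mk₂ k (fun p x => (symp k p.2 x.2, x.1 • p.2 + p.1.1 x.2))
    (fun _ _ _ => by simp; abel)
    (fun c p x => by
      refine Prod.ext ?_ ?_
      · simp
      · change x.1 • (c • p.2) + c • p.1.1 x.2 = c • (x.1 • p.2 + p.1.1 x.2)
        module)
    (fun _ _ _ => by simp [add_smul]; abel) (fun _ _ _ => by simp [smul_smul])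

theorem s12End_apply (p : spV k × (Fin 2 → k)) (x : k × (Fin 2 → k)) :
    s12End k p x = (symp k p.2 x.2, x.1 • p.2 + p.1.1 x.2) := rfl

theorem s12End_even_mem (f : spV k) : (fun _ => s12End k (f, 0)) ∈ (s12 k).triPart 0 := by
  have h0 := mem_spV.1 f.2
  refine ⟨fun n => ⟨fun j x hx => ?_, fun j x hx y => ?_⟩, fun j x hx y => ?_⟩
  · rcases zmod2_cases j with rfl | rfl
    · have := (s12_mem_zero k).1 hx
      exact (s12_mem_zero k).2 (by simp [s12End_apply, this])
    · exact (s12_mem_one k).2 (by simp [s12End_apply])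
  · simp [s12End_apply, s12_form, h0]
  · simp [s12End_apply, s12_mul, h0]

/-- Characteristic 3 enters here: because `b(1, 1) = 2` and `b(u, v) = ⟨u | v⟩`, the failure of
skewness is three times a pairing with `v`, and likewise the failure of triality. -/
theorem s12End_odd_mem (v : Fin 2 → k) : (fun _ => s12End k (0, v)) ∈ (s12 k).triPart 1 := by
  have h3 := three_eq_zero k
  refine ⟨fun n => ⟨fun j x hx => ?_, fun j x hx y => ?_⟩, fun j x hx y => ?_⟩
  · rcases zmod2_cases j with rfl | rfl
    · exact (s12_mem_one k).2 (by simp [s12End_apply, (s12_mem_zero k).1 hx])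
    · exact (s12_mem_zero k).2 (by simp [s12End_apply, (s12_mem_one k).1 hx])
  · rcases zmod2_cases j with rfl | rfl
    · simp [s12End_apply, s12_form, (s12_mem_zero k).1 hx, symp_apply]
      linear_combination x.1 * (v 0 * y.2 1 - v 1 * y.2 0) * h3
    · simp [s12End_apply, s12_form, (s12_mem_one k).1 hx, symp_apply]
      linear_combination y.1 * (v 0 * x.2 1 - v 1 * x.2 0) * h3
  · rcases zmod2_cases j with rfl | rfl
    · simp only [s12_mem_zero] at hx
      simp [s12End_apply, s12_mul, hx, symp_apply]
      refine ⟨?_, funext fun i => ?_⟩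
      · linear_combination -x.1 * (v 0 * y.2 1 - v 1 * y.2 0) * h3
      · simp
        linear_combination x.1 * y.1 * v i * h3
    · simp only [s12_mem_one] at hx
      simp [s12End_apply, s12_mul, hx, symp_apply]
      refine ⟨?_, funext fun i => ?_⟩
      · linear_combination -y.1 * (v 0 * x.2 1 - v 1 * x.2 0) * h3
      · fin_cases i <;> simp
        · ring
        · ring

/-- An even skew map sends `1` to a multiple of `1`, and skewness makes that multiple zero. Then
triality on `1 • u` and `u • 1` shows that the three components agree on `V`, where skewness means
membership in `sp(V)`. -/
theorem exists_s12End_even {d : Fin 3 → Module.End k (k × (Fin 2 → k))}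
    (hd : d ∈ (s12 k).triPart 0) : ∃ f : spV k, d = fun _ => s12End k (f, 0) := by
  have h3 := three_eq_zero k
  have h1 : ∀ n, d n (1, 0) = 0 := fun n => by
    have e := (s12_mem_zero k).1 ((hd.1 n).1 0 (1, 0) ((s12_mem_zero k).2 rfl))
    have s := (hd.1 n).2 0 (1, 0) ((s12_mem_zero k).2 rfl) (1, 0)
    simp [s12_form, e] at s
    exact Prod.ext (by simp; linear_combination s - (d n (1, 0)).1 * h3) e
  have h2 : ∀ n u, (d n (0, u)).1 = 0 := fun n u =>
    (s12_mem_one k).1 ((hd.1 n).1 1 (0, u) ((s12_mem_one k).2 rfl))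
  have h4 : ∀ u, d 1 (0, u) = d 0 (0, u) ∧ d 2 (0, u) = d 0 (0, u) := fun u => by
    have a := hd.2 0 (1, 0) ((s12_mem_zero k).2 rfl) (0, u)
    have b := hd.2 1 (0, u) ((s12_mem_one k).2 rfl) (1, 0)
    have c : ((0, -u) : k × (Fin 2 → k)) = -(0, u) := by simp
    simp [s12_mul, h1, h2] at a b
    rw [c, map_neg] at a b
    have a2 := congrArg Prod.snd a
    have b2 := congrArg Prod.snd b
    simp at a2 b2
    exact ⟨Prod.ext (by rw [h2, h2]) b2.symm, Prod.ext (by rw [h2, h2]) a2.symm⟩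
  let f : Module.End k (Fin 2 → k) := LinearMap.snd k _ _ ∘ₗ d 0 ∘ₗ LinearMap.inr k _ _
  have hf : f ∈ spV k := mem_spV.2 fun x y => by
    have s := (hd.1 0).2 1 (0, x) ((s12_mem_one k).2 rfl) (0, y)
    simpa [s12_form, f] using s
  have h5 : ∀ n u, d n (0, u) = (0, f u) := fun n u => by
    have : d 0 (0, u) = (0, f u) := Prod.ext (h2 0 u) rfl
    fin_cases n
    · exact this
    · exact (h4 u).1.trans this
    · exact (h4 u).2.trans this
  refine ⟨⟨f, hf⟩, funext fun n => LinearMap.ext fun x => ?_⟩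
  have : x = x.1 • (1, 0) + (0, x.2) := by simp
  rw [this, map_add, map_smul, h1, h5, s12End_apply]
  simp

/-- By skewness an odd component is determined by `v_n = d_n(1)`. Triality on `u • u = 0` gives `v₁
= v₂`, and triality on `1 • 1 = 1` gives `v₀ = -v₁ - v₂ = v₁` modulo 3. -/
theorem exists_s12End_odd {d : Fin 3 → Module.End k (k × (Fin 2 → k))}
    (hd : d ∈ (s12 k).triPart 1) : ∃ v : Fin 2 → k, d = fun _ => s12End k (0, v) := by
  have h3 := three_eq_zero k
  have h1 : ∀ n, (d n (1, 0)).1 = 0 := fun n =>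
    (s12_mem_one k).1 ((hd.1 n).1 0 (1, 0) ((s12_mem_zero k).2 rfl))
  have h2 : ∀ n u, d n (0, u) = (symp k (d n (1, 0)).2 u, 0) := fun n u => by
    have s := (hd.1 n).2 0 (1, 0) ((s12_mem_zero k).2 rfl) (0, u)
    simp [s12_form] at s
    exact Prod.ext (by simp; linear_combination -s + (d n (0, u)).1 * h3)
      ((s12_mem_zero k).1 ((hd.1 n).1 1 (0, u) ((s12_mem_one k).2 rfl)))
  have h5 : ∀ u, symp k (d 2 (1, 0)).2 u = symp k (d 1 (1, 0)).2 u := fun u => by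
    have a := hd.2 1 (0, u) ((s12_mem_one k).2 rfl) (0, u)
    have a2 := congrArg Prod.snd a
    have c : symp k u u = 0 := by rw [symp_apply]; ring
    simp [s12_mul, h2, c] at a2
    have a0 (i : Fin 2) : (0 : k) = -(symp k (d 1 (1, 0)).2 u * u i) +
      symp k (d 2 (1, 0)).2 u * u i := congrFun a2 i
    -- The relation is `(⟨v₂ | u⟩ - ⟨v₁ | u⟩) u = 0`; a nonzero coordinate of `u` can be cancelled,
    -- and `u = 0` is trivial.
    by_cases h0 : u 0 = 0
    · by_cases h1 : u 1 = 0
      · simp [h0, h1, symp_apply]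
      · exact mul_right_cancel₀ h1 (by linear_combination -a0 1)
    · exact mul_right_cancel₀ h0 (by linear_combination -a0 0)
  have h6 : (d 2 (1, 0)).2 = (d 1 (1, 0)).2 := by
    have a := h5 (Pi.single 0 1)
    have b := h5 (Pi.single 1 1)
    simp [symp_apply] at a b
    ext i
    fin_cases i
    · exact b
    · exact a
  have h7 : (d 0 (1, 0)).2 = (d 1 (1, 0)).2 := by
    have a := hd.2 0 (1, 0) ((s12_mem_zero k).2 rfl) (1, 0)
    simp [s12_mul] at a
    have a2 := congrArg Prod.snd a
    simp [h6] at a2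
    rw [a2]
    ext i
    simp
    linear_combination -(d 1 (1, 0)).2 i * h3
  have h8 : ∀ n, (d n (1, 0)).2 = (d 1 (1, 0)).2 := fun n => by
    fin_cases n
    · exact h7
    · rfl
    · exact h6
  refine ⟨(d 1 (1, 0)).2, funext fun n => LinearMap.ext fun x => ?_⟩
  have : x = x.1 • (1, 0) + (0, x.2) := by simp
  rw [this, map_add, map_smul, h2, h8, s12End_apply]
  have e : d n (1, 0) = (0, (d 1 (1, 0)).2) := Prod.ext (h1 n) (h8 n)
  rw [e]
  simp

/-- The triality Lie superalgebra of `S_{1,2}` is `sp(V) ⊕ V`. -/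
noncomputable def s12TriMap : spV k × (Fin 2 → k) →ₗ[k] (s12 k).tri :=
  LinearMap.codRestrict (s12 k).tri (LinearMap.pi fun _ => s12End k) fun p => by
    have h : p = (p.1, 0) + (0, p.2) := by simp
    rw [h, map_add]
    exact add_mem ((s12 k).triPart_le 0 (s12End_even_mem k p.1))
      ((s12 k).triPart_le 1 (s12End_odd_mem k p.2))

theorem s12TriMap_apply (p : spV k × (Fin 2 → k)) (n : Fin 3) :
    (s12TriMap k p).1 n = s12End k p := rfl

theorem s12End_injective : Function.Injective (s12End k) := fun p q h => by
  have h1 := congrArg (fun d => (d (1, 0)).2) h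
  have h2 := fun u => congrArg (fun d => (d (0, u)).2) h
  simp [s12End_apply] at h1 h2
  exact Prod.ext (Subtype.ext (LinearMap.ext h2)) h1

theorem s12TriMap_bijective : Function.Bijective (s12TriMap k) := by
  refine ⟨fun p q h => s12End_injective k (congrFun (congrArg Subtype.val h) 0), fun d => ?_⟩
  obtain ⟨d0, h0, d1, h1, h⟩ := Submodule.mem_sup.1 d.2
  obtain ⟨f, rfl⟩ := exists_s12End_even k h0
  obtain ⟨v, rfl⟩ := exists_s12End_odd k h1
  refine ⟨(f, v), Subtype.ext (Eq.trans (funext fun n => ?_) h)⟩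
  change s12End k (f, v) = s12End k (f, 0) + s12End k (0, v)
  rw [← map_add]
  simp

theorem s12TriMap_mem_zero (p : spV k × (Fin 2 → k)) :
    (s12TriMap k p).1 ∈ (s12 k).triPart 0 ↔ p.2 = 0 := by
  constructor
  · intro h
    obtain ⟨f, hf⟩ := exists_s12End_even k h
    have := s12End_injective k (congrFun hf 0)
    exact congrArg Prod.snd this
  · intro h
    obtain ⟨f, v⟩ := p
    subst h
    exact s12End_even_mem k f

theorem s12TriMap_mem_one (p : spV k × (Fin 2 → k)) :
    (s12TriMap k p).1 ∈ (s12 k).triPart 1 ↔ p.1 = 0 := by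
  constructor
  · intro h
    obtain ⟨f, hf⟩ := exists_s12End_odd k h
    have := s12End_injective k (congrFun hf 0)
    exact congrArg Prod.fst this
  · intro h
    obtain ⟨f, v⟩ := p
    subst h
    exact s12End_odd_mem k v

theorem s12End_comp (p : spV k × (Fin 2 → k)) :
    (s12 k).comp 0 (s12End k p) = s12End k (p.1, 0) ∧
    (s12 k).comp 1 (s12End k p) = s12End k (0, p.2) := by
  constructor <;> refine LinearMap.ext fun x => ?_
  · rw [(s12 k).comp_apply, zero_add, s12_proj_zero, s12_proj_zero, s12_proj_one, s12_proj_one]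
    simp [s12End_apply]
  · rw [(s12 k).comp_apply, show (1 + 1 : ZMod 2) = 0 from rfl, s12_proj_zero, s12_proj_zero,
      s12_proj_one, s12_proj_one]
    simp [s12End_apply]

theorem s12_triBracket (p q : spV k × (Fin 2 → k)) :
    (s12 k).triBracket (s12TriMap k p) (s12TriMap k q) =
      s12TriMap k (⁅p.1, q.1⁆ + gamma k p.2 q.2, p.1.1 q.2 - q.1.1 p.2) := by
  refine Subtype.ext (funext fun n => LinearMap.ext fun x => ?_)
  change (s12 k).superComm (s12End k p) (s12End k q) x = s12End k _ x
  have e : (⁅p.1, q.1⁆ : spV k).1 x.2 = p.1.1 (q.1.1 x.2) - q.1.1 (p.1.1 x.2) := rfl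
  have e1 := eq_neg_of_add_eq_zero_right (mem_spV.1 p.1.2 q.2 x.2)
  have e2 := eq_neg_of_add_eq_zero_right (mem_spV.1 q.1.2 p.2 x.2)
  have hp : ∀ p : spV k × (Fin 2 → k), s12End k p = s12End k (p.1, 0) + s12End k (0, p.2) :=
    fun p => by rw [← map_add]; simp
  have h0 : ∀ f, s12End k (f, 0) ∈ (s12 k).endPart 0 := fun f => ((s12End_even_mem k f).1 0).1
  have h1 : ∀ v, s12End k (0, v) ∈ (s12 k).endPart 1 := fun v => ((s12End_odd_mem k v).1 0).1
  rw [hp p, hp q, (s12 k).superComm_add_add (h0 _) (h1 _) (h0 _) (h1 _)]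
  simp only [mul_zero, LinearMap.sub_apply, LinearMap.add_apply, Module.End.mul_apply, s12End_apply,
    map_zero, LinearMap.zero_apply, ZeroMemClass.coe_zero, smul_zero, zero_add, add_zero,
    map_smul, smul_eq_mul, AddMemClass.coe_add, gamma_apply, e]
  refine Prod.ext ?_ ?_
  · simp [symp_swap k q.2 p.2, e1, e2]
    ring
  · simp
    module

/-- Triples in `tri(S_{1,2})` are constant, so `θⁿ` acts trivially and one component determines the
triple. The component of index `n` of `θⁿ(t_{x,y})` is `σ_{x,y}`, which is the easiest to compute.
-/
theorem s12_thetaT (n : Fin 3) (x y : k × (Fin 2 → k)) : (s12 k).thetaT n x y =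
    s12TriMap k (-gamma k x.2 y.2, y.1 • x.2 - x.1 • y.2) := by
  have h3 := three_eq_zero k
  have key : (s12 k).sigma x y = s12End k (-gamma k x.2 y.2, y.1 • x.2 - x.1 • y.2) := by
    refine LinearMap.ext fun z => ?_
    have e : (-gamma k x.2 y.2).1 z.2 = -(symp k x.2 z.2 • y.2 + symp k y.2 z.2 • x.2) := by
      rw [← gamma_apply]; rfl
    rw [s12End_apply, e]
    rw [SymmetricCompositionSuperalgebra.sigma_eq, s12_proj_zero, s12_proj_one, s12_proj_zero,
      s12_proj_one, s12_proj_zero, s12_proj_one]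
    simp only [s12_form]
    refine Prod.ext ?_ ?_
    · simp
      ring
    · simp
      linear_combination (norm := module) h3 • ((x.1 * z.1) • y.2 - (y.1 * z.1) • x.2)
  obtain ⟨q, hq⟩ := (s12TriMap_bijective k).2 ((s12 k).thetaT n x y)
  rw [← hq]
  congr 1
  refine s12End_injective k ?_
  rw [← key, ← s12TriMap_apply k q n, hq]
  change (s12 k).t x y (n - n) = _
  rw [sub_self]
  rfl

end SmallSymmetricComposition

end Supersquare

namespace Supersquare

attribute [local instance] LieRing.ofAssociativeRing
attribute [local instance] subalgebraAddCommGroup subalgebraAddCommMonoid subalgebraAddGroup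
  subalgebraSubNegMonoid subalgebraAddMonoid subalgebraAddZeroClass subalgebraAdd subalgebraZero
  subalgebraSub subalgebraNeg subalgebraModule subalgebraSMul
attribute [local instance 2000] Prod.instAddCommMonoid Prod.instAddCommGroup Prod.instModule

namespace HurwitzAlgebra

variable {k C : Type*} [Field k] [AddCommGroup C] [Module k C] (H : HurwitzAlgebra k C)

/-! ### The structure maps of `g(S, S')` when `S'` has zero odd part. -/

section EvenFactor

open MagicSquare

variable [NeZero (2 : k)] {S : Type*} [AddCommGroup S] [Module k S]
  (A : SymmetricCompositionSuperalgebra k S)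

theorem para_proj_zero (x : C) : H.para.proj 0 x = x :=
  H.para.proj_self (H.mem_para_part_zero x)

theorem para_proj_one (x : C) : H.para.proj 1 x = 0 :=
  H.para.proj_ne (by decide) (H.mem_para_part_zero x)

theorem para_comp_zero (f : Module.End k C) : H.para.comp 0 f = f :=
  H.para.comp_self (H.mem_para_endPart_zero f)

theorem para_comp_one (f : Module.End k C) : H.para.comp 1 f = 0 :=
  H.para.comp_ne (by decide) (H.mem_para_endPart_zero f)

theorem tensorProj_tmul (c : ZMod 2) (x : S) (a : C) :
    tensorProj A H.para c (x ⊗ₜ[k] a) = A.proj c x ⊗ₜ[k] a := by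
  rcases zmod2_cases c with rfl | rfl <;>
    simp [tensorProj, zmod2_sum, para_proj_zero, para_proj_one]

theorem actRight_tmul (f : Module.End k C) (x : S) (a : C) :
    actRight A H.para f (x ⊗ₜ[k] a) = x ⊗ₜ[k] f a := by
  simp [actRight, zmod2_sum, para_comp_zero, para_comp_one, ← TensorProduct.add_tmul,
    A.proj_add_proj]

theorem tensorMul_tmul (x y : S) (a b : C) : tensorMul A H.para (x ⊗ₜ[k] a) (y ⊗ₜ[k] b) =
    A.mul x y ⊗ₜ[k] H.para.mul a b := by
  simp [tensorMul, zmod2_sum, para_proj_zero, para_proj_one, ← TensorProduct.add_tmul,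
    ← map_add, A.proj_add_proj]

theorem tensorT_tmul (n : Fin 3) (x y : S) (a b : C) :
    tensorT A H.para n (x ⊗ₜ[k] a) (y ⊗ₜ[k] b) = H.form a b • A.thetaT n x y := by
  have h : A.thetaT n x y = A.thetaT n (A.proj 0 x) (A.proj 0 y) +
      A.thetaT n (A.proj 0 x) (A.proj 1 y) + (A.thetaT n (A.proj 1 x) (A.proj 0 y) +
      A.thetaT n (A.proj 1 x) (A.proj 1 y)) := by
    rw [← map_add, ← map_add, ← LinearMap.add_apply, ← map_add, A.proj_add_proj, A.proj_add_proj]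
  rw [h]
  simp [tensorT, zmod2_sum, para_proj_zero, para_proj_one, para_form]

theorem tensorT'_tmul (n : Fin 3) (x y : S) (a b : C) :
    tensorT' A H.para n (x ⊗ₜ[k] a) (y ⊗ₜ[k] b) = A.form x y • H.para.thetaT n a b := by
  simp [tensorT', zmod2_sum, para_proj_zero, para_proj_one, ← add_smul, ← map_add, A.proj_add_proj]

theorem superFlip_actRight_tmul (f : Module.End k C) (x : S) (a : C) :
    superFlip (tensorProj A H.para) H.para.comp (actRight A H.para) (x ⊗ₜ[k] a) f =
      x ⊗ₜ[k] f a := by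
  simp [superFlip, zmod2_sum, para_comp_zero, para_comp_one, tensorProj_tmul, actRight_tmul,
    ← TensorProduct.add_tmul, A.proj_add_proj]

theorem superFlip_actLeft_tmul (f : Module.End k S) (x : S) (a : C) :
    superFlip (tensorProj A H.para) A.comp (actLeft k S C) (x ⊗ₜ[k] a) f =
      (A.comp 0 f (A.proj 0 x) + A.comp 1 f (A.proj 0 x) + (A.comp 0 f (A.proj 1 x) -
        A.comp 1 f (A.proj 1 x))) ⊗ₜ[k] a := by
  simp [superFlip, zmod2_sum, tensorProj_tmul, actLeft, TensorProduct.add_tmul,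
    TensorProduct.neg_tmul, sub_eq_add_neg]

theorem superFlip_tensorMul_tmul (x y : S) (a b : C) :
    superFlip (tensorProj A H.para) (tensorProj A H.para) (tensorMul A H.para)
      (x ⊗ₜ[k] a) (y ⊗ₜ[k] b) = (A.mul (A.proj 0 y) (A.proj 0 x) + A.mul (A.proj 1 y) (A.proj 0 x) +
        (A.mul (A.proj 0 y) (A.proj 1 x) - A.mul (A.proj 1 y) (A.proj 1 x))) ⊗ₜ[k]
          H.para.mul b a := by
  simp [superFlip, zmod2_sum, tensorProj_tmul, tensorMul_tmul, TensorProduct.add_tmul,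
    TensorProduct.neg_tmul, sub_eq_add_neg]

end EvenFactor

end HurwitzAlgebra

/-! ### Coordinates on `(k1 ⊕ V) ⊗ C` and the structure maps of `g(S_{1,2}, S)` in them. -/

section Coordinates

variable {k C : Type*} [Field k] [AddCommGroup C] [Module k C]

/-- The even coordinate of an element of `(k 1 ⊕ V) ⊗ C`. -/
noncomputable def evenCoord : (k × (Fin 2 → k)) ⊗[k] C →ₗ[k] C :=
  (TensorProduct.lid k C).toLinearMap ∘ₗ LinearMap.rTensor C (LinearMap.fst k k (Fin 2 → k))

/-- The odd coordinates of an element of `(k 1 ⊕ V) ⊗ C`. -/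
noncomputable def oddCoord (i : Fin 2) : (k × (Fin 2 → k)) ⊗[k] C →ₗ[k] C :=
  tensorCoord i ∘ₗ LinearMap.rTensor C (LinearMap.snd k k (Fin 2 → k))

@[simp] theorem evenCoord_tmul (x : k × (Fin 2 → k)) (a : C) :
    evenCoord (x ⊗ₜ[k] a) = x.1 • a := by
  simp [evenCoord]

@[simp] theorem oddCoord_tmul (i : Fin 2) (x : k × (Fin 2 → k)) (a : C) :
    oddCoord i (x ⊗ₜ[k] a) = x.2 i • a := by
  simp [oddCoord]

theorem superTensor_eq (w : (k × (Fin 2 → k)) ⊗[k] C) : w = (1, 0) ⊗ₜ[k] evenCoord w +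
    ((0, Pi.single 0 1) ⊗ₜ[k] oddCoord 0 w + (0, Pi.single 1 1) ⊗ₜ[k] oddCoord 1 w) := by
  induction w using TensorProduct.induction_on with
  | zero => simp
  | add x y hx hy =>
    simp only [map_add, TensorProduct.tmul_add]
    nth_rewrite 1 [hx, hy]
    abel
  | tmul x a =>
    simp only [evenCoord_tmul, oddCoord_tmul, ← TensorProduct.smul_tmul, ← TensorProduct.add_tmul]
    congr 1
    refine Prod.ext (by simp) (funext fun i => ?_)
    fin_cases i <;> simp

theorem superTensor_ext {w w' : (k × (Fin 2 → k)) ⊗[k] C} (h : evenCoord w = evenCoord w')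
    (h' : ∀ i, oddCoord i w = oddCoord i w') : w = w' := by
  rw [superTensor_eq w, superTensor_eq w', h, h', h']

theorem end_eq_sum (f : Module.End k (Fin 2 → k)) (u : Fin 2 → k) (i : Fin 2) :
    f u i = f (Pi.single 0 1) i * u 0 + f (Pi.single 1 1) i * u 1 := by
  have h : u = u 0 • Pi.single 0 1 + u 1 • Pi.single 1 1 := by
    ext i
    fin_cases i <;> simp
  conv_lhs => rw [h]
  simp [mul_comm]

/-- Induction for statements about two tensors; zero is written as `0 ⊗ 0`, so it needs no separate
case. -/
theorem tensor_induction_pair {S : Type*} [AddCommGroup S] [Module k S]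
    {P : S ⊗[k] C → S ⊗[k] C → Prop}
    (h : ∀ x a y b, P (x ⊗ₜ a) (y ⊗ₜ b)) (h1 : ∀ w w' z, P w z → P w' z → P (w + w') z)
    (h2 : ∀ w z z', P w z → P w z' → P w (z + z')) (w z : S ⊗[k] C) : P w z := by
  have h0 : (0 : S ⊗[k] C) = 0 ⊗ₜ 0 := by simp
  induction w using TensorProduct.induction_on with
  | add w w' hw hw' => exact h1 _ _ _ hw hw'
  | zero =>
    rw [h0]
    induction z using TensorProduct.induction_on with
    | zero => rw [h0]; exact h _ _ _ _
    | add z z' hz hz' => exact h2 _ _ _ hz hz'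
    | tmul y b => exact h _ _ _ _
  | tmul x a =>
    induction z using TensorProduct.induction_on with
    | zero => rw [h0]; exact h _ _ _ _
    | add z z' hz hz' => exact h2 _ _ _ hz hz'
    | tmul y b => exact h _ _ _ _

theorem gamma_eq_sum (u v : Fin 2 → k) : gamma k u v =
    ∑ i, ∑ j, (u i * v j) • gamma k (Pi.single i 1) (Pi.single j 1) := by
  have h (u : Fin 2 → k) : u = u 0 • Pi.single 0 1 + u 1 • Pi.single 1 1 := by
    ext i
    fin_cases i <;> simp
  conv_lhs => rw [h u, h v]
  simp only [Fin.sum_univ_two, map_add, map_smul, LinearMap.add_apply, LinearMap.smul_apply]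
  module

variable [CharP k 3]

theorem evenCoord_actLeft (p : spV k × (Fin 2 → k)) (w : (k × (Fin 2 → k)) ⊗[k] C) :
    evenCoord (MagicSquare.actLeft k _ C (s12End k p) w) =
      p.2 0 • oddCoord 1 w - p.2 1 • oddCoord 0 w := by
  induction w using TensorProduct.induction_on with
  | zero => simp
  | add x y hx hy => simp only [map_add, hx, hy]; module
  | tmul x a =>
    simp [MagicSquare.actLeft, s12End_apply, symp_apply]
    module

theorem oddCoord_actLeft (p : spV k × (Fin 2 → k)) (w : (k × (Fin 2 → k)) ⊗[k] C) (i : Fin 2) :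
    oddCoord i (MagicSquare.actLeft k _ C (s12End k p) w) = p.2 i • evenCoord w +
      (p.1.1 (Pi.single 0 1) i • oddCoord 0 w + p.1.1 (Pi.single 1 1) i • oddCoord 1 w) := by
  induction w using TensorProduct.induction_on with
  | zero => simp
  | add x y hx hy => simp only [map_add, hx, hy]; module
  | tmul x a =>
    simp only [MagicSquare.actLeft, LinearMap.coe_rTensorHom, LinearMap.rTensor_tmul, s12End_apply,
      oddCoord_tmul, evenCoord_tmul, Pi.add_apply, end_eq_sum p.1.1 x.2]
    simp
    module

namespace HurwitzAlgebra

variable (H : HurwitzAlgebra k C)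

open MagicSquare

theorem evenCoord_actRight (f : Module.End k C) (w : (k × (Fin 2 → k)) ⊗[k] C) :
    evenCoord (actRight (s12 k) H.para f w) = f (evenCoord w) := by
  induction w using TensorProduct.induction_on with
  | zero => simp
  | add x y hx hy => simp only [map_add, hx, hy]
  | tmul x a => simp [actRight_tmul]

theorem oddCoord_actRight (f : Module.End k C) (w : (k × (Fin 2 → k)) ⊗[k] C) (i : Fin 2) :
    oddCoord i (actRight (s12 k) H.para f w) = f (oddCoord i w) := by
  induction w using TensorProduct.induction_on with
  | zero => simp
  | add x y hx hy => simp only [map_add, hx, hy]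
  | tmul x a => simp [actRight_tmul]

theorem superFlip_actRight (f : Module.End k C) (w : (k × (Fin 2 → k)) ⊗[k] C) :
    superFlip (tensorProj (s12 k) H.para) H.para.comp (actRight (s12 k) H.para) w f =
      actRight (s12 k) H.para f w := by
  induction w using TensorProduct.induction_on with
  | zero => simp
  | add x y hx hy => simp only [map_add, LinearMap.add_apply, hx, hy]
  | tmul x a => rw [superFlip_actRight_tmul, actRight_tmul]

theorem superFlip_s12End_tmul (p : spV k × (Fin 2 → k)) (x : k × (Fin 2 → k)) (a : C) :
    superFlip (tensorProj (s12 k) H.para) (s12 k).comp (actLeft k _ C) (x ⊗ₜ[k] a) (s12End k p) =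
      (-symp k p.2 x.2, x.1 • p.2 + p.1.1 x.2) ⊗ₜ[k] a := by
  rw [superFlip_actLeft_tmul, (s12End_comp k p).1, (s12End_comp k p).2, s12_proj_zero,
    s12_proj_one]
  simp [s12End_apply]

theorem evenCoord_superFlip (p : spV k × (Fin 2 → k)) (w : (k × (Fin 2 → k)) ⊗[k] C) :
    evenCoord (superFlip (tensorProj (s12 k) H.para) (s12 k).comp (actLeft k _ C) w (s12End k p)) =
      p.2 1 • oddCoord 0 w - p.2 0 • oddCoord 1 w := by
  induction w using TensorProduct.induction_on with
  | zero => simp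
  | add x y hx hy => simp only [map_add, LinearMap.add_apply, hx, hy]; module
  | tmul x a =>
    rw [superFlip_s12End_tmul]
    simp [symp_apply]
    module

theorem oddCoord_superFlip (p : spV k × (Fin 2 → k)) (w : (k × (Fin 2 → k)) ⊗[k] C) (i : Fin 2) :
    oddCoord i (superFlip (tensorProj (s12 k) H.para) (s12 k).comp (actLeft k _ C) w (s12End k p)) =
      p.2 i • evenCoord w +
      (p.1.1 (Pi.single 0 1) i • oddCoord 0 w + p.1.1 (Pi.single 1 1) i • oddCoord 1 w) := by
  induction w using TensorProduct.induction_on with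
  | zero => simp
  | add x y hx hy => simp only [map_add, LinearMap.add_apply, hx, hy]; module
  | tmul x a =>
    simp only [superFlip_s12End_tmul, oddCoord_tmul, Pi.add_apply, end_eq_sum p.1.1 x.2]
    simp
    module

theorem evenCoord_tensorMul (w z : (k × (Fin 2 → k)) ⊗[k] C) :
    evenCoord (tensorMul (s12 k) H.para w z) = H.para.mul (evenCoord w) (evenCoord z) +
      H.para.mul (oddCoord 0 w) (oddCoord 1 z) - H.para.mul (oddCoord 1 w) (oddCoord 0 z) := by
  induction w, z using tensor_induction_pair with
  | h x a y b =>
    rw [tensorMul_tmul, s12_mul]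
    simp [symp_apply]
    module
  | h1 w w' z h h' => simp only [map_add, LinearMap.add_apply, h, h']; abel
  | h2 w z z' h h' => simp only [map_add, h, h']; abel

theorem oddCoord_tensorMul (w z : (k × (Fin 2 → k)) ⊗[k] C) (i : Fin 2) :
    oddCoord i (tensorMul (s12 k) H.para w z) = -(H.para.mul (evenCoord w) (oddCoord i z) +
      H.para.mul (oddCoord i w) (evenCoord z)) := by
  induction w, z using tensor_induction_pair with
  | h x a y b =>
    rw [tensorMul_tmul, s12_mul]
    simp
    module
  | h1 w w' z h h' => simp only [map_add, LinearMap.add_apply, h, h']; abel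
  | h2 w z z' h h' => simp only [map_add, h, h']; abel

/-- The para-product of `S_{1,2}` is supercommutative, so the signed flip reverses only the two
factors in `C`. -/
theorem superFlip_s12_tensorMul_tmul (x y : k × (Fin 2 → k)) (a b : C) :
    superFlip (tensorProj (s12 k) H.para) (tensorProj (s12 k) H.para) (tensorMul (s12 k) H.para)
      (x ⊗ₜ[k] a) (y ⊗ₜ[k] b) = (x.1 * y.1 + symp k x.2 y.2, -(x.1 • y.2 + y.1 • x.2)) ⊗ₜ[k]
        H.para.mul b a := by
  rw [superFlip_tensorMul_tmul]
  simp only [s12_proj_zero, s12_proj_one, s12_mul]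
  congr 1
  refine Prod.ext ?_ ?_
  · simp [symp_swap k y.2 x.2, mul_comm]
  · simp; abel

theorem evenCoord_superFlip_tensorMul (w z : (k × (Fin 2 → k)) ⊗[k] C) :
    evenCoord (superFlip (tensorProj (s12 k) H.para) (tensorProj (s12 k) H.para)
      (tensorMul (s12 k) H.para) w z) = H.para.mul (evenCoord z) (evenCoord w) +
      H.para.mul (oddCoord 1 z) (oddCoord 0 w) - H.para.mul (oddCoord 0 z) (oddCoord 1 w) := by
  induction w, z using tensor_induction_pair with
  | h x a y b =>
    rw [superFlip_s12_tensorMul_tmul]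
    simp [symp_apply]
    module
  | h1 w w' z h h' => simp only [map_add, LinearMap.add_apply, h, h']; abel
  | h2 w z z' h h' => simp only [map_add, LinearMap.add_apply, h, h']; abel

theorem oddCoord_superFlip_tensorMul (w z : (k × (Fin 2 → k)) ⊗[k] C) (i : Fin 2) :
    oddCoord i (superFlip (tensorProj (s12 k) H.para) (tensorProj (s12 k) H.para)
      (tensorMul (s12 k) H.para) w z) = -(H.para.mul (evenCoord z) (oddCoord i w) +
      H.para.mul (oddCoord i z) (evenCoord w)) := by
  induction w, z using tensor_induction_pair with
  | h x a y b =>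
    rw [superFlip_s12_tensorMul_tmul]
    simp
    module
  | h1 w w' z h h' => simp only [map_add, LinearMap.add_apply, h, h']; abel
  | h2 w z z' h h' => simp only [map_add, LinearMap.add_apply, h, h']; abel

/-- The right-hand side does not depend on `n`, because `θ` fixes the constant triples of
`tri(S_{1,2})`. -/
theorem s12_tensorT (n : Fin 3) (w z : (k × (Fin 2 → k)) ⊗[k] C) :
    tensorT (s12 k) H.para n w z = s12TriMap k
      (-∑ i, ∑ j, H.form (oddCoord i w) (oddCoord j z) • gamma k (Pi.single i 1) (Pi.single j 1),
      fun i => H.form (oddCoord i w) (evenCoord z) - H.form (evenCoord w) (oddCoord i z)) := by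
  induction w, z using tensor_induction_pair with
  | h x a y b =>
    rw [tensorT_tmul, s12_thetaT, ← map_smul]
    congr 1
    refine Prod.ext ?_ (funext fun i => ?_)
    · simp [gamma_eq_sum x.2 y.2]
      module
    · simp
      ring
  | h1 w w' z h h' =>
    rw [map_add, LinearMap.add_apply, h, h', ← map_add]
    congr 1
    refine Prod.ext ?_ (funext fun i => ?_)
    · simp
      module
    · simp
      ring
  | h2 w z z' h h' =>
    rw [map_add, h, h', ← map_add]
    congr 1
    refine Prod.ext ?_ (funext fun i => ?_)
    · simp
      module
    · simp
      ring

/-- The coefficient `-1` of the even part is `b(1, 1) = 2`; the odd part is weighted by the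
alternating form of `V`. -/
theorem s12_tensorT' (n : Fin 3) (w z : (k × (Fin 2 → k)) ⊗[k] C) :
    tensorT' (s12 k) H.para n w z = -H.para.thetaT n (evenCoord w) (evenCoord z) +
      H.para.thetaT n (oddCoord 0 w) (oddCoord 1 z) -
      H.para.thetaT n (oddCoord 1 w) (oddCoord 0 z) := by
  have h3 := three_eq_zero k
  induction w, z using tensor_induction_pair with
  | h x a y b =>
    rw [tensorT'_tmul, s12_form]
    simp [symp_apply]
    linear_combination (norm := module) (x.1 * y.1) • h3 • H.para.thetaT n a b
  | h1 w w' z h h' => simp only [map_add, LinearMap.add_apply, h, h']; abel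
  | h2 w z z' h h' => simp only [map_add, h, h']; abel

end HurwitzAlgebra

end Coordinates

end Supersquare

namespace Supersquare

attribute [local instance] LieRing.ofAssociativeRing
attribute [local instance] subalgebraAddCommGroup subalgebraAddCommMonoid subalgebraAddGroup
  subalgebraSubNegMonoid subalgebraAddMonoid subalgebraAddZeroClass subalgebraAdd subalgebraZero
  subalgebraSub subalgebraNeg subalgebraModule subalgebraSMul
attribute [local instance 2000] Prod.instAddCommMonoid Prod.instAddCommGroup Prod.instModule

/-! ### The bracket of `g(T, s)` in coordinates on `V ⊗ T`. -/

section OddCoordinates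

variable {k T : Type*} [Field k] [AddCommGroup T] [Module k T]

theorem TripleSystem.tensorCoord_evenAct (s : LieSubalgebra k (Module.End k T)) (a : spV k × s)
    (w : (Fin 2 → k) ⊗[k] T) (i : Fin 2) : tensorCoord i (evenAct s a w) =
      a.1.1 (Pi.single 0 1) i • tensorCoord 0 w + a.1.1 (Pi.single 1 1) i • tensorCoord 1 w +
        a.2.1 (tensorCoord i w) := by
  induction w using TensorProduct.induction_on with
  | zero => simp
  | add x y hx hy => simp only [map_add, hx, hy]; module
  | tmul u x =>
    simp only [evenAct_tmul, map_add, tensorCoord_tmul, end_eq_sum a.1.1 u, map_smul]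
    module

theorem TripleSystem.oddBracket_fst (R : TripleSystem k T) (s : LieSubalgebra k (Module.End k T))
    (hs : ∀ x y, R.triple x y ∈ s) (w z : (Fin 2 → k) ⊗[k] T) : (R.oddBracket s hs w z).1 =
      -∑ i, ∑ j, R.form (tensorCoord i w) (tensorCoord j z) •
          gamma k (Pi.single i 1) (Pi.single j 1) := by
  induction w, z using tensor_induction_pair with
  | h u x v y =>
    rw [oddBracket_tmul]
    simp [gamma_eq_sum u v]
    module
  | h1 w w' z h h' =>
    rw [map_add, LinearMap.add_apply, Prod.fst_add, h, h']
    simp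
    module
  | h2 w z z' h h' =>
    rw [map_add, Prod.fst_add, h, h']
    simp
    module

theorem TripleSystem.oddBracket_snd (R : TripleSystem k T) (s : LieSubalgebra k (Module.End k T))
    (hs : ∀ x y, R.triple x y ∈ s) (w z : (Fin 2 → k) ⊗[k] T) : (R.oddBracket s hs w z).2.1 =
      R.triple (tensorCoord 0 w) (tensorCoord 1 z) -
        R.triple (tensorCoord 1 w) (tensorCoord 0 z) := by
  induction w, z using tensor_induction_pair with
  | h u x v y =>
    rw [oddBracket_tmul]
    simp [symp_apply]
    module
  | h1 w w' z h h' =>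
    rw [map_add, LinearMap.add_apply, Prod.snd_add, AddMemClass.coe_add, h, h']
    simp
    module
  | h2 w z z' h h' =>
    rw [map_add, Prod.snd_add, AddMemClass.coe_add, h, h']
    simp
    module

/-- The element of `V ⊗ T` with given coordinates. -/
noncomputable def ofTensorCoord : (Fin 2 → T) →ₗ[k] (Fin 2 → k) ⊗[k] T :=
  ∑ i : Fin 2, TensorProduct.mk k (Fin 2 → k) T (Pi.single i 1) ∘ₗ LinearMap.proj i

@[simp] theorem tensorCoord_ofTensorCoord (x : Fin 2 → T) (i : Fin 2) :
    tensorCoord i (ofTensorCoord (k := k) x) = x i := by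
  fin_cases i <;> simp [ofTensorCoord]

/-- The lift `D` of the triple product to `s` is kept as a parameter, so that for the model it can
be taken to be `modelDer` followed by the identification of `tri(C) ⊕ C³` with `s`. -/
theorem TripleSystem.superalgebra_bracket_coord (R : TripleSystem k T)
    (s : LieSubalgebra k (Module.End k T)) (hs : ∀ x y, R.triple x y ∈ s) (D : T →ₗ[k] T →ₗ[k] s)
    (hD : ∀ x y, (D x y).1 = R.triple x y) (f f' : spV k) (a a' : s) (x y : Fin 2 → T) :
    (R.superalgebra s hs).bracket ((f, a), ofTensorCoord x) ((f', a'), ofTensorCoord y) =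
    ((⁅f, f'⁆ - ∑ i, ∑ j, R.form (x i) (y j) • gamma k (Pi.single i 1) (Pi.single j 1),
      ⁅a, a'⁆ + (D (x 0) (y 1) - D (x 1) (y 0))),
      ofTensorCoord fun i => f.1 (Pi.single 0 1) i • y 0 + f.1 (Pi.single 1 1) i • y 1 +
        a.1 (y i) - (f'.1 (Pi.single 0 1) i • x 0 + f'.1 (Pi.single 1 1) i • x 1 + a'.1 (x i))) := by
  rw [superalgebra_bracket]
  refine Prod.ext (Prod.ext ?_ ?_) (tensor_ext fun i => ?_)
  · have h := R.oddBracket_fst s hs (ofTensorCoord x) (ofTensorCoord y)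
    simp only [tensorCoord_ofTensorCoord] at h
    change ⁅f, f'⁆ + _ = _
    rw [h, sub_eq_add_neg]
  · have h := R.oddBracket_snd s hs (ofTensorCoord x) (ofTensorCoord y)
    simp only [tensorCoord_ofTensorCoord] at h
    change ⁅a, a'⁆ + _ = _
    refine congrArg _ (Subtype.ext ?_)
    rw [h, AddSubgroupClass.coe_sub, hD, hD]
  · rw [map_sub, tensorCoord_evenAct, tensorCoord_evenAct]
    simp only [tensorCoord_ofTensorCoord]

end OddCoordinates

theorem MagicSquare.bracket_apply {k S S' : Type*} [Field k] [AddCommGroup S] [Module k S]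
    [AddCommGroup S'] [Module k S'] (A : SymmetricCompositionSuperalgebra k S)
    (A' : SymmetricCompositionSuperalgebra k S') [NeZero (2 : k)]
    (X Y : A.tri × A'.tri × (Fin 3 → S ⊗[k] S')) : bracket A A' X Y =
      (A.triBracket X.1 Y.1 + ∑ n, tensorT A A' n (X.2.2 n) (Y.2.2 n),
        A'.triBracket X.2.1 Y.2.1 + ∑ n, tensorT' A A' n (X.2.2 n) (Y.2.2 n),
        fun n =>
          actLeft k S S' (X.1.1 n) (Y.2.2 n) + actRight A A' (X.2.1.1 n) (Y.2.2 n)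
          - superFlip (tensorProj A A') A.comp (actLeft k S S') (X.2.2 n) (Y.1.1 n)
          - superFlip (tensorProj A A') A'.comp (actRight A A') (X.2.2 n) (Y.2.1.1 n)
          + tensorMul A A' (X.2.2 (n + 1)) (Y.2.2 (n + 2))
          - superFlip (tensorProj A A') (tensorProj A A') (tensorMul A A')
              (X.2.2 (n + 2)) (Y.2.2 (n + 1))) := by
  rw [bracket, LinearMap.mk₂_apply]

/-! ### The isomorphism of `g(S_{1,2}, S)` with `(sp(V) ⊕ tri(C) ⊕ C³) ⊕ V ⊗ (k × C³)`. -/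

namespace HurwitzAlgebra

open MagicSquare

variable {k C : Type*} [Field k] [AddCommGroup C] [Module k C] (H : HurwitzAlgebra k C)
  [CharP k 3]

/-- The action on `(1, 0)` gives `-c`; once `c = 0`, the action on the copy of `C` with index `i`
gives the component `d i`. -/
theorem modelAct_injective : Function.Injective H.modelAct := by
  refine (injective_iff_map_eq_zero _).2 fun p h => ?_
  have h1 : p.2 = 0 := funext fun i => by
    have := congrArg (fun f => (f (1, 0)).2 i) h
    simpa [modelAct_snd] using this
  refine Prod.ext (Subtype.ext (funext fun i => LinearMap.ext fun x => ?_)) h1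
  have := congrArg (fun f => (f (0, Pi.single i x)).2 i) h
  simpa [modelAct_snd, h1] using this

/-- The Lie algebra `tri(C) ⊕ C³` of endomorphisms of `k × C³`. -/
@[irreducible] noncomputable def modelLie : LieSubalgebra k (Module.End k (k × (Fin 3 → C))) :=
  { LinearMap.range H.modelAct with
    lie_mem' := by
      rintro _ _ ⟨p, rfl⟩ ⟨q, rfl⟩
      exact ⟨_, H.modelAct_bracket p q⟩ }

theorem mem_modelLie {f : Module.End k (k × (Fin 3 → C))} :
    f ∈ H.modelLie ↔ ∃ p, H.modelAct p = f := by
  unfold modelLie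
  exact Iff.rfl

theorem modelAct_mem (p : H.para.tri × (Fin 3 → C)) : H.modelAct p ∈ H.modelLie :=
  H.mem_modelLie.2 ⟨p, rfl⟩

theorem model_triple_mem (x y : k × (Fin 3 → C)) : H.model.triple x y ∈ H.modelLie :=
  H.modelAct_mem _

/-- The representation property of `modelAct` and the equivariance of `modelDer` together say that
`s` acts by derivations of the triple product; invariance of the form supplies skewness. -/
theorem modelLie_le : H.modelLie ≤ H.model.derivations := by
  intro f hf
  obtain ⟨p, rfl⟩ := H.mem_modelLie.1 hf
  refine ⟨H.modelForm_act p, fun x y z => ?_⟩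
  simp only [model_triple]
  have h := H.modelAct_bracket p (H.modelDer x y)
  rw [modelBracket_der] at h
  have h' := congrArg (fun f => f z) h
  change _ = H.modelAct p (H.modelAct (H.modelDer x y) z) -
    H.modelAct (H.modelDer x y) (H.modelAct p z) at h'
  rw [eq_sub_iff_add_eq] at h'
  rw [← h', map_add, LinearMap.add_apply]

/-- The identification of `tri(C) ⊕ C³` with a Lie algebra of endomorphisms of `k × C³`. -/
noncomputable def modelLieMap : H.para.tri × (Fin 3 → C) →ₗ[k] H.modelLie :=
  { toFun := fun p => ⟨H.modelAct p, H.modelAct_mem p⟩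
    map_add' := fun _ _ => Subtype.ext (map_add _ _ _)
    map_smul' := fun _ _ => Subtype.ext (map_smul _ _ _) }

theorem modelLieMap_coe (p : H.para.tri × (Fin 3 → C)) : (H.modelLieMap p).1 = H.modelAct p := rfl

/-- The superalgebra `(sp(V) ⊕ s) ⊕ (V ⊗ T)` of the model, for `s = tri(C) ⊕ C³`. -/
noncomputable def modelSuper :
    Superalgebra k ((spV k × H.modelLie) × (Fin 2 → k) ⊗[k] (k × (Fin 3 → C))) :=
  H.model.superalgebra H.modelLie H.model_triple_mem

theorem modelSuper_isLie : H.modelSuper.IsLie :=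
  H.model_isOrthogonal.superalgebra_isLie _ _ H.modelLie_le

/-- The identification of `g(S_{1,2}, S)` with `(sp(V) ⊕ s) ⊕ (V ⊗ T)`. -/
noncomputable def toModel : (s12 k).tri × H.para.tri × (Fin 3 → (k × (Fin 2 → k)) ⊗[k] C) →ₗ[k]
    (spV k × H.modelLie) × (Fin 2 → k) ⊗[k] (k × (Fin 3 → C)) :=
  let e := (LinearEquiv.ofBijective _ (s12TriMap_bijective k)).symm.toLinearMap
  ((LinearMap.fst k _ _ ∘ₗ e ∘ₗ LinearMap.fst k _ _).prod
    (H.modelLieMap ∘ₗ LinearMap.prodMap LinearMap.id (-LinearMap.compLeft evenCoord (Fin 3)) ∘ₗ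
      LinearMap.snd k _ _)).prod
  (ofTensorCoord ∘ₗ LinearMap.pi fun i =>
    (-LinearMap.proj i ∘ₗ LinearMap.snd k _ _ ∘ₗ e ∘ₗ LinearMap.fst k _ _).prod
      (LinearMap.compLeft (oddCoord i) (Fin 3) ∘ₗ LinearMap.snd k _ _ ∘ₗ LinearMap.snd k _ _))

/-- `V` inside `tri(S_{1,2})` becomes `V ⊗ k`, the three copies of `1 ⊗ C` become `C³` in `s`, and
those of `V ⊗ C` become `V ⊗ C³`. The sign on `1 ⊗ C` is needed because `modelBracket` has the
opposite sign in front of the product; the sign on `V` then matches the action of `C³` on `V ⊗ k`.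
-/
theorem toModel_apply (p : spV k × (Fin 2 → k)) (d : H.para.tri)
    (w : Fin 3 → (k × (Fin 2 → k)) ⊗[k] C) : H.toModel (s12TriMap k p, d, w) =
      ((p.1, H.modelLieMap (d, fun n => -evenCoord (w n))),
        ofTensorCoord fun i => (-p.2 i, fun n => oddCoord i (w n))) := by
  have h : (LinearEquiv.ofBijective _ (s12TriMap_bijective k)).symm (s12TriMap k p) = p :=
    LinearEquiv.ofBijective_symm_apply_apply _ _
  refine Prod.ext (Prod.ext ?_ ?_) ?_
  · change ((LinearEquiv.ofBijective _ (s12TriMap_bijective k)).symm (s12TriMap k p)).1 = p.1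
    rw [h]
  · rfl
  · change ofTensorCoord (fun i => (-((LinearEquiv.ofBijective _
      (s12TriMap_bijective k)).symm (s12TriMap k p)).2 i, fun n => oddCoord i (w n))) = _
    rw [h]

theorem toModel_bijective : Function.Bijective H.toModel := by
  constructor
  · refine (injective_iff_map_eq_zero _).2 ?_
    rintro ⟨t, d, w⟩ h
    obtain ⟨p, rfl⟩ := (s12TriMap_bijective k).2 t
    rw [toModel_apply] at h
    have h1 := congrArg (fun X => X.1.1) h
    have h2 := H.modelAct_injective (a₁ := (d, fun n => -evenCoord (w n))) (a₂ := 0)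
      ((congrArg (fun X => X.1.2.1) h).trans (map_zero _).symm)
    have h3 := fun i => (tensorCoord_ofTensorCoord (k := k) _ i).symm.trans
      ((congrArg (fun X => tensorCoord i X.2) h).trans (map_zero (tensorCoord i)))
    have hp : p = 0 := Prod.ext h1 (funext fun i => neg_eq_zero.1 (congrArg Prod.fst (h3 i)))
    have hd : d = 0 := congrArg Prod.fst h2
    have hw : w = 0 := funext fun n => superTensor_ext
      (by simpa using congrFun (congrArg Prod.snd h2) n)
      (fun i => by simpa using congrFun (congrArg Prod.snd (h3 i)) n)
    rw [hp, hd, hw, map_zero]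
    rfl
  · rintro ⟨⟨f, ⟨g, hg⟩⟩, Z⟩
    obtain ⟨⟨d, c⟩, rfl⟩ := H.mem_modelLie.1 hg
    refine ⟨(s12TriMap k (f, fun i => -(tensorCoord i Z).1), d, fun n => (1, 0) ⊗ₜ[k] (-c n) +
      ((0, Pi.single 0 1) ⊗ₜ[k] (tensorCoord 0 Z).2 n +
        (0, Pi.single 1 1) ⊗ₜ[k] (tensorCoord 1 Z).2 n)), ?_⟩
    rw [toModel_apply]
    refine Prod.ext (Prod.ext rfl (Subtype.ext ?_)) (tensor_ext fun i => ?_)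
    · simp
      rfl
    · rw [tensorCoord_ofTensorCoord]
      refine Prod.ext (by simp) (funext fun n => ?_)
      fin_cases i <;> simp

theorem mem_tensorPart_zero (w : (k × (Fin 2 → k)) ⊗[k] C) :
    w ∈ tensorPart (s12 k) H.para 0 ↔ ∀ i, oddCoord i w = 0 := by
  constructor
  · intro h i
    have : tensorPart (s12 k) H.para 0 ≤ LinearMap.ker (oddCoord i) := by
      refine iSup_le fun a => Submodule.map₂_le.2 fun x hx c hc => ?_
      rcases zmod2_cases a with rfl | rfl
      · simp [(s12_mem_zero k).1 hx]
      · have := H.para_proj_one c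
        rw [H.para.proj_self (i := 1) hc] at this
        simp [this]
    exact this h
  · intro h
    rw [superTensor_eq w, h, h, TensorProduct.tmul_zero, TensorProduct.tmul_zero, add_zero,
      add_zero]
    exact Submodule.mem_iSup_of_mem 0 (Submodule.apply_mem_map₂ _ ((s12_mem_zero k).2 rfl)
      (by rw [sub_zero]; exact H.mem_para_part_zero _))

theorem mem_tensorPart_one (w : (k × (Fin 2 → k)) ⊗[k] C) :
    w ∈ tensorPart (s12 k) H.para 1 ↔ evenCoord w = 0 := by
  constructor
  · intro h
    have : tensorPart (s12 k) H.para 1 ≤ LinearMap.ker evenCoord := by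
      refine iSup_le fun a => Submodule.map₂_le.2 fun x hx c hc => ?_
      rcases zmod2_cases a with rfl | rfl
      · have := H.para_proj_one c
        rw [H.para.proj_self (i := 1) hc] at this
        simp [this]
      · simp [(s12_mem_one k).1 hx]
    exact this h
  · intro h
    rw [superTensor_eq w, h, TensorProduct.tmul_zero, zero_add]
    exact Submodule.mem_iSup_of_mem 1 (add_mem
      (Submodule.apply_mem_map₂ _ ((s12_mem_one k).2 rfl)
        (by rw [sub_self]; exact H.mem_para_part_zero _))
      (Submodule.apply_mem_map₂ _ ((s12_mem_one k).2 rfl)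
        (by rw [sub_self]; exact H.mem_para_part_zero _)))

theorem toModel_mem_part (i : ZMod 2) (X : MagicSpace (s12 k) H.para) :
    H.toModel X ∈ H.modelSuper.part i ↔ X ∈ (magic (s12 k) H.para).part i := by
  obtain ⟨t, d, w⟩ := X
  obtain ⟨p, rfl⟩ := (s12TriMap_bijective k).2 t
  rw [toModel_apply]
  have hA : ∀ i, ((s12TriMap k p, d, w) : MagicSpace (s12 k) H.para) ∈
      (magic (s12 k) H.para).part i ↔ (s12TriMap k p).1 ∈ (s12 k).triPart i ∧
        d.1 ∈ H.para.triPart i ∧ ∀ n, w n ∈ tensorPart (s12 k) H.para i := fun i =>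
    ⟨fun h => ⟨h.1, h.2.1, fun n => h.2.2 n trivial⟩, fun h => ⟨h.1, h.2.1, fun n _ => h.2.2 n⟩⟩
  refine Iff.trans ?_ (hA i).symm
  rcases zmod2_cases i with rfl | rfl
  · have hB : ∀ a Z, (a, Z) ∈ H.modelSuper.part 0 ↔ Z = 0 := fun a Z => by
      simp [modelSuper, TripleSystem.superalgebra, Submodule.mem_prod]
    rw [hB, s12TriMap_mem_zero]
    constructor
    · intro h
      have h3 := fun i => (tensorCoord_ofTensorCoord (k := k) _ i).symm.trans
        ((congrArg (tensorCoord i) h).trans (map_zero (tensorCoord i)))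
      exact ⟨funext fun i => neg_eq_zero.1 (congrArg Prod.fst (h3 i)), H.para_tri_eq.le d.2,
        fun n => (H.mem_tensorPart_zero _).2 fun i => congrFun (congrArg Prod.snd (h3 i)) n⟩
    · rintro ⟨h1, -, h2⟩
      refine tensor_ext fun i => ?_
      rw [tensorCoord_ofTensorCoord, map_zero]
      refine Prod.ext (by simp [h1]) (funext fun n => (H.mem_tensorPart_zero _).1 (h2 n) i)
  · have hB : ∀ a Z, (a, Z) ∈ H.modelSuper.part 1 ↔ a = 0 := fun a Z => by
      simp [modelSuper, TripleSystem.superalgebra, Submodule.mem_prod]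
    rw [hB, s12TriMap_mem_one]
    constructor
    · intro h
      have h2 := H.modelAct_injective (a₁ := (d, fun n => -evenCoord (w n))) (a₂ := 0)
        ((congrArg (fun X => X.2.1) h).trans (map_zero _).symm)
      have hd : d = 0 := congrArg Prod.fst h2
      refine ⟨congrArg Prod.fst h, hd ▸ zero_mem _, fun n => (H.mem_tensorPart_one _).2 ?_⟩
      simpa using congrFun (congrArg Prod.snd h2) n
    · rintro ⟨h1, h2, h3⟩
      have hd : d = 0 := Subtype.ext (funext fun n => H.para_endPart_one (h2.1 n).1)
      refine Prod.ext h1 (Subtype.ext ?_)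
      have hw : (fun n => -evenCoord (w n)) = 0 := funext fun n => by
        simp [(H.mem_tensorPart_one _).1 (h3 n)]
      change H.modelAct (d, fun n => -evenCoord (w n)) = 0
      rw [hd, hw]
      exact map_zero _

theorem magic_bracket_apply (p p' : spV k × (Fin 2 → k)) (d d' : H.para.tri)
    (w w' : Fin 3 → (k × (Fin 2 → k)) ⊗[k] C) :
    MagicSquare.bracket (s12 k) H.para (s12TriMap k p, d, w) (s12TriMap k p', d', w') =
      (s12TriMap k ((⁅p.1, p'.1⁆ + gamma k p.2 p'.2, p.1.1 p'.2 - p'.1.1 p.2) +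
          ∑ n, (-∑ i, ∑ j, H.form (oddCoord i (w n)) (oddCoord j (w' n)) •
            gamma k (Pi.single i 1) (Pi.single j 1), fun i =>
            H.form (oddCoord i (w n)) (evenCoord (w' n)) -
              H.form (evenCoord (w n)) (oddCoord i (w' n)))),
        H.para.triBracket d d' + ∑ n, tensorT' (s12 k) H.para n (w n) (w' n),
        fun n =>
          actLeft k _ C (s12End k p) (w' n) + actRight (s12 k) H.para (d.1 n) (w' n)
          - superFlip (tensorProj (s12 k) H.para) (s12 k).comp (actLeft k _ C) (w n) (s12End k p')
          - actRight (s12 k) H.para (d'.1 n) (w n)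
          + tensorMul (s12 k) H.para (w (n + 1)) (w' (n + 2))
          - superFlip (tensorProj (s12 k) H.para) (tensorProj (s12 k) H.para)
              (tensorMul (s12 k) H.para) (w (n + 2)) (w' (n + 1))) := by
  rw [bracket_apply, s12_triBracket, map_add, map_sum]
  simp only [s12_tensorT, superFlip_actRight, s12TriMap_apply]

theorem modelLieMap_lie (a a' : H.para.tri × (Fin 3 → C)) :
    ⁅H.modelLieMap a, H.modelLieMap a'⁆ = H.modelLieMap (H.modelBracket a a') :=
  Subtype.ext (H.modelAct_bracket a a').symm

theorem modelSuper_bracket (f f' : spV k) (a a' : H.para.tri × (Fin 3 → C))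
    (x y : Fin 2 → k × (Fin 3 → C)) :
    H.modelSuper.bracket ((f, H.modelLieMap a), ofTensorCoord x)
      ((f', H.modelLieMap a'), ofTensorCoord y) =
    ((⁅f, f'⁆ - ∑ i, ∑ j, H.modelForm (x i) (y j) • gamma k (Pi.single i 1) (Pi.single j 1),
      H.modelLieMap (H.modelBracket a a' + (H.modelDer (x 0) (y 1) - H.modelDer (x 1) (y 0)))),
      ofTensorCoord fun i => f.1 (Pi.single 0 1) i • y 0 + f.1 (Pi.single 1 1) i • y 1 +
        H.modelAct a (y i) - (f'.1 (Pi.single 0 1) i • x 0 + f'.1 (Pi.single 1 1) i • x 1 +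
        H.modelAct a' (x i))) := by
  have h := H.model.superalgebra_bracket_coord H.modelLie H.model_triple_mem
    (H.modelDer.compr₂ H.modelLieMap) (fun _ _ => rfl) f f' (H.modelLieMap a) (H.modelLieMap a') x y
  simp only [modelLieMap_lie, LinearMap.compr₂_apply, modelLieMap_coe, ← map_sub, ← map_add] at h
  exact h

/-- The tensors of the bracket in `g(S_{1,2}, S)` are replaced by their coordinates, given as
hypotheses. What is left are linear rearrangements in `sp(V)`, `tri(C)`, `C` and `k`. -/
theorem toModel_bracket_aux {p p' q : spV k × (Fin 2 → k)} {d d' D : H.para.tri}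
    {w w' W : Fin 3 → (k × (Fin 2 → k)) ⊗[k] C}
    (h1 : q.1 = ⁅p.1, p'.1⁆ + gamma k p.2 p'.2 - ∑ n, ∑ i, ∑ j,
      H.form (oddCoord i (w n)) (oddCoord j (w' n)) • gamma k (Pi.single i 1) (Pi.single j 1))
    (h2 : ∀ i, q.2 i = p.1.1 p'.2 i - p'.1.1 p.2 i + ∑ n,
      (H.form (oddCoord i (w n)) (evenCoord (w' n)) - H.form (evenCoord (w n)) (oddCoord i (w' n))))
    (hD : D = H.para.triBracket d d' + ∑ n, (-H.para.thetaT n (evenCoord (w n)) (evenCoord (w' n)) +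
      H.para.thetaT n (oddCoord 0 (w n)) (oddCoord 1 (w' n)) -
      H.para.thetaT n (oddCoord 1 (w n)) (oddCoord 0 (w' n))))
    (he : ∀ n, evenCoord (W n) = p.2 0 • oddCoord 1 (w' n) - p.2 1 • oddCoord 0 (w' n) +
      d.1 n (evenCoord (w' n)) - (p'.2 1 • oddCoord 0 (w n) - p'.2 0 • oddCoord 1 (w n)) -
      d'.1 n (evenCoord (w n)) +
      (H.para.mul (evenCoord (w (n + 1))) (evenCoord (w' (n + 2))) +
        H.para.mul (oddCoord 0 (w (n + 1))) (oddCoord 1 (w' (n + 2))) -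
        H.para.mul (oddCoord 1 (w (n + 1))) (oddCoord 0 (w' (n + 2)))) -
      (H.para.mul (evenCoord (w' (n + 1))) (evenCoord (w (n + 2))) +
        H.para.mul (oddCoord 1 (w' (n + 1))) (oddCoord 0 (w (n + 2))) -
        H.para.mul (oddCoord 0 (w' (n + 1))) (oddCoord 1 (w (n + 2)))))
    (ho : ∀ n i, oddCoord i (W n) = p.2 i • evenCoord (w' n) +
      (p.1.1 (Pi.single 0 1) i • oddCoord 0 (w' n) + p.1.1 (Pi.single 1 1) i • oddCoord 1 (w' n)) +
      d.1 n (oddCoord i (w' n)) - (p'.2 i • evenCoord (w n) +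
      (p'.1.1 (Pi.single 0 1) i • oddCoord 0 (w n) + p'.1.1 (Pi.single 1 1) i • oddCoord 1 (w n))) -
      d'.1 n (oddCoord i (w n)) -
      (H.para.mul (evenCoord (w (n + 1))) (oddCoord i (w' (n + 2))) +
        H.para.mul (oddCoord i (w (n + 1))) (evenCoord (w' (n + 2)))) +
      (H.para.mul (evenCoord (w' (n + 1))) (oddCoord i (w (n + 2))) +
        H.para.mul (oddCoord i (w' (n + 1))) (evenCoord (w (n + 2))))) :
    H.toModel (s12TriMap k q, D, W) = H.modelSuper.bracket (H.toModel (s12TriMap k p, d, w))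
      (H.toModel (s12TriMap k p', d', w')) := by
  rw [toModel_apply, toModel_apply, toModel_apply, modelSuper_bracket]
  refine Prod.ext (Prod.ext ?_ (congrArg (fun z => H.modelLieMap z)
    (Prod.ext ?_ (funext fun n => ?_))))
    (congrArg (fun z => ofTensorCoord z) (funext fun i => Prod.ext ?_ (funext fun n => ?_)))
  · simp only [h1, gamma_eq_sum p.2 p'.2]
    rw [add_sub_assoc, sub_eq_add_neg ⁅p.1, p'.1⁆]
    refine congrArg₂ _ rfl ?_
    simp only [modelForm_apply, Fin.sum_univ_two, Fin.sum_univ_three]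
    module
  · simp only [modelBracket, Prod.fst_add, Prod.fst_sub, modelDer_fst, hD, Fin.sum_univ_three,
      map_neg, LinearMap.neg_apply]
    abel
  · simp only [modelBracket, Prod.snd_add, Prod.snd_sub, modelDer_snd, Pi.add_apply,
      Pi.sub_apply, map_neg, LinearMap.neg_apply, he]
    module
  · simp only [h2, Prod.fst_add, Prod.fst_sub, Prod.smul_fst, modelAct_fst,
      Fin.sum_univ_three, map_neg, LinearMap.neg_apply, end_eq_sum p.1.1 p'.2,
      end_eq_sum p'.1.1 p.2, smul_eq_mul, H.form_comm (evenCoord (w' _))]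
    ring
  · simp only [Prod.snd_add, Prod.snd_sub, Prod.smul_snd, Pi.add_apply, Pi.sub_apply,
      Pi.smul_apply, modelAct_snd, map_neg, LinearMap.neg_apply, ho]
    module

theorem toModel_bracket (X Y : (s12 k).tri × H.para.tri × (Fin 3 → (k × (Fin 2 → k)) ⊗[k] C)) :
    H.toModel (MagicSquare.bracket (s12 k) H.para X Y) =
      H.modelSuper.bracket (H.toModel X) (H.toModel Y) := by
  obtain ⟨t, d, w⟩ := X
  obtain ⟨t', d', w'⟩ := Y
  obtain ⟨p, rfl⟩ := (s12TriMap_bijective k).2 t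
  obtain ⟨p', rfl⟩ := (s12TriMap_bijective k).2 t'
  rw [magic_bracket_apply]
  refine H.toModel_bracket_aux ?_ (fun i => ?_) ?_ (fun n => ?_) (fun n i => ?_)
  · simp only [Prod.fst_add, Prod.fst_sum, Finset.sum_neg_distrib, sub_eq_add_neg]
  · simp only [Prod.snd_add, Prod.snd_sum, Pi.add_apply, Pi.sub_apply, Finset.sum_apply]
  · simp only [s12_tensorT']
  · simp only [map_add, map_sub, evenCoord_actLeft, evenCoord_actRight, evenCoord_superFlip,
      evenCoord_tensorMul, evenCoord_superFlip_tensorMul]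
  · simp only [map_add, map_sub, oddCoord_actLeft, oddCoord_actRight, oddCoord_superFlip,
      oddCoord_tensorMul, oddCoord_superFlip_tensorMul]
    abel

theorem magic_iso_model : (magic (s12 k) H.para).Iso H.modelSuper :=
  ⟨LinearEquiv.ofBijective H.toModel H.toModel_bijective, H.toModel_mem_part, H.toModel_bracket⟩

/-- The super Jacobi identity is inherited from the triple system side and never checked on
`g(S_{1,2}, S)` itself. -/
theorem magic_isLie : (magic (s12 k) H.para).IsLie :=
  H.modelSuper_isLie.of_iso H.magic_iso_model

end HurwitzAlgebra

end Supersquare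

namespace Supersquare

attribute [local instance] LieRing.ofAssociativeRing
attribute [local instance] subalgebraAddCommGroup subalgebraAddCommMonoid subalgebraAddGroup
  subalgebraSubNegMonoid subalgebraAddMonoid subalgebraAddZeroClass subalgebraAdd subalgebraZero
  subalgebraSub subalgebraNeg subalgebraModule subalgebraSMul
attribute [local instance 2000] Prod.instAddCommMonoid Prod.instAddCommGroup Prod.instModule

/-! ### Comparison of `g(T)` with the derived algebra of `g(T, s)`. -/

namespace TripleSystem

variable {k T : Type*} [Field k] [AddCommGroup T] [Module k T] {R : TripleSystem k T}
  {s : LieSubalgebra k (Module.End k T)} {hs : ∀ x y, R.triple x y ∈ s}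

theorem inder_le_of_triple_mem (hs : ∀ x y, R.triple x y ∈ s) : R.inder ≤ s := by
  refine LieSubalgebra.lieSpan_le.2 ?_
  rintro _ ⟨x, y, rfl⟩
  exact hs x y

theorem superalgebra_iso_g (h : s = R.inder) : (R.superalgebra s hs).Iso R.g := by
  subst h
  exact Superalgebra.Iso.refl _

theorem oddBracket_snd_mem (w z : (Fin 2 → k) ⊗[k] T) : (R.oddBracket s hs w z).2.1 ∈ R.inder := by
  rw [oddBracket_snd]
  exact sub_mem (R.triple_mem_inder _ _) (R.triple_mem_inder _ _)

/-- The inclusion of `g(T)` in `g(T, s)`. -/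
noncomputable def superInclusion (hs : ∀ x y, R.triple x y ∈ s) :
    (spV k × R.inder) × (Fin 2 → k) ⊗[k] T →ₗ[k] (spV k × s) × (Fin 2 → k) ⊗[k] T :=
  LinearMap.prodMap (LinearMap.prodMap LinearMap.id
    (Submodule.inclusion (p := R.inder.toSubmodule) (p' := s.toSubmodule)
      (inder_le_of_triple_mem hs))) LinearMap.id

theorem superInclusion_apply (X : (spV k × R.inder) × (Fin 2 → k) ⊗[k] T) :
    superInclusion hs X = ((X.1.1, ⟨X.1.2.1, inder_le_of_triple_mem hs X.1.2.2⟩), X.2) := rfl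

theorem superInclusion_injective : Function.Injective (superInclusion hs) := by
  intro X Y h
  rw [superInclusion_apply, superInclusion_apply] at h
  refine Prod.ext (Prod.ext (congrArg (fun Z => Z.1.1) h) (Subtype.ext
    (congrArg (fun Z => Z.1.2.1) h))) (congrArg (fun Z => Z.2) h)

theorem superInclusion_bracket (X Y : (spV k × R.inder) × (Fin 2 → k) ⊗[k] T) :
    superInclusion hs (R.g.bracket X Y) =
      (R.superalgebra s hs).bracket (superInclusion hs X) (superInclusion hs Y) := by
  rw [g_bracket, superalgebra_bracket]
  refine Prod.ext (Prod.ext ?_ (Subtype.ext ?_)) rfl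
  · change ⁅X.1.1, Y.1.1⁆ + _ = ⁅X.1.1, Y.1.1⁆ + _
    rw [oddBracket_fst, superInclusion_apply, superInclusion_apply, oddBracket_fst]
  · change ⁅X.1.2.1, Y.1.2.1⁆ + _ = ⁅X.1.2.1, Y.1.2.1⁆ + _
    rw [oddBracket_snd, superInclusion_apply, superInclusion_apply, oddBracket_snd]

/-- `g(T)` is simple, hence equal to its own derived algebra, and so lies in the derived algebra of
`g(T, s)`. Conversely the `s` component of a bracket is inner: odd pairs produce inner derivations,
and `[s, s]` does by hypothesis. -/
theorem range_superInclusion (hR : R.IsOrthogonal) [NeZero (2 : k)] (hg : R.g.IsSimple)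
    (h : ∀ x ∈ s, ∀ y ∈ s, ⁅x, y⁆ ∈ R.inder) :
    LinearMap.range (superInclusion hs) = (R.superalgebra s hs).derivedSpace := by
  refine le_antisymm ?_ ?_
  · have hL := hR.g_isLie
    rw [LinearMap.range_eq_map, ← Superalgebra.derivedSpace_eq_top hg hL.bracket_mem
      hL.isCompl.sup_eq_top, Superalgebra.derivedSpace, Submodule.map_span, Submodule.span_le]
    rintro _ ⟨_, ⟨x, y, rfl⟩, rfl⟩
    rw [superInclusion_bracket]
    exact Submodule.subset_span ⟨_, _, rfl⟩
  · rw [Superalgebra.derivedSpace, Submodule.span_le]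
    rintro _ ⟨X, Y, rfl⟩
    have hm : ((R.superalgebra s hs).bracket X Y).1.2.1 ∈ R.inder := by
      rw [superalgebra_bracket]
      exact add_mem (h _ X.1.2.2 _ Y.1.2.2) (oddBracket_snd_mem _ _)
    exact ⟨((((R.superalgebra s hs).bracket X Y).1.1, ⟨_, hm⟩),
      ((R.superalgebra s hs).bracket X Y).2), rfl⟩

theorem derived_superalgebra_iso_g (hR : R.IsOrthogonal) [NeZero (2 : k)] (hg : R.g.IsSimple)
    (h : ∀ x ∈ s, ∀ y ∈ s, ⁅x, y⁆ ∈ R.inder) :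
    (R.superalgebra s hs).derived.Iso R.g := by
  refine Superalgebra.derived_iso_of_injective (superInclusion hs) superInclusion_injective
    (fun i X => ?_) superInclusion_bracket (range_superInclusion hR hg h)
  rcases zmod2_cases i with rfl | rfl
  · simp [g, superalgebra, Submodule.mem_prod, superInclusion_apply]
  · simp only [g, superalgebra, superInclusion_apply, one_ne_zero, if_false, Submodule.mem_prod,
      Submodule.mem_bot, Submodule.mem_top, and_true, Prod.ext_iff, Subtype.ext_iff, Prod.fst_zero,
      Prod.snd_zero, ZeroMemClass.coe_zero]

end TripleSystem

/-! ### Inner derivations of the model inside `tri(C) ⊕ C³`. -/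

namespace HurwitzAlgebra

variable {k C : Type*} [Field k] [AddCommGroup C] [Module k C] (H : HurwitzAlgebra k C)
  [CharP k 3]

/-- The span of the triples `θⁱ(t_{x,y})`. -/
noncomputable def spanT : Submodule k H.para.tri :=
  ⨆ n, Submodule.span k {d | ∃ x y, d = H.para.thetaT n x y}

theorem thetaT_mem_spanT (n : Fin 3) (x y : C) : H.para.thetaT n x y ∈ H.spanT :=
  Submodule.mem_iSup_of_mem n (Submodule.subset_span ⟨x, y, rfl⟩)

theorem modelDer_mem_inder (x y : k × (Fin 3 → C)) :
    H.modelAct (H.modelDer x y) ∈ H.model.inder := H.model.triple_mem_inder x y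

/-- The vector `(1, 0)` paired with `(0, c)` gives exactly `c`, so all of `C³` is inner. -/
theorem modelAct_snd_mem_inder (c : Fin 3 → C) : H.modelAct (0, c) ∈ H.model.inder := by
  have h : H.modelDer (1, 0) (0, c) = (0, c) :=
    Prod.ext (by simp [modelDer_fst]) (funext fun i => by simp [modelDer_snd])
  rw [← h]
  exact H.modelDer_mem_inder _ _

/-- Two vectors in the same copy `n` of `C` give an inner derivation with `tri(C)` component
`θⁿ(t_{x,y})`; its `C³` component is inner and can be subtracted. -/
theorem modelAct_mem_inder {d : H.para.tri} (hd : d ∈ H.spanT) (c : Fin 3 → C) :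
    H.modelAct (d, c) ∈ H.model.inder := by
  have h : H.spanT ≤ H.model.inder.toSubmodule.comap
      (H.modelAct ∘ₗ LinearMap.inl k H.para.tri (Fin 3 → C)) := by
    refine iSup_le fun n => Submodule.span_le.2 ?_
    rintro _ ⟨x, y, rfl⟩
    have h1 : (H.modelDer (0, Pi.single n x) (0, Pi.single n y)).1 = H.para.thetaT n x y := by
      rw [modelDer_fst, Finset.sum_eq_single n (fun j _ hj => by simp [hj]) (by simp)]
      simp
    have h2 := sub_mem (H.modelDer_mem_inder (0, Pi.single n x) (0, Pi.single n y))
      (H.modelAct_snd_mem_inder (H.modelDer (0, Pi.single n x) (0, Pi.single n y)).2)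
    rw [← map_sub] at h2
    change H.modelAct (H.para.thetaT n x y, 0) ∈ H.model.inder
    convert h2 using 2
    exact Prod.ext (by rw [Prod.fst_sub, h1, sub_zero]) (by rw [Prod.snd_sub, sub_self])
  have h3 : ((d, c) : H.para.tri × (Fin 3 → C)) = (d, 0) + (0, c) := by simp
  rw [h3, map_add]
  exact add_mem (h hd) (H.modelAct_snd_mem_inder c)

theorem modelLie_eq_inder (h : H.spanT = ⊤) : H.modelLie = H.model.inder := by
  refine le_antisymm (fun f hf => ?_)
    (TripleSystem.inder_le_of_triple_mem H.model_triple_mem)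
  obtain ⟨p, rfl⟩ := H.mem_modelLie.1 hf
  exact H.modelAct_mem_inder (h ▸ Submodule.mem_top) p.2

theorem magic_iso_g [Nontrivial C] (h : H.spanT = ⊤) :
    (magic (s12 k) H.para).Iso H.tripleSystem.g :=
  (H.magic_iso_model.trans (TripleSystem.superalgebra_iso_g (H.modelLie_eq_inder h))).trans
    H.tripleSystem_g_iso.symm

/-- When `tri(C)` is abelian, the `tri(C)` component of a bracket in `s` is only `-∑ θⁿ(t)`, so `[s,
s]` consists of inner derivations even if `s` does not. -/
theorem magic_derived_iso_g [Nontrivial C] (h : ∀ d e, H.para.triBracket d e = 0) :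
    (magic (s12 k) H.para).derived.Iso H.tripleSystem.g := by
  refine (H.magic_iso_model.derived.trans (TripleSystem.derived_superalgebra_iso_g
    H.model_isOrthogonal H.model_g_isSimple fun x hx y hy => ?_)).trans H.tripleSystem_g_iso.symm
  obtain ⟨p, rfl⟩ := H.mem_modelLie.1 hx
  obtain ⟨q, rfl⟩ := H.mem_modelLie.1 hy
  rw [← modelAct_bracket]
  refine H.modelAct_mem_inder ?_ _
  rw [h, zero_sub]
  exact neg_mem (sum_mem fun n _ => H.thetaT_mem_spanT n _ _)

theorem form_skew_self {f : Module.End k C} (hf : ∀ x y, H.form (f x) y + H.form x (f y) = 0)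
    (x : C) : H.form (f x) x = 0 := by
  have h := hf x x
  rw [H.form_comm x, ← two_mul] at h
  exact (mul_eq_zero.1 h).resolve_left (NeZero.ne 2)

/-- Modulo the span of the triples `θⁱ(t_{x,y})`, the first component of a triple in `tri(C)` can be
taken to be zero. -/
theorem mem_spanT_of_apply_zero [FiniteDimensional k C]
    (h : ∀ d : H.para.tri, d.1 0 = 0 → d ∈ H.spanT) : H.spanT = ⊤ := by
  refine top_unique fun d _ => ?_
  let b := Module.finBasis k C
  let B : LinearMap.BilinForm k C := H.form
  have hB : B.Nondegenerate := H.nondegenerate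
  -- With dual bases, skewness of `d₀` gives `∑ σ_{bᵢ*, d₀ bᵢ} = 2 d₀`; hence the first component of
  -- `d + e` is `3 d₀ = 0`.
  let e : H.para.tri := ∑ i, H.para.thetaT 0 (B.dualBasis hB b i) (d.1 0 (b i))
  have he : e ∈ H.spanT := sum_mem fun i _ => H.thetaT_mem_spanT _ _ _
  have hexp : ∀ z, ∑ i, H.form (B.dualBasis hB b i) z • b i = z := fun z => by
    refine (Finset.sum_congr rfl fun i _ => ?_).trans (b.sum_repr z)
    congr 1
    conv_lhs => rw [← b.sum_repr z, map_sum]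
    have : ∀ j, H.form (B.dualBasis hB b i) (b j) = if j = i then 1 else 0 := fun j =>
      LinearMap.BilinForm.apply_dualBasis_left hB b i j
    simp [this]
  have hexp' : ∀ z, ∑ i, H.form z (b i) • B.dualBasis hB b i = z := fun z =>
    (Finset.sum_congr rfl fun i _ => by
      rw [LinearMap.BilinForm.dualBasis_repr_apply hB b z i]).trans ((B.dualBasis hB b).sum_repr z)
  have he0 : (d + e).1 0 = 0 := LinearMap.ext fun z => by
    have h1 : e.1 0 z = ∑ i, H.para.t (B.dualBasis hB b i) (d.1 0 (b i)) 0 z := by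
      simp only [e, AddSubmonoidClass.coe_finsetSum, Finset.sum_apply, LinearMap.sum_apply]
      rfl
    have h2 := congrArg (d.1 0) (hexp z)
    have h3 := hexp' (d.1 0 z)
    simp only [map_sum, map_smul, H.tri_skew] at h2 h3
    have h4 : (3 : k) • d.1 0 z = 0 := by rw [three_eq_zero, zero_smul]
    change d.1 0 z + e.1 0 z = 0
    simp only [h1, para_t_zero, Finset.sum_sub_distrib, h2]
    simp only [H.tri_skew, H.form_comm (b _), neg_smul, Finset.sum_neg_distrib] at h3 ⊢
    linear_combination (norm := module) h3 + h4
  have := sub_mem (h _ he0) he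
  rwa [add_sub_cancel_right] at this

end HurwitzAlgebra

end Supersquare

namespace Supersquare

/-! ### The triality algebras of `k × k`, `Mat₂(k)` and `C(k)`. -/

namespace HurwitzAlgebra

variable {k C : Type*} [Field k] [AddCommGroup C] [Module k C] (H : HurwitzAlgebra k C)
  [CharP k 3]

theorem para_mul_one (x : C) : H.para.mul x H.one = H.conj x := by
  rw [para_mul_apply, conj_one, H.mul_one]

theorem para_one_mul (x : C) : H.para.mul H.one x = H.conj x := by
  rw [para_mul_apply, conj_one, H.one_mul]

/-- A triple in `tri(C)` with first component `0` is given by a skew element of the middle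
nucleus. -/
theorem exists_of_apply_zero {d : H.para.tri} (hd : d.1 0 = 0) : ∃ a, H.form a H.one = 0 ∧
    (∀ x, d.1 1 x = H.mul a x) ∧ (∀ x, d.1 2 x = -H.mul x a) ∧
    ∀ x y, H.mul (H.mul x a) y = H.mul x (H.mul a y) := by
  -- The element is `a = d₁(1)`; as `d₁` is skew, `a` is orthogonal to `1`, and therefore its
  -- conjugate is `-a`.
  have ha : H.form (d.1 1 H.one) H.one = 0 :=
    H.form_skew_self ((H.mem_para_tri.1 d.2).1 1) H.one
  have hc : H.conj (d.1 1 H.one) = -d.1 1 H.one := by rw [conj_apply, ha, zero_smul, zero_sub]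
  -- With `d₀ = 0`, the triality relation led by `d₁` and with first factor `1` shows that `d₁` is a
  -- left multiplication. The relation led by `d₂` with second factor `1` does the same on the right
  -- below.
  have h1 : ∀ x, d.1 1 x = H.mul (H.conj (d.1 2 H.one)) x := fun x => by
    have := H.tri_mul d 1 H.one (H.conj x)
    simp only [Fin.reduceAdd, hd, LinearMap.zero_apply, map_zero, add_zero, para_one_mul,
      conj_conj] at this
    rw [this, para_mul_apply, conj_conj]
  have h1' : ∀ x, d.1 1 x = H.mul (d.1 1 H.one) x := fun x => by
    rw [h1, h1 H.one, H.mul_one]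
  have h2 : ∀ x, d.1 2 x = -H.mul x (d.1 1 H.one) := fun x => by
    have := H.tri_mul d 2 (H.conj x) H.one
    simp only [Fin.reduceAdd, hd, LinearMap.zero_apply, map_zero, zero_add, para_mul_one,
      conj_conj] at this
    rw [this, para_mul_apply, conj_conj, hc, map_neg]
  refine ⟨_, ha, h1', h2, fun x y => ?_⟩
  -- The remaining relation, led by `d₀ = 0`, says that multiplying by `a` on the right of `x` or on
  -- the left of `y` gives the same product: `a` is in the middle nucleus.
  have := H.tri_mul d 0 (H.conj x) (H.conj y)
  simp only [Fin.reduceAdd, zero_add, hd, LinearMap.zero_apply] at this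
  rw [h1', h2, para_mul_apply, para_mul_apply, conj_mul, conj_conj, conj_conj, map_neg, conj_mul,
    conj_conj, hc] at this
  simp only [map_neg, LinearMap.neg_apply, neg_neg] at this
  rw [eq_comm, neg_add_eq_zero] at this
  exact this

end HurwitzAlgebra

variable (k : Type*) [Field k] [CharP k 3]

open HurwitzAlgebra

theorem hurwitz2_form (x y : k × k) : (hurwitz2 k).form x y = x.1 * y.2 + y.1 * x.2 := by
  simp [form_apply, hurwitz2]
  ring

/-- On the hyperbolic plane a skew map is diagonal with entries `c, -c`, and such maps commute. -/
theorem hurwitz2_triBracket (d e : (hurwitz2 k).para.tri) :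
    (hurwitz2 k).para.triBracket d e = 0 := by
  have h : ∀ (d : (hurwitz2 k).para.tri) n, ∃ c : k, ∀ x, d.1 n x = (c * x.1, -(c * x.2)) :=
    fun d n => by
    have h1 := (hurwitz2 k).form_skew_self (((hurwitz2 k).mem_para_tri.1 d.2).1 n) (1, 0)
    have h2 := (hurwitz2 k).form_skew_self (((hurwitz2 k).mem_para_tri.1 d.2).1 n) (0, 1)
    have h3 := ((hurwitz2 k).mem_para_tri.1 d.2).1 n (1, 0) (0, 1)
    simp only [hurwitz2_form] at h1 h2 h3
    simp at h1 h2 h3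
    refine ⟨(d.1 n (1, 0)).1, fun x => ?_⟩
    have hx : x = x.1 • (1, 0) + x.2 • (0, 1) := by ext <;> simp
    conv_lhs => rw [hx]
    rw [map_add, map_smul, map_smul]
    ext
    · simp [h2, mul_comm]
    · simp [h1]
      linear_combination x.2 * h3
  refine Subtype.ext (funext fun n => LinearMap.ext fun x => ?_)
  obtain ⟨c, hc⟩ := h d n
  obtain ⟨c', hc'⟩ := h e n
  rw [triBracket_apply, hc, hc', hc, hc']
  refine Prod.ext ?_ ?_ <;> simp <;> ring

/-- The Cayley algebra is so far from associative that no nonzero skew element lies in the middle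
nucleus; hence a triple with first component zero is zero. -/
theorem hurwitz8_spanT : (hurwitz8 k).spanT = ⊤ := by
  refine mem_spanT_of_apply_zero _ fun d hd => ?_
  obtain ⟨a, h0, h1, h2, h⟩ := (hurwitz8 k).exists_of_apply_zero hd
  have ha : a = 0 := by
    obtain ⟨α, β, u, v⟩ := a
    -- Two tests of the nucleus condition suffice: the first gives `α = β` and kills `u 2`, `v 0`,
    -- `v 1`, the second kills `v 2`, `u 0`, `u 1`. Skewness, `α + β = 0`, finishes.
    have e1 := h (0, 0, Pi.single 0 1, 0) (0, 0, Pi.single 1 1, 0)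
    have e3 := h (0, 0, 0, Pi.single 0 1) (0, 0, 0, Pi.single 1 1)
    simp [hurwitz8, zornMul, cross_apply, Prod.ext_iff, Matrix.vecHead, Matrix.vecTail] at e1 e3
    simp [form_apply, hurwitz8, zornNorm_apply] at h0
    obtain ⟨u2, ⟨v1, v0⟩, rfl⟩ := e1
    obtain ⟨v2, -, -, u1, u0⟩ := e3
    have hβ : β = 0 := (mul_eq_zero.1 (by linear_combination h0 : (2 : k) * β = 0)).resolve_left
      (NeZero.ne 2)
    refine Prod.ext hβ (Prod.ext hβ (Prod.ext (funext fun i => ?_) (funext fun i => ?_))) <;>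
      fin_cases i
    exacts [u0, u1.symm, u2, v0, v1.symm, v2]
  have : d = 0 := Subtype.ext (funext fun n => LinearMap.ext fun x => by
    fin_cases n
    · simp [hd]
    · simp [h1, ha]
    · simp [h2, ha])
  rw [this]
  exact zero_mem _

theorem hurwitz4_conj (X : Matrix (Fin 2) (Fin 2) k) : (hurwitz4 k).conj X = X.adjugate := by
  rw [conj_apply, form_apply]
  ext i j
  fin_cases i <;> fin_cases j <;> simp [hurwitz4, detForm_apply, Matrix.det_fin_two,
    Matrix.adjugate_fin_two] <;> ring

/-- Conjugation in `Mat₂(k)` is the adjugate, and associativity turns all three components into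
one-sided multiplications, or a difference of two of them. -/
theorem hurwitz4_t (X Y Z : Matrix (Fin 2) (Fin 2) k) :
    (hurwitz4 k).para.t X Y 0 Z = Z * (X.adjugate * Y) - (X * Y.adjugate) * Z ∧ 
    (hurwitz4 k).para.t X Y 1 Z = -((hurwitz4 k).form X Y • Z) - Z * (Y * X.adjugate) ∧ 
    (hurwitz4 k).para.t X Y 2 Z = -((hurwitz4 k).form X Y • Z) - (X.adjugate * Y) * Z := by
  have hm : ∀ X Y, (hurwitz4 k).mul X Y = X * Y := fun _ _ => rfl
  refine ⟨?_, ?_, ?_⟩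
  · rw [para_t_zero]
    ext i j
    fin_cases i <;> fin_cases j <;> simp [form_apply, hurwitz4, detForm_apply, Matrix.det_fin_two,
      Matrix.mul_apply, Fin.sum_univ_two, Matrix.adjugate_fin_two,
      Matrix.vecMul, Matrix.vecHead, Matrix.vecTail] <;> ring
  · rw [para_t_one, para_mul_apply, para_mul_apply, HurwitzAlgebra.conj_mul,
      HurwitzAlgebra.conj_conj, HurwitzAlgebra.conj_conj, hm, hm, hurwitz4_conj, mul_assoc]
  · rw [para_t_two, para_mul_apply, para_mul_apply, HurwitzAlgebra.conj_mul,
      HurwitzAlgebra.conj_conj, HurwitzAlgebra.conj_conj, hm, hm, hurwitz4_conj, mul_assoc]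

/-- The last component of `t_{X,Y}` depends only on `X.adjugate * Y`, because `b(X, Y)` is the trace
of this product. Replacing `(X, Y)` by `(1, X.adjugate * Y)` and subtracting kills it, and leaves
`(0, L_c, -R_c)` with `c` a commutator. -/
theorem hurwitz4_thetaT_sub (X Y Z : Matrix (Fin 2) (Fin 2) k) :
    let d := (hurwitz4 k).para.thetaT 1 X Y - (hurwitz4 k).para.thetaT 1 1 (X.adjugate * Y)
    d.1 0 Z = 0 ∧ d.1 1 Z = (Y * X.adjugate - X.adjugate * Y) * Z ∧
      d.1 2 Z = -(Z * (Y * X.adjugate - X.adjugate * Y)) := by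
  refine ⟨?_, ?_, ?_⟩
  · change (hurwitz4 k).para.t X Y 2 Z - (hurwitz4 k).para.t 1 (X.adjugate * Y) 2 Z = _
    rw [(hurwitz4_t k _ _ _).2.2, (hurwitz4_t k _ _ _).2.2]
    ext i j
    fin_cases i <;> fin_cases j <;> simp [form_apply, hurwitz4, detForm_apply, Matrix.det_fin_two,
      Matrix.mul_apply, Fin.sum_univ_two, Matrix.adjugate_fin_two,
      Matrix.vecMul, Matrix.vecHead, Matrix.vecTail] <;> ring
  · change (hurwitz4 k).para.t X Y 0 Z - (hurwitz4 k).para.t 1 (X.adjugate * Y) 0 Z = _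
    rw [(hurwitz4_t k _ _ _).1, (hurwitz4_t k _ _ _).1]
    ext i j
    fin_cases i <;> fin_cases j <;> simp [Matrix.mul_apply, Fin.sum_univ_two,
      Matrix.adjugate_fin_two,
      Matrix.vecMul, Matrix.vecHead, Matrix.vecTail] <;> ring
  · change (hurwitz4 k).para.t X Y 1 Z - (hurwitz4 k).para.t 1 (X.adjugate * Y) 1 Z = _
    rw [(hurwitz4_t k _ _ _).2.1, (hurwitz4_t k _ _ _).2.1]
    ext i j
    fin_cases i <;> fin_cases j <;> simp [form_apply, hurwitz4, detForm_apply, Matrix.det_fin_two,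
      Matrix.mul_apply, Fin.sum_univ_two, Matrix.adjugate_fin_two,
      Matrix.vecMul, Matrix.vecHead, Matrix.vecTail] <;> ring

/-- Middle nucleus carries no condition in an associative algebra, so `a` is an arbitrary trace zero
matrix; it has to be a sum of commutators `Y * X.adjugate - X.adjugate * Y`. -/
theorem hurwitz4_spanT : (hurwitz4 k).spanT = ⊤ := by
  refine mem_spanT_of_apply_zero _ fun d hd => ?_
  obtain ⟨a, h0, h1, h2, -⟩ := (hurwitz4 k).exists_of_apply_zero hd
  have hmem : ∀ X Y, (hurwitz4 k).para.thetaT 1 X Y -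
      (hurwitz4 k).para.thetaT 1 1 (X.adjugate * Y) ∈ (hurwitz4 k).spanT := fun X Y =>
    sub_mem (thetaT_mem_spanT _ _ _ _) (thetaT_mem_spanT _ _ _ _)
  -- With `N = !![0, a 0 1; -a 1 0, 0]`, the commutator of the idempotent `!![1, 0; 0, 0]` with `N`
  -- is the off-diagonal part of `a`, and that of `!![0, a 0 0; 0, 0]` with `!![0, 0; 1, 0]` is its
  -- diagonal part. The first arguments below are the adjugates of `N` and of `!![0, 0; 1, 0]`.
  have key := add_mem (hmem !![0, -a 0 1; a 1 0, 0] !![1, 0; 0, 0])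
    (hmem !![0, 0; -1, 0] !![0, a 0 0; 0, 0])
  have ha : a 1 1 = -a 0 0 := by
    simp [form_apply, hurwitz4, detForm_apply, Matrix.det_fin_two] at h0
    linear_combination h0
  have e : ((!![1, 0; 0, 0] * !![0, a 0 1; -a 1 0, 0] - !![0, a 0 1; -a 1 0, 0] * !![1, 0; 0, 0]) +
      (!![0, a 0 0; 0, 0] * !![0, 0; 1, 0] - !![0, 0; 1, 0] * !![0, a 0 0; 0, 0]) :
        Matrix (Fin 2) (Fin 2) k) = a := by
    ext i j
    fin_cases i <;> fin_cases j <;> simp [ha]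
  convert key using 1
  refine Subtype.ext (funext fun n => LinearMap.ext fun Z => ?_)
  obtain ⟨f0, f1, f2⟩ := hurwitz4_thetaT_sub k !![0, -a 0 1; a 1 0, 0] !![1, 0; 0, 0] Z
  obtain ⟨g0, g1, g2⟩ := hurwitz4_thetaT_sub k !![0, 0; -1, 0] !![0, a 0 0; 0, 0] Z
  change _ = (_ : Module.End k _) Z + (_ : Module.End k _) Z
  have hm : ∀ X Y, (hurwitz4 k).mul X Y = X * Y := fun _ _ => rfl
  fin_cases n
  · refine Eq.trans ?_ (congrArg₂ _ f0 g0).symm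
    simp [hd]
  · refine Eq.trans ?_ (congrArg₂ _ f1 g1).symm
    simp only [Matrix.adjugate_fin_two_of, neg_neg, neg_zero, ← add_mul, e]
    exact h1 Z
  · refine Eq.trans ?_ (congrArg₂ _ f2 g2).symm
    simp only [Matrix.adjugate_fin_two_of, neg_neg, neg_zero, ← neg_add, ← mul_add, e]
    exact h2 Z

end Supersquare

namespace Supersquare

attribute [local instance] LieRing.ofAssociativeRing

/-! ### The case `C = k`: the model as the matrix algebra `Mat₂(k)`. -/

section Quaternions

variable {k : Type*} [Field k]

/-- The identification of `k × k³` with `Mat₂(k)` given by the quaternion units. -/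
def quatMat : (k × (Fin 3 → k)) →ₗ[k] Matrix (Fin 2) (Fin 2) k where
  -- The unit vector of `k` goes to `-1` and those of `k³` to `i = !![0, 1; -1, 0]`, `j = !![1, 1;
  -- 1, -1]` and `i * j`; all three have square `-1`, because `1 + 1 = -1`.
  toFun x := !![-x.1 + x.2 1 + x.2 2, x.2 0 + x.2 1 - x.2 2;
    -x.2 0 + x.2 1 - x.2 2, -x.1 - x.2 1 - x.2 2]
  map_add' x y := by
    ext i j
    fin_cases i <;> fin_cases j <;> simp <;> ring
  map_smul' c x := by
    ext i j
    fin_cases i <;> fin_cases j <;> simp <;> ring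

theorem quatMat_apply (x : k × (Fin 3 → k)) : quatMat x =
    !![-x.1 + x.2 1 + x.2 2, x.2 0 + x.2 1 - x.2 2;
      -x.2 0 + x.2 1 - x.2 2, -x.1 - x.2 1 - x.2 2] := rfl

variable [CharP k 3]

/-- The coordinates of a matrix with respect to the quaternion units. -/
def quatCoord (X : Matrix (Fin 2) (Fin 2) k) : k × (Fin 3 → k) :=
  (X 0 0 + X 1 1, ![X 1 0 - X 0 1, X 0 0 - X 1 1 + X 0 1 + X 1 0, X 0 0 - X 1 1 - X 0 1 - X 1 0])

theorem quatMat_quatCoord (X : Matrix (Fin 2) (Fin 2) k) : quatMat (quatCoord X) = X := by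
  ext i j
  fin_cases i <;> fin_cases j <;> simp [quatMat_apply, quatCoord] <;> rw [← sub_eq_zero] <;>
    ring_nf <;> reduce_mod_char!

theorem quatCoord_quatMat (x : k × (Fin 3 → k)) : quatCoord (quatMat x) = x := by
  refine Prod.ext ?_ (funext fun i => ?_)
  · simp [quatMat_apply, quatCoord]
    rw [← sub_eq_zero]
    ring_nf
    reduce_mod_char!
  · fin_cases i <;> simp [quatMat_apply, quatCoord] <;> rw [← sub_eq_zero] <;>
      ring_nf <;> reduce_mod_char!

theorem quatMat_injective : Function.Injective (quatMat (k := k)) :=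
  Function.LeftInverse.injective quatCoord_quatMat

theorem hurwitz1_form (x y : k) : (hurwitz1 k).form x y = -(x * y) := by
  simp [HurwitzAlgebra.form_apply, hurwitz1]
  rw [← sub_eq_zero]
  ring_nf
  reduce_mod_char!

theorem hurwitz1_mul (x y : k) : (hurwitz1 k).para.mul x y = x * y := by
  have h : ∀ x, (hurwitz1 k).conj x = x := fun x => by
    rw [HurwitzAlgebra.conj_apply, hurwitz1_form]
    simp [hurwitz1]
    rw [← sub_eq_zero]
    ring_nf
    reduce_mod_char!
  rw [HurwitzAlgebra.para_mul_apply, h, h]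
  rfl

theorem hurwitz1_tri (d : (hurwitz1 k).para.tri) : d = 0 := by
  refine Subtype.ext (funext fun n => LinearMap.ext_ring ?_)
  have := (hurwitz1 k).form_skew_self (((hurwitz1 k).mem_para_tri.1 d.2).1 n) 1
  rw [hurwitz1_form] at this
  simpa using this

/-- Here `tri(C) = 0`, and `s = k³` becomes `sl₂` acting on `Mat₂(k)` by left multiplication by pure
quaternions. -/
theorem quatMat_modelAct (p : (hurwitz1 k).para.tri × (Fin 3 → k)) (x : k × (Fin 3 → k)) :
    quatMat ((hurwitz1 k).modelAct p x) = quatMat (0, p.2) * quatMat x := by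
  have h0 := (hurwitz1 k).modelAct_snd p x 0
  have h1 := (hurwitz1 k).modelAct_snd p x 1
  have h2 := (hurwitz1 k).modelAct_snd p x 2
  simp only [hurwitz1_mul, hurwitz1_tri p.1, Fin.reduceAdd] at h0 h1 h2
  ext i j
  fin_cases i <;> fin_cases j <;>
    simp [quatMat_apply, HurwitzAlgebra.modelAct_fst, h0, h1, h2, hurwitz1_form,
      Fin.sum_univ_three] <;>
    rw [← sub_eq_zero] <;> ring_nf <;> reduce_mod_char!

theorem quatMat_modelBracket (p q : (hurwitz1 k).para.tri × (Fin 3 → k)) :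
    quatMat (0, ((hurwitz1 k).modelBracket p q).2) =
      quatMat (0, p.2) * quatMat (0, q.2) - quatMat (0, q.2) * quatMat (0, p.2) := by
  ext i j
  fin_cases i <;> fin_cases j <;>
    simp [quatMat_apply, HurwitzAlgebra.modelBracket, hurwitz1_tri p.1, hurwitz1_tri q.1,
      hurwitz1_mul] <;>
    rw [← sub_eq_zero] <;> ring_nf <;> reduce_mod_char!

/-- Since `-1/2 = 1`, adding the trace times `1` is the projection onto trace zero matrices; the
derivation attached to `x, y` is left multiplication by the pure part of `x ȳ`. -/
theorem quatMat_modelDer (x y : k × (Fin 3 → k)) :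
    quatMat (0, ((hurwitz1 k).modelDer x y).2) = quatMat x * (quatMat y).adjugate +
      (quatMat x * (quatMat y).adjugate).trace • 1 := by
  ext i j
  fin_cases i <;> fin_cases j <;>
    simp [quatMat_apply, HurwitzAlgebra.modelDer_snd, hurwitz1_mul, Matrix.adjugate_fin_two,
      Matrix.trace_fin_two] <;>
    rw [← sub_eq_zero] <;> ring_nf <;> reduce_mod_char!

theorem modelForm_eq_trace (x y : k × (Fin 3 → k)) :
    (hurwitz1 k).modelForm x y = (quatMat x * (quatMat y).adjugate).trace := by
  simp [quatMat_apply, HurwitzAlgebra.modelForm_apply, hurwitz1_form, Matrix.adjugate_fin_two,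
      Matrix.trace_fin_two, Fin.sum_univ_three]
  rw [← sub_eq_zero]
  ring_nf
  reduce_mod_char!

end Quaternions

/-! ### Block form of `gl_{2,2}(k)` and of its odd part. -/

section Blocks

variable {k : Type*} [Field k]

open Matrix

theorem matComp_fromBlocks (A B C D : Matrix (Fin 2) (Fin 2) k) :
    matComp k 0 (fromBlocks A B C D) = fromBlocks A 0 0 D ∧
      matComp k 1 (fromBlocks A B C D) = fromBlocks 0 B C 0 := by
  have h2 : (1 + 1 : ZMod 2) = 0 := rfl
  constructor <;> ext a b <;> rcases a with a | a <;> rcases b with b | b <;>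
    simp [matComp, indexParity, h2]

theorem gl22_bracket_fromBlocks (A B C D A' B' C' D' : Matrix (Fin 2) (Fin 2) k) :
    (gl22 k).bracket (fromBlocks A B C D) (fromBlocks A' B' C' D') =
      fromBlocks (A * A' - A' * A + (B * C' + B' * C)) (A * B' + B * D' - (A' * B + B' * D))
        (C * A' + D * C' - (C' * A + D' * C)) (D * D' - D' * D + (C * B' + C' * B)) := by
  rw [gl22_bracket]
  simp only [(matComp_fromBlocks _ _ _ _).1, (matComp_fromBlocks _ _ _ _).2, fromBlocks_multiply,
    sub_eq_add_neg, neg_add, fromBlocks_neg, fromBlocks_add]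
  congr 1 <;> simp <;> abel

theorem mem_gl22_part_zero (A B C D : Matrix (Fin 2) (Fin 2) k) :
    fromBlocks A B C D ∈ (gl22 k).part 0 ↔ B = 0 ∧ C = 0 := by
  constructor
  · rintro ⟨X, hX⟩
    rw [← fromBlocks_toBlocks X, (matComp_fromBlocks _ _ _ _).1, fromBlocks_inj] at hX
    exact ⟨hX.2.1.symm, hX.2.2.1.symm⟩
  · rintro ⟨rfl, rfl⟩
    exact ⟨_, (matComp_fromBlocks A 0 0 D).1⟩

theorem mem_gl22_part_one (A B C D : Matrix (Fin 2) (Fin 2) k) :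
    fromBlocks A B C D ∈ (gl22 k).part 1 ↔ A = 0 ∧ D = 0 := by
  constructor
  · rintro ⟨X, hX⟩
    rw [← fromBlocks_toBlocks X, (matComp_fromBlocks _ _ _ _).2, fromBlocks_inj] at hX
    exact ⟨hX.1.symm, hX.2.2.2.symm⟩
  · rintro ⟨rfl, rfl⟩
    exact ⟨_, (matComp_fromBlocks 0 B C 0).2⟩

theorem supertrace_fromBlocks (A B C D : Matrix (Fin 2) (Fin 2) k) :
    supertrace k (fromBlocks A B C D) = A.trace - D.trace := by
  simp [supertrace_apply, trace_fin_two]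
  ring

/-- The upper right block of the matrix that corresponds to an element of `V ⊗ Mat₂(k)`. -/
def upperBlock (X Y : Matrix (Fin 2) (Fin 2) k) : Matrix (Fin 2) (Fin 2) k :=
  !![-X 1 0, X 0 0; -Y 1 0, Y 0 0]

/-- The lower left block of the matrix that corresponds to an element of `V ⊗ Mat₂(k)`. -/
def lowerBlock (X Y : Matrix (Fin 2) (Fin 2) k) : Matrix (Fin 2) (Fin 2) k :=
  !![-Y 0 1, X 0 1; -Y 1 1, X 1 1]

end Blocks

end Supersquare

namespace Supersquare

attribute [local instance] LieRing.ofAssociativeRing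
attribute [local instance] subalgebraAddCommGroup subalgebraAddCommMonoid subalgebraAddGroup
  subalgebraSubNegMonoid subalgebraAddMonoid subalgebraAddZeroClass subalgebraAdd subalgebraZero
  subalgebraSub subalgebraNeg subalgebraModule subalgebraSMul
attribute [local instance 2000] Prod.instAddCommMonoid Prod.instAddCommGroup Prod.instModule

open Matrix

section Blocks

variable {k : Type*} [Field k]

theorem upperBlock_add (X Y X' Y' : Matrix (Fin 2) (Fin 2) k) :
    upperBlock (X + X') (Y + Y') = upperBlock X Y + upperBlock X' Y' := by
  ext i j
  fin_cases i <;> fin_cases j <;> simp [upperBlock] <;> ring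

theorem lowerBlock_add (X Y X' Y' : Matrix (Fin 2) (Fin 2) k) :
    lowerBlock (X + X') (Y + Y') = lowerBlock X Y + lowerBlock X' Y' := by
  ext i j
  fin_cases i <;> fin_cases j <;> simp [lowerBlock] <;> ring

theorem upperBlock_smul (c : k) (X Y : Matrix (Fin 2) (Fin 2) k) :
    upperBlock (c • X) (c • Y) = c • upperBlock X Y := by
  ext i j
  fin_cases i <;> fin_cases j <;> simp [upperBlock]

theorem lowerBlock_smul (c : k) (X Y : Matrix (Fin 2) (Fin 2) k) :
    lowerBlock (c • X) (c • Y) = c • lowerBlock X Y := by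
  ext i j
  fin_cases i <;> fin_cases j <;> simp [lowerBlock]

theorem upperBlock_sub (X Y X' Y' : Matrix (Fin 2) (Fin 2) k) :
    upperBlock (X - X') (Y - Y') = upperBlock X Y - upperBlock X' Y' := by
  rw [eq_sub_iff_add_eq, ← upperBlock_add, sub_add_cancel, sub_add_cancel]

theorem lowerBlock_sub (X Y X' Y' : Matrix (Fin 2) (Fin 2) k) :
    lowerBlock (X - X') (Y - Y') = lowerBlock X Y - lowerBlock X' Y' := by
  rw [eq_sub_iff_add_eq, ← lowerBlock_add, sub_add_cancel, sub_add_cancel]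

/-- First columns form a copy of `V ⊗ W`, read as maps `W → V` through `W ≅ W*`. That identification
is compatible only with trace zero matrices, hence the condition on `P`. In the lower block it is
`V` that is dualized, and the condition falls on `F`. -/
theorem upperBlock_act (F : Matrix (Fin 2) (Fin 2) k) {P : Matrix (Fin 2) (Fin 2) k}
    (hP : P.trace = 0) (X Y : Matrix (Fin 2) (Fin 2) k) :
    upperBlock (F 0 0 • X + F 0 1 • Y + P * X) (F 1 0 • X + F 1 1 • Y + P * Y) =
      F * upperBlock X Y - upperBlock X Y * P := by
  have h : P 1 1 = -P 0 0 := eq_neg_of_add_eq_zero_right (by rw [← trace_fin_two, hP])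
  ext i j
  fin_cases i <;> fin_cases j <;>
    simp [upperBlock, vecMul, vecHead, vecTail, Matrix.mul_apply, Fin.sum_univ_two, h] <;> ring

theorem lowerBlock_act {F : Matrix (Fin 2) (Fin 2) k} (hF : F.trace = 0)
    (P X Y : Matrix (Fin 2) (Fin 2) k) :
    lowerBlock (F 0 0 • X + F 0 1 • Y + P * X) (F 1 0 • X + F 1 1 • Y + P * Y) =
      P * lowerBlock X Y - lowerBlock X Y * F := by
  have h : F 1 1 = -F 0 0 := eq_neg_of_add_eq_zero_right (by rw [← trace_fin_two, hF])
  ext i j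
  fin_cases i <;> fin_cases j <;>
    simp [lowerBlock, vecMul, vecHead, vecTail, Matrix.mul_apply, Fin.sum_univ_two, h] <;> ring

/-- The scalar that corrects the brackets of odd elements. -/
def blockScalar (X Y : Matrix (Fin 2) (Fin 2) k) : k :=
  X 0 0 * Y 1 1 - X 1 0 * Y 0 1 - Y 0 0 * X 1 1 + Y 1 0 * X 0 1

variable [CharP k 3]

/-- In `sl_{2,2}` the diagonal blocks of an odd bracket need not have trace zero; here and in the
companion identity for the other block the deviation is the same scalar, so it disappears modulo
scalar matrices. -/
theorem upperBlock_mul_lowerBlock (X Y X' Y' : Matrix (Fin 2) (Fin 2) k) :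
    upperBlock X Y * lowerBlock X' Y' + upperBlock X' Y' * lowerBlock X Y =
      -!![-((X * Y'.adjugate).trace + (Y * X'.adjugate).trace), 2 * (X * X'.adjugate).trace;
        -(2 * (Y * Y'.adjugate).trace), (X * Y'.adjugate).trace + (Y * X'.adjugate).trace] -
      (blockScalar Y X' - blockScalar X Y') • 1 := by
  ext i j
  fin_cases i <;> fin_cases j <;>
    simp [upperBlock, lowerBlock, blockScalar, adjugate_fin_two, trace_fin_two, vecMul, vecHead,
      vecTail, Matrix.mul_apply, Fin.sum_univ_two] <;>
    rw [← sub_eq_zero] <;> ring_nf <;> reduce_mod_char!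

theorem lowerBlock_mul_upperBlock (X Y X' Y' : Matrix (Fin 2) (Fin 2) k) :
    lowerBlock X Y * upperBlock X' Y' + lowerBlock X' Y' * upperBlock X Y =
      X * Y'.adjugate + (X * Y'.adjugate).trace • 1 - (Y * X'.adjugate + (Y * X'.adjugate).trace •
        1) -
      (blockScalar Y X' - blockScalar X Y') • 1 := by
  ext i j
  fin_cases i <;> fin_cases j <;>
    simp [upperBlock, lowerBlock, blockScalar, adjugate_fin_two, trace_fin_two, vecMul, vecHead,
      vecTail, Matrix.mul_apply, Fin.sum_univ_two] <;>
    rw [← sub_eq_zero] <;> ring_nf <;> reduce_mod_char!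

end Blocks

/-! ### The isomorphism of the model for `C = k` with `psl_{2,2}(k)`. -/

variable (k : Type*) [Field k] [CharP k 3]

/-- The space `(sp(V) ⊕ k³) ⊕ (V ⊗ (k × k³))`. -/
abbrev QuatSpace := (spV k × (hurwitz1 k).modelLie) × (Fin 2 → k) ⊗[k] (k × (Fin 3 → k))

/-- The matrix in `sl_{2,2}(k)` that corresponds to an element of `QuatSpace k`. -/
noncomputable def matrixMap : QuatSpace k →ₗ[k] Mat22 k where
  toFun X := fromBlocks (LinearMap.toMatrix' X.1.1.1)
    (upperBlock (quatMat (tensorCoord 0 X.2)) (quatMat (tensorCoord 1 X.2)))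
    (lowerBlock (quatMat (tensorCoord 0 X.2)) (quatMat (tensorCoord 1 X.2)))
    -- The element `c` of `s = k³` is recovered from the endomorphism it defines: its value at `(1,
    -- 0)` has second component `-c`.
    (quatMat (0, -(X.1.2.1 (1, 0)).2))
  map_add' X Y := by
    rw [fromBlocks_add, fromBlocks_inj]
    refine ⟨map_add LinearMap.toMatrix' _ _, ?_, ?_, ?_⟩
    · simp only [Prod.snd_add, map_add, upperBlock_add]
    · simp only [Prod.snd_add, map_add, lowerBlock_add]
    · rw [← map_add]
      refine congrArg _ (Prod.ext (add_zero 0).symm ?_)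
      change -(X.1.2.1 (1, 0) + Y.1.2.1 (1, 0)).2 = _
      rw [Prod.snd_add, neg_add]
      rfl
  map_smul' c X := by
    rw [RingHom.id_apply, fromBlocks_smul, fromBlocks_inj]
    refine ⟨map_smul LinearMap.toMatrix' _ _, ?_, ?_, ?_⟩
    · simp only [Prod.smul_snd, map_smul, upperBlock_smul]
    · simp only [Prod.smul_snd, map_smul, lowerBlock_smul]
    · rw [← map_smul]
      refine congrArg _ (Prod.ext (smul_zero c).symm ?_)
      change -(c • X.1.2.1 (1, 0)).2 = _
      exact (smul_neg c _).symm

theorem matrixMap_apply (f : spV k) (p : (hurwitz1 k).para.tri × (Fin 3 → k))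
    (x : Fin 2 → k × (Fin 3 → k)) :
    matrixMap k ((f, (hurwitz1 k).modelLieMap p), ofTensorCoord x) =
      fromBlocks (LinearMap.toMatrix' f.1) (upperBlock (quatMat (x 0)) (quatMat (x 1)))
        (lowerBlock (quatMat (x 0)) (quatMat (x 1))) (quatMat (0, p.2)) := by
  change fromBlocks (LinearMap.toMatrix' f.1) (upperBlock (quatMat (tensorCoord 0 (ofTensorCoord
    x)))
    (quatMat (tensorCoord 1 (ofTensorCoord x)))) (lowerBlock (quatMat (tensorCoord 0 (ofTensorCoord
      x)))
    (quatMat (tensorCoord 1 (ofTensorCoord x))))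
    (quatMat (0, -((hurwitz1 k).modelAct p (1, 0)).2)) = _
  have h : -((hurwitz1 k).modelAct p (1, 0)).2 = p.2 := funext fun i => by
    simp [HurwitzAlgebra.modelAct_snd]
  rw [h, tensorCoord_ofTensorCoord, tensorCoord_ofTensorCoord]

theorem quatSpace_cases (X : QuatSpace k) : ∃ f p x,
    X = ((f, (hurwitz1 k).modelLieMap p), ofTensorCoord x) := by
  obtain ⟨⟨f, g, hg⟩, Z⟩ := X
  obtain ⟨p, rfl⟩ := (hurwitz1 k).mem_modelLie.1 hg
  exact ⟨f, p, fun i => tensorCoord i Z, Prod.ext rfl (tensor_ext fun i => by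
    rw [tensorCoord_ofTensorCoord])⟩

theorem toMatrix_spV (f : spV k) : (LinearMap.toMatrix' f.1).trace = 0 := by
  rw [trace_fin_two, LinearMap.toMatrix'_apply, LinearMap.toMatrix'_apply]
  have := spV_trace f
  simpa [Pi.single] using this

theorem quatMat_trace (c : Fin 3 → k) : (quatMat (0, c)).trace = 0 := by
  simp [quatMat_apply, trace_fin_two]

theorem matrixMap_mem (X : QuatSpace k) : matrixMap k X ∈ LinearMap.ker (supertrace k) := by
  change supertrace k (fromBlocks _ _ _ _) = 0
  rw [supertrace_fromBlocks, toMatrix_spV, quatMat_trace, sub_zero]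

theorem toMatrix_sum_gamma (c : Fin 2 → Fin 2 → k) :
    LinearMap.toMatrix' (∑ i, ∑ j, c i j • gamma k (Pi.single i 1) (Pi.single j 1)).1 =
      !![-(c 0 1 + c 1 0), 2 * c 0 0; -(2 * c 1 1), c 0 1 + c 1 0] := by
  ext i j
  rw [LinearMap.toMatrix'_apply]
  simp only [Fin.sum_univ_two, AddMemClass.coe_add, SetLike.val_smul, LinearMap.add_apply,
    LinearMap.smul_apply, gamma_apply, symp_apply]
  fin_cases i <;> fin_cases j <;> simp <;> ring

theorem toMatrix_lie_sub (f g : spV k) (c : Fin 2 → Fin 2 → k) :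
    LinearMap.toMatrix' (⁅f, g⁆ - ∑ i, ∑ j, c i j • gamma k (Pi.single i 1) (Pi.single j 1)).1 =
      LinearMap.toMatrix' f.1 * LinearMap.toMatrix' g.1 -
        LinearMap.toMatrix' g.1 * LinearMap.toMatrix' f.1 -
      !![-(c 0 1 + c 1 0), 2 * c 0 0; -(2 * c 1 1), c 0 1 + c 1 0] := by
  rw [← toMatrix_sum_gamma, ← LinearMap.toMatrix'_mul, ← LinearMap.toMatrix'_mul, ← map_sub,
    ← map_sub]
  rfl

/-- The image always has trace zero diagonal blocks, so it cannot match the bracket of `gl_{2,2}`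
exactly; the two differ by a scalar matrix, nonzero only through brackets of odd elements. -/
theorem exists_matrixMap_bracket (X Y : QuatSpace k) : ∃ c : k,
    matrixMap k ((hurwitz1 k).modelSuper.bracket X Y) =
      (gl22 k).bracket (matrixMap k X) (matrixMap k Y) + c • 1 := by
  obtain ⟨f, p, x, rfl⟩ := quatSpace_cases k X
  obtain ⟨g, q, y, rfl⟩ := quatSpace_cases k Y
  refine ⟨blockScalar (quatMat (x 1)) (quatMat (y 0)) - blockScalar (quatMat (x 0)) (quatMat (y 1)),
    ?_⟩
  have hq : ∀ i, quatMat (f.1 (Pi.single 0 1) i • y 0 + f.1 (Pi.single 1 1) i • y 1 +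
        (hurwitz1 k).modelAct p (y i) - (g.1 (Pi.single 0 1) i • x 0 + g.1 (Pi.single 1 1) i • x 1 +
        (hurwitz1 k).modelAct q (x i))) = LinearMap.toMatrix' f.1 i 0 • quatMat (y 0) +
      LinearMap.toMatrix' f.1 i 1 • quatMat (y 1) + quatMat (0, p.2) * quatMat (y i) -
      (LinearMap.toMatrix' g.1 i 0 • quatMat (x 0) + LinearMap.toMatrix' g.1 i 1 • quatMat (x 1) +
        quatMat (0, q.2) * quatMat (x i)) := fun i => by
    simp only [map_add, map_sub, map_smul, quatMat_modelAct, LinearMap.toMatrix'_apply]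
  rw [HurwitzAlgebra.modelSuper_bracket, matrixMap_apply, matrixMap_apply, matrixMap_apply,
    gl22_bracket_fromBlocks, ← fromBlocks_one, fromBlocks_smul, fromBlocks_add, fromBlocks_inj,
      hq, hq,
    upperBlock_sub, lowerBlock_sub, upperBlock_act _ (quatMat_trace k p.2),
    upperBlock_act _ (quatMat_trace k q.2), lowerBlock_act (toMatrix_spV k f),
    lowerBlock_act (toMatrix_spV k g), upperBlock_mul_lowerBlock, lowerBlock_mul_upperBlock]
  refine ⟨?_, ?_, ?_, ?_⟩
  · refine (toMatrix_lie_sub k f g _).trans ?_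
    simp only [modelForm_eq_trace]
    module
  · rw [smul_zero]
    abel
  · rw [smul_zero]
    abel
  · have h : ((0 : k), ((hurwitz1 k).modelBracket p q +
      ((hurwitz1 k).modelDer (x 0) (y 1) - (hurwitz1 k).modelDer (x 1) (y 0))).2) =
        (0, ((hurwitz1 k).modelBracket p q).2) + ((0, ((hurwitz1 k).modelDer (x 0) (y 1)).2) -
        (0, ((hurwitz1 k).modelDer (x 1) (y 0)).2)) := by simp
    rw [h, map_add, map_sub, quatMat_modelBracket, quatMat_modelDer, quatMat_modelDer]
    module

theorem quatMat_eq_zero {x : k × (Fin 3 → k)} (h : quatMat x = 0) : x = 0 :=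
  quatMat_injective (h.trans (map_zero _).symm)

theorem quatMat_of_trace {D : Matrix (Fin 2) (Fin 2) k} (h : D.trace = 0) :
    quatMat (0, (quatCoord D).2) = D := by
  conv_rhs => rw [← quatMat_quatCoord D]
  refine congrArg _ (Prod.ext ?_ rfl)
  change 0 = D 0 0 + D 1 1
  rw [← trace_fin_two, h]

theorem mem_spV_of_trace {A : Matrix (Fin 2) (Fin 2) k} (h : A.trace = 0) :
    Matrix.toLin' A ∈ spV k := by
  rw [mem_spV]
  intro x y
  rw [trace_fin_two] at h
  simp only [symp_apply, Matrix.toLin'_apply, mulVec, Matrix.vec2_dotProduct]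
  linear_combination (x 0 * y 1 - x 1 * y 0) * h

/-- The linear map to `psl_{2,2}(k)` induced by `matrixMap`. -/
noncomputable def pslMap : QuatSpace k →ₗ[k] LinearMap.ker (supertrace k) ⧸ scalars22 k :=
  (scalars22 k).mkQ ∘ₗ (matrixMap k).codRestrict _ (matrixMap_mem k)

variable {k}

theorem mem_scalars22 {Y : LinearMap.ker (supertrace k)} :
    Y ∈ scalars22 k ↔ ∃ c : k, c • 1 = Y.1 := Submodule.mem_span_singleton

theorem pslMap_eq_mk {X : QuatSpace k} {Y : LinearMap.ker (supertrace k)} :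
    pslMap k X = (scalars22 k).mkQ Y ↔ ∃ c : k, matrixMap k X = Y.1 + c • 1 := by
  refine (Submodule.Quotient.eq _).trans (mem_scalars22.trans ⟨?_, ?_⟩)
  · rintro ⟨c, hc⟩
    exact ⟨c, by rw [hc]; exact (add_sub_cancel _ _).symm⟩
  · rintro ⟨c, hc⟩
    exact ⟨c, eq_sub_of_add_eq' hc.symm⟩

/-- The scalar `2 × 2` matrix `c` has trace `2 c`. This is why the map to the quotient by scalars
loses nothing: `sl₂ × sl₂` meets the scalars trivially. -/
theorem eq_zero_of_trace_eq_zero {A : Matrix (Fin 2) (Fin 2) k} {c : k} (hA : A.trace = 0)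
    (h : A = c • 1) : c = 0 := by
  have : (c • (1 : Matrix (Fin 2) (Fin 2) k)).trace = 0 := h ▸ hA
  rw [trace_smul, trace_one, smul_eq_mul] at this
  exact (mul_eq_zero.1 this).resolve_right (by simpa using NeZero.ne (2 : k))

theorem upperBlock_lowerBlock_eq_zero {X Y : Matrix (Fin 2) (Fin 2) k} (h : upperBlock X Y = 0)
    (h' : lowerBlock X Y = 0) : X = 0 ∧ Y = 0 := by
  have e := fun i j => congrFun (congrFun h i) j
  have e' := fun i j => congrFun (congrFun h' i) j
  simp [Fin.forall_fin_two, upperBlock, lowerBlock] at e e'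
  constructor <;> ext i j <;> fin_cases i <;> fin_cases j <;> simp [e, e']

theorem even_of_matrixMap {X : QuatSpace k} {c : k} {A D : Matrix (Fin 2) (Fin 2) k}
    (h : matrixMap k X = fromBlocks A 0 0 D + c • 1) : X.2 = 0 := by
  obtain ⟨f, p, x, rfl⟩ := quatSpace_cases k X
  rw [matrixMap_apply, ← fromBlocks_one, fromBlocks_smul, fromBlocks_add, fromBlocks_inj] at h
  obtain ⟨h0, h1⟩ := upperBlock_lowerBlock_eq_zero (h.2.1.trans (by simp)) (h.2.2.1.trans (by simp))
  refine tensor_ext fun i => ?_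
  rw [tensorCoord_ofTensorCoord, map_zero]
  fin_cases i
  · exact quatMat_eq_zero k h0
  · exact quatMat_eq_zero k h1

theorem odd_of_matrixMap {X : QuatSpace k} {c : k} {B C : Matrix (Fin 2) (Fin 2) k}
    (h : matrixMap k X = fromBlocks 0 B C 0 + c • 1) : X.1 = 0 := by
  obtain ⟨f, p, x, rfl⟩ := quatSpace_cases k X
  rw [matrixMap_apply, ← fromBlocks_one, fromBlocks_smul, fromBlocks_add, fromBlocks_inj] at h
  obtain ⟨h0, -, -, h1⟩ := h
  rw [zero_add] at h0 h1
  have hc := eq_zero_of_trace_eq_zero (toMatrix_spV k f) h0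
  rw [hc, zero_smul] at h0 h1
  have hp : p = 0 := Prod.ext (hurwitz1_tri p.1) (Prod.ext_iff.1 (quatMat_eq_zero k h1)).2
  refine Prod.ext (Subtype.ext (LinearMap.toMatrix'.injective (h0.trans (map_zero _).symm))) ?_
  rw [hp]
  exact map_zero _

theorem pslMap_injective : Function.Injective (pslMap k) := by
  refine (injective_iff_map_eq_zero _).2 fun X h => ?_
  obtain ⟨c, hc⟩ := pslMap_eq_mk.1 (h.trans (map_zero (scalars22 k).mkQ).symm)
  have h0 : matrixMap k X = fromBlocks 0 0 0 0 + c • 1 := by rw [hc, fromBlocks_zero]; rfl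
  exact Prod.ext (odd_of_matrixMap h0) (even_of_matrixMap h0)

theorem exists_matrixMap_eq {A D : Matrix (Fin 2) (Fin 2) k} (hA : A.trace = 0) (hD : D.trace = 0)
    (B C : Matrix (Fin 2) (Fin 2) k) : ∃ X, matrixMap k X = fromBlocks A B C D := by
  -- The two matrices are obtained by solving the definitions of the upper and lower blocks for
  -- their entries: first columns from `B`, second columns from `C`.
  refine ⟨((⟨_, mem_spV_of_trace k hA⟩, (hurwitz1 k).modelLieMap (0, (quatCoord D).2)),
    ofTensorCoord ![quatCoord !![B 0 1, C 0 1; -B 0 0, C 1 1],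
      quatCoord !![B 1 1, -C 0 0; -B 1 0, -C 1 0]]), ?_⟩
  rw [matrixMap_apply, fromBlocks_inj, quatMat_of_trace k hD]
  refine ⟨LinearMap.toMatrix'_toLin' A, ?_, ?_, rfl⟩
  · ext i j
    fin_cases i <;> fin_cases j <;> simp [quatMat_quatCoord, upperBlock]
  · ext i j
    fin_cases i <;> fin_cases j <;> simp [quatMat_quatCoord, lowerBlock]

theorem pslMap_surjective : Function.Surjective (pslMap k) := by
  intro y
  obtain ⟨⟨Y, hY⟩, rfl⟩ := (scalars22 k).mkQ_surjective y
  obtain ⟨A, B, C, D, rfl⟩ : ∃ A B C D, Y = fromBlocks A B C D := ⟨_, _, _, _,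
    (fromBlocks_toBlocks Y).symm⟩
  have h2 : (2 : k) = -1 := by
    rw [eq_neg_iff_add_eq_zero]
    exact (by norm_num : (2 : k) + 1 = 3).trans (three_eq_zero k)
  have h : A.trace = D.trace := by
    have : supertrace k (fromBlocks A B C D) = 0 := hY
    rwa [supertrace_fromBlocks, sub_eq_zero] at this
  -- Adding the scalar `tr M` to a `2 × 2` matrix makes its trace `3 tr M = 0`. Supertrace zero
  -- means that both diagonal blocks have equal trace, so a single scalar corrects both.
  have h1 : ∀ M : Matrix (Fin 2) (Fin 2) k, (M + M.trace • 1).trace = 0 := fun M => by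
    simp [h2]
  obtain ⟨X, hX⟩ := exists_matrixMap_eq (h1 A) (h1 D) B C
  refine ⟨X, pslMap_eq_mk.2 ⟨A.trace, ?_⟩⟩
  rw [hX, ← fromBlocks_one, fromBlocks_smul, fromBlocks_add, h]
  simp

theorem pslMap_mem_part (i : ZMod 2) (X : QuatSpace k) :
    pslMap k X ∈ (psl22 k).part i ↔ X ∈ (hurwitz1 k).modelSuper.part i := by
  have hp : pslMap k X ∈ (psl22 k).part i ↔
      ∃ Y : LinearMap.ker (supertrace k), Y.1 ∈ (gl22 k).part i ∧ ∃ c : k,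
        matrixMap k X = Y.1 + c • 1 :=
    ⟨fun ⟨Y, h1, h2⟩ => ⟨Y, h1, pslMap_eq_mk.1 h2.symm⟩,
      fun ⟨Y, h1, h2⟩ => ⟨Y, h1, (pslMap_eq_mk.2 h2).symm⟩⟩
  rw [hp]
  rcases zmod2_cases i with rfl | rfl
  · have hB : X ∈ (hurwitz1 k).modelSuper.part 0 ↔ X.2 = 0 := by
      simp [HurwitzAlgebra.modelSuper, TripleSystem.superalgebra, Submodule.mem_prod]
    rw [hB]
    constructor
    · rintro ⟨⟨Y, hY₀⟩, hY, c, hc⟩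
      obtain ⟨A, B, C, D, rfl⟩ : ∃ A B C D, Y = fromBlocks A B C D :=
        ⟨_, _, _, _, (fromBlocks_toBlocks Y).symm⟩
      obtain ⟨rfl, rfl⟩ := (mem_gl22_part_zero A B C D).1 hY
      exact even_of_matrixMap hc
    · intro h
      refine ⟨⟨_, matrixMap_mem k X⟩, (mem_gl22_part_zero _ _ _ _).2 ?_, 0, by simp⟩
      rw [h, map_zero, map_zero, map_zero]
      exact ⟨by simpa using upperBlock_smul (0 : k) 0 0, by simpa using lowerBlock_smul (0 : k) 0 0⟩
  · have hB : X ∈ (hurwitz1 k).modelSuper.part 1 ↔ X.1 = 0 := by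
      simp [HurwitzAlgebra.modelSuper, TripleSystem.superalgebra, Submodule.mem_prod]
    rw [hB]
    constructor
    · rintro ⟨⟨Y, hY₀⟩, hY, c, hc⟩
      obtain ⟨A, B, C, D, rfl⟩ : ∃ A B C D, Y = fromBlocks A B C D :=
        ⟨_, _, _, _, (fromBlocks_toBlocks Y).symm⟩
      obtain ⟨rfl, rfl⟩ := (mem_gl22_part_one A B C D).1 hY
      exact odd_of_matrixMap hc
    · intro h
      obtain ⟨f, p, x, rfl⟩ := quatSpace_cases k X
      have hf : f = 0 := congrArg Prod.fst h
      have hp : p = 0 := (hurwitz1 k).modelAct_injective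
        ((congrArg (fun a => a.2.1) h).trans (map_zero _).symm)
      have hm : matrixMap k ((f, (hurwitz1 k).modelLieMap p), ofTensorCoord x) ∈
          (gl22 k).part 1 := by
        rw [matrixMap_apply, mem_gl22_part_one, hf, hp]
        exact ⟨map_zero LinearMap.toMatrix', map_zero quatMat⟩
      exact ⟨⟨_, matrixMap_mem k _⟩, hm, 0, by simp⟩

theorem pslMap_bracket (X Y : QuatSpace k) :
    pslMap k ((hurwitz1 k).modelSuper.bracket X Y) =
      (psl22 k).bracket (pslMap k X) (pslMap k Y) := by
  obtain ⟨c, hc⟩ := exists_matrixMap_bracket k X Y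
  exact pslMap_eq_mk (Y := (sl22 k).bracket ⟨_, matrixMap_mem k X⟩ ⟨_, matrixMap_mem k Y⟩) |>.2 ⟨c,
    hc⟩

theorem modelSuper_iso_psl22 : (hurwitz1 k).modelSuper.Iso (psl22 k) :=
  ⟨LinearEquiv.ofBijective _ ⟨pslMap_injective, pslMap_surjective⟩, pslMap_mem_part, pslMap_bracket⟩

end Supersquare

open Supersquare
theorem mainTheorem7 {k : Type*} [Field k] [IsAlgClosed k] [CharP k 3] :
    ((magic (s12 k) (hurwitz1 k).para).IsLie ∧
      (magic (s12 k) (hurwitz1 k).para).Iso (psl22 k)) ∧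
    ((magic (s12 k) (hurwitz2 k).para).IsLie ∧
      (hurwitz2 k).tripleSystem.IsOrthogonal ∧
      (hurwitz2 k).tripleSystem.g.IsLie ∧
      (hurwitz2 k).tripleSystem.g.IsSimple ∧
      (magic (s12 k) (hurwitz2 k).para).derived.Iso (hurwitz2 k).tripleSystem.g) ∧
    ((magic (s12 k) (hurwitz4 k).para).IsLie ∧
      (hurwitz4 k).tripleSystem.IsOrthogonal ∧
      (hurwitz4 k).tripleSystem.g.IsLie ∧
      (hurwitz4 k).tripleSystem.g.IsSimple ∧
      (magic (s12 k) (hurwitz4 k).para).Iso (hurwitz4 k).tripleSystem.g) ∧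
    ((magic (s12 k) (hurwitz8 k).para).IsLie ∧
      (hurwitz8 k).tripleSystem.IsOrthogonal ∧
      (hurwitz8 k).tripleSystem.g.IsLie ∧
      (hurwitz8 k).tripleSystem.g.IsSimple ∧
      (magic (s12 k) (hurwitz8 k).para).Iso (hurwitz8 k).tripleSystem.g) :=
  ⟨⟨(hurwitz1 k).magic_isLie, (hurwitz1 k).magic_iso_model.trans modelSuper_iso_psl22⟩,
    ⟨(hurwitz2 k).magic_isLie, (hurwitz2 k).tripleSystem_isOrthogonal,
      (hurwitz2 k).tripleSystem_g_isLie, (hurwitz2 k).tripleSystem_g_isSimple,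
      (hurwitz2 k).magic_derived_iso_g (hurwitz2_triBracket k)⟩,
    ⟨(hurwitz4 k).magic_isLie, (hurwitz4 k).tripleSystem_isOrthogonal,
      (hurwitz4 k).tripleSystem_g_isLie, (hurwitz4 k).tripleSystem_g_isSimple,
      (hurwitz4 k).magic_iso_g (hurwitz4_spanT k)⟩,
    ⟨(hurwitz8 k).magic_isLie, (hurwitz8 k).tripleSystem_isOrthogonal,
      (hurwitz8 k).tripleSystem_g_isLie, (hurwitz8 k).tripleSystem_g_isSimple,
      (hurwitz8 k).magic_iso_g (hurwitz8_spanT k)⟩⟩
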